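/- **Setting.** Let $K$ linear dynamical systems on $\mathbb R^d$ be given by $(A^{(k)},W^{(k)})$, $1\le k\le K$, with $W^{(k)}\succ 0$. Set $\Gamma^{(k)}=\sum_{t\ge 0}(A^{(k)})^tW^{(k)}((A^{(k)})^t)^\top$ and $Y^{(k)}=A^{(k)}\Gamma^{(k)}$. Let $\kappa_A\ge 1$, $0\le\rho<1$, $\Gamma_{\max}$ and $\Delta_{\Gamma,Y}>0$ be such that $\|(A^{(k)})^t\|\le\kappa_A\rho^t$ for all $t\ge 1$ and all $k$, $\|\Gamma^{(k)}\|\le\Gamma_{\max}$ for all $k$ (spectral norms), and $\|\Gamma^{(k)}-\Gamma^{(\ell)}\|_F^2+\|Y^{(k)}-Y^{(\ell)}\|_F^2\ge\Delta_{\Gamma,Y}^2$ for all $k\ne\ell$. Let $x_{m,t}\in\mathbb R^d$, $1\le m\le M$, be trajectories with fixed labels $k_m\in\{1,\dots,K\}$ and lengths $T_m$, satisfying $x_{m,t+1}=A^{(k_m)}x_{m,t}+w_{m,t}$ for $0\le t\le T_m$, where the $w_{m,t}\sim\mathcal N(0,W^{(k_m)})$ are independent. Suppose that either (Case 0) $x_{m,0}=0$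 for all $m$, or (Case 1) $x_{1,0}=0$, $x_{m+1,0}=x_{m,T_m}$ for $1\le m<M$, and $T_m\ge\frac1{1-\rho}\log(\sqrt2\,\kappa_A)$ for all $m$. Let $T_{\mathrm{total}}=\sum_m T_m$, and let $\mathcal M\subset\{1,\dots,M\}$ be a set of trajectories to be clustered, all of the same length $T_m=T$, $m\in\mathcal M$. **Pairwise test.** Given matrices $V_i,U_i\in\mathbb R^{d\times K}$ ($1\le i\le d$) with orthonormal columns, a threshold $\tau$ and a number of copies $G$, let $n_0=\lfloor T/(4G)\rfloor$, $\Omega_{g,1}=\{(4g-3)n_0+j:1\le j\le n_0\}$, $\Omega_{g,2}=\{(4g-1)n_0+j:1\le j\le n_0\}$ for $1\le g\le G$, and $$h_{m,i,g,j}=\frac1{n_0}\sum_{t\in\Omega_{g,j}}(x_{m,t})_i\,x_{m,t},\qquad g_{m,i,g,j}=\frac1{n_0}\sum_{t\in\Omega_{g,j}}(x_{m,t+1})_i\,x_{m,t}.$$ For $m,n\in\mathcal M$ put $$\mathrm{stat}_{\Gamma,g}=\sum_{i=1}^d\big\langle V_i^\top(h_{m,i,g,1}-h_{n,i,g,1}),V_i^\top(h_{m,i,g,2}-h_{n,i,g,2})\big\rangle,$$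 $$\mathrm{stat}_{Y,g}=\sum_{i=1}^d\big\langle U_i^\top(g_{m,i,g,1}-g_{n,i,g,1}),U_i^\top(g_{m,i,g,2}-g_{n,i,g,2})\big\rangle,$$ and let $S_{m,n}=1$ if $\mathrm{median}_{1\le g\le G}\,\mathrm{stat}_{\Gamma,g}+\mathrm{median}_{1\le g\le G}\,\mathrm{stat}_{Y,g}\le\tau$, and $S_{m,n}=0$ otherwise. **Theorem.** There are universal constants $C_1,C_2,c_3>0$ such that the following holds in this setting for every $0<\delta<1$. Suppose that * $1/8<\tau/\Delta_{\Gamma,Y}^2<3/8$; * $T=NG$ with $N>0$, where $$G\ge C_1\log\frac{|\mathcal M|}{\delta},\qquad N\ge C_2\Big(\frac{\Gamma_{\max}^2\kappa_A^2\sqrt{dK}}{\Delta_{\Gamma,Y}^2}+1\Big)\frac1{1-\rho}\log\Big(\Big(\frac{\Gamma_{\max}}{\Delta_{\Gamma,Y}}+2\Big)\frac{d\,\kappa_A\,T_{\mathrm{total}}}{\delta}\Big);$$ * the (possibly random) matrices $\{V_i,U_i\}_{1\le i\le d}$ are independent of the trajectories $\{x_{m,t}:m\in\mathcal M,\ 0\le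 t\le T+1\}$, and almost surely have orthonormal columns and satisfy, for all $1\le i\le d$ and $1\le k\le K$, $$\max\big\{\|\Gamma^{(k)}_i-V_iV_i^\top\Gamma^{(k)}_i\|_2,\ \|Y^{(k)}_i-U_iU_i^\top Y^{(k)}_i\|_2\big\}\le c_3\frac{\Delta_{\Gamma,Y}}{\sqrt d},$$ where $\Gamma^{(k)}_i$, $Y^{(k)}_i$ denote the transposed $i$-th rows of $\Gamma^{(k)}$, $Y^{(k)}$. Then with probability at least $1-\delta$ the clustering is exact: for all $m,n\in\mathcal M$, $S_{m,n}=1$ if and only if $k_m=k_n$. -/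

import Mathlib

open MeasureTheory ProbabilityTheory Matrix

namespace MixedLDS

noncomputable section

/-- Spectral norm of a square real matrix: its operator norm on Euclidean space. -/
def specNorm {d : ℕ} (X : Matrix (Fin d) (Fin d) ℝ) : ℝ :=
  ‖Matrix.toEuclideanCLM (𝕜 := ℝ) X‖

/-- Squared Frobenius norm. -/
def frobSq {d : ℕ} (X : Matrix (Fin d) (Fin d) ℝ) : ℝ :=
  ∑ i, ∑ j, X i j ^ 2

/-- Order-0 stationary autocovariance `Γ(A, W) = ∑ₜ Aᵗ W (Aᵗ)ᵀ`. -/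
def Gam {d : ℕ} (A W : Matrix (Fin d) (Fin d) ℝ) : Matrix (Fin d) (Fin d) ℝ :=
  ∑' t : ℕ, A ^ t * W * (A ^ t)ᵀ

/-- Order-1 stationary autocovariance `Y(A, W) = A Γ(A, W)`. -/
def Yam {d : ℕ} (A W : Matrix (Fin d) (Fin d) ℝ) : Matrix (Fin d) (Fin d) ℝ :=
  A * Gam A W

/-- Assumptions on the `K` ground-truth models: nondegenerate noise, exponential stability with
parameters `κ, ρ`, boundedness of the stationary covariances by `Γmax`, and separation `Δ` of the
stationary autocovariances. -/
structure ModelAssumptions {d K : ℕ} (A W : Fin K → Matrix (Fin d) (Fin d) ℝ)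
    (κ ρ Γmax Δ : ℝ) : Prop where
  posDef : ∀ k, (W k).PosDef
  one_le_kappa : 1 ≤ κ
  rho_nonneg : 0 ≤ ρ
  rho_lt_one : ρ < 1
  stable : ∀ k, ∀ t : ℕ, 1 ≤ t → specNorm (A k ^ t) ≤ κ * ρ ^ t
  bounded : ∀ k, specNorm (Gam (A k) (W k)) ≤ Γmax
  sep_pos : 0 < Δ
  separated : ∀ k l, k ≠ l →
    Δ ^ 2 ≤ frobSq (Gam (A k) (W k) - Gam (A l) (W l)) + frobSq (Yam (A k) (W k) - Yam (A l) (W l))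

/-- The `M` sample trajectories `x m 0, x m 1, …` with labels `lab m` and lengths `T m`, driven by
independent Gaussian noise vectors `w m t`, `0 ≤ t ≤ T m`, of law `N(0, W (lab m))`:
`x m (t + 1) = A (lab m) (x m t) + w m t`. -/
structure IsMixedLDS {Ω : Type*} [MeasurableSpace Ω] (μ : Measure Ω) {d K M : ℕ}
    (A W : Fin K → Matrix (Fin d) (Fin d) ℝ) (lab : Fin M → Fin K) (T : Fin M → ℕ)
    (w x : Fin M → ℕ → Ω → EuclideanSpace ℝ (Fin d)) : Prop where
  measurable_noise : ∀ m t, t ≤ T m → Measurable (w m t)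
  law_noise : ∀ m t, t ≤ T m → HasLaw (w m t) (multivariateGaussian 0 (W (lab m))) μ
  indep_noise : iIndepFun (fun p : (m : Fin M) × Fin (T m + 1) => w p.1 p.2) μ
  step : ∀ m t, t ≤ T m → ∀ ω,
    x m (t + 1) ω = WithLp.toLp 2 (A (lab m) *ᵥ (x m t ω).ofLp) + w m t ω

/-- Case 0: all trajectories start at the zero state. -/
def ZeroStart {Ω : Type*} {d M : ℕ} (x : Fin M → ℕ → Ω → EuclideanSpace ℝ (Fin d)) : Prop :=
  ∀ m ω, x m 0 ω = 0

/-- Case 1: the trajectories are consecutive segments of one long trajectory started at zero. -/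
def ConsecutiveSegments {Ω : Type*} {d M : ℕ} (T : Fin M → ℕ)
    (x : Fin M → ℕ → Ω → EuclideanSpace ℝ (Fin d)) : Prop :=
  (∀ m : Fin M, m.val = 0 → ∀ ω, x m 0 ω = 0) ∧
    ∀ m m' : Fin M, m'.val = m.val + 1 → ∀ ω, x m' 0 ω = x m (T m) ω

/-- Median of `n` real numbers: the mean of the two middle order statistics, which coincide
when `n` is odd. -/
def median {n : ℕ} (a : Fin n → ℝ) : ℝ :=
  if h : 0 < n then
    (a (Tuple.sort a ⟨(n - 1) / 2, by omega⟩) + a (Tuple.sort a ⟨n / 2, by omega⟩)) / 2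
  else 0

/-- First time window of the `g`-th copy, `{(4g - 3)N + j : 1 ≤ j ≤ N}` for `g = 1, …, G`;
here `g` counts from `0`. -/
def window₁ (N g : ℕ) : Finset ℕ :=
  Finset.Icc ((4 * g + 1) * N + 1) ((4 * g + 1) * N + N)

/-- Second time window of the `g`-th copy, `{(4g - 1)N + j : 1 ≤ j ≤ N}` for `g = 1, …, G`;
here `g` counts from `0`. -/
def window₂ (N g : ℕ) : Finset ℕ :=
  Finset.Icc ((4 * g + 3) * N + 1) ((4 * g + 3) * N + N)

/-- `|S|⁻¹ ∑_{t ∈ S} (x_t)_i x_t`. -/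
def hVec {d : ℕ} (x : ℕ → EuclideanSpace ℝ (Fin d)) (S : Finset ℕ) (i : Fin d) : Fin d → ℝ :=
  (S.card : ℝ)⁻¹ • ∑ t ∈ S, x t i • (x t).ofLp

/-- `|S|⁻¹ ∑_{t ∈ S} (x_{t+1})_i x_t`. -/
def gVec {d : ℕ} (x : ℕ → EuclideanSpace ℝ (Fin d)) (S : Finset ℕ) (i : Fin d) : Fin d → ℝ :=
  (S.card : ℝ)⁻¹ • ∑ t ∈ S, x (t + 1) i • (x t).ofLp

/-- `g`-th copy of the test statistic for `Γ`, for two trajectories `x, z` and block length `N`. -/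
def statGam {d K : ℕ} (V : Fin d → Matrix (Fin d) (Fin K) ℝ) (N g : ℕ)
    (x z : ℕ → EuclideanSpace ℝ (Fin d)) : ℝ :=
  ∑ i, ((V i)ᵀ *ᵥ (hVec x (window₁ N g) i - hVec z (window₁ N g) i)) ⬝ᵥ
    ((V i)ᵀ *ᵥ (hVec x (window₂ N g) i - hVec z (window₂ N g) i))

/-- `g`-th copy of the test statistic for `Y`, for two trajectories `x, z` and block length `N`. -/
def statY {d K : ℕ} (U : Fin d → Matrix (Fin d) (Fin K) ℝ) (N g : ℕ)
    (x z : ℕ → EuclideanSpace ℝ (Fin d)) : ℝ :=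
  ∑ i, ((U i)ᵀ *ᵥ (gVec x (window₁ N g) i - gVec z (window₁ N g) i)) ⬝ᵥ
    ((U i)ᵀ *ᵥ (gVec x (window₂ N g) i - gVec z (window₂ N g) i))

/-- Entry of the similarity matrix for two trajectories `x, z` of length `T`, computed with `G`
copies, block length `⌊T / (4G)⌋` and threshold `τ`. -/
def similarity {d K : ℕ} (V U : Fin d → Matrix (Fin d) (Fin K) ℝ) (T G : ℕ) (τ : ℝ)
    (x z : ℕ → EuclideanSpace ℝ (Fin d)) : ℕ :=
  if median (fun g : Fin G => statGam V (T / (4 * G)) g x z) +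
      median (fun g : Fin G => statY U (T / (4 * G)) g x z) ≤ τ then 1 else 0

/-- The columns of `V` are orthonormal and the rows of `X k`, for all `k`, satisfy
`‖X_i - V_i V_iᵀ X_i‖₂ ≤ ε`, where `V i` is a `d × K` matrix for each row index `i`. -/
def ApproxRows {d K : ℕ} (V : Fin d → Matrix (Fin d) (Fin K) ℝ)
    (X : Fin K → Matrix (Fin d) (Fin d) ℝ) (ε : ℝ) : Prop :=
  ∀ i, (V i)ᵀ * V i = 1 ∧
    ∀ k, ‖WithLp.toLp 2 (X k i - (V i * (V i)ᵀ) *ᵥ X k i)‖ ≤ ε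

end

end MixedLDS

namespace MixedLDS

section Norms
open scoped Matrix.Norms.L2Operator

variable {d : ℕ}

theorem specNorm_eq_norm (X : Matrix (Fin d) (Fin d) ℝ) : specNorm X = ‖X‖ := rfl

theorem specNorm_nonneg (X : Matrix (Fin d) (Fin d) ℝ) : 0 ≤ specNorm X := norm_nonneg _

theorem specNorm_mul_le (X Y : Matrix (Fin d) (Fin d) ℝ) :
    specNorm (X * Y) ≤ specNorm X * specNorm Y := by
  simpa only [specNorm_eq_norm] using norm_mul_le X Y

theorem specNorm_transpose (X : Matrix (Fin d) (Fin d) ℝ) : specNorm Xᵀ = specNorm X := by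
  have := l2_opNorm_conjTranspose X
  rwa [conjTranspose_eq_transpose_of_trivial] at this

theorem specNorm_one_le : specNorm (1 : Matrix (Fin d) (Fin d) ℝ) ≤ 1 := by
  rw [specNorm, map_one]
  exact ContinuousLinearMap.norm_id_le

theorem norm_mulVec_le (X : Matrix (Fin d) (Fin d) ℝ) (v : Fin d → ℝ) :
    ‖WithLp.toLp 2 (X *ᵥ v)‖ ≤ specNorm X * ‖WithLp.toLp 2 v‖ := by
  rw [← toEuclideanCLM_toLp]
  exact ContinuousLinearMap.le_opNorm _ _

theorem frobSq_nonneg (X : Matrix (Fin d) (Fin d) ℝ) : 0 ≤ frobSq X :=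
  Finset.sum_nonneg fun _ _ => Finset.sum_nonneg fun _ _ => sq_nonneg _

theorem frobSq_transpose (X : Matrix (Fin d) (Fin d) ℝ) : frobSq Xᵀ = frobSq X := by
  simp only [frobSq, transpose_apply]
  exact Finset.sum_comm

theorem frobSq_eq_sum_norm_col (X : Matrix (Fin d) (Fin d) ℝ) :
    frobSq X = ∑ j, ‖WithLp.toLp 2 (fun i => X i j)‖ ^ 2 := by
  simp only [frobSq, EuclideanSpace.real_norm_sq_eq]
  exact Finset.sum_comm

theorem frobSq_mul_le (B Z : Matrix (Fin d) (Fin d) ℝ) :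
    frobSq (B * Z) ≤ specNorm B ^ 2 * frobSq Z := by
  rw [frobSq_eq_sum_norm_col, frobSq_eq_sum_norm_col, Finset.mul_sum]
  refine Finset.sum_le_sum fun j _ => ?_
  rw [← mul_pow]
  refine pow_le_pow_left₀ (norm_nonneg _) ?_ 2
  exact norm_mulVec_le B fun i => Z i j

theorem frobSq_mul_le' (Z B : Matrix (Fin d) (Fin d) ℝ) :
    frobSq (Z * B) ≤ specNorm B ^ 2 * frobSq Z := by
  rw [← frobSq_transpose, transpose_mul, ← specNorm_transpose, ← frobSq_transpose Z]
  exact frobSq_mul_le _ _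

theorem frobSq_one : frobSq (1 : Matrix (Fin d) (Fin d) ℝ) = d := by
  simp [frobSq, Matrix.one_apply]

theorem frobSq_le_mul_specNorm_sq (X : Matrix (Fin d) (Fin d) ℝ) :
    frobSq X ≤ d * specNorm X ^ 2 := by
  have := frobSq_mul_le X 1
  rwa [mul_one, frobSq_one, mul_comm] at this

theorem abs_sum_mul_le (X Y : Matrix (Fin d) (Fin d) ℝ) :
    |∑ i, ∑ j, X i j * Y i j| ≤ √(frobSq X) * √(frobSq Y) := by
  rw [← Real.sqrt_mul (frobSq_nonneg X)]
  refine Real.abs_le_sqrt ?_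
  simp only [frobSq, ← Finset.sum_product']
  exact Finset.sum_mul_sq_le_sq_mul_sq _ _ _

theorem abs_sum_mul_mul_mul_le (X Z B C : Matrix (Fin d) (Fin d) ℝ) (hX : frobSq X = frobSq Z) :
    |∑ i, ∑ j, Z i j * (B * X * C) i j| ≤ specNorm B * specNorm C * frobSq Z := by
  refine (abs_sum_mul_le _ _).trans ?_
  have h : frobSq (B * X * C) ≤ (specNorm B * specNorm C) ^ 2 * frobSq Z := by
    calc _ ≤ specNorm C ^ 2 * frobSq (B * X) := frobSq_mul_le' _ _
      _ ≤ specNorm C ^ 2 * (specNorm B ^ 2 * frobSq X) := by gcongr; exact frobSq_mul_le _ _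
      _ = _ := by rw [hX]; ring
  calc √(frobSq Z) * √(frobSq (B * X * C))
      ≤ √(frobSq Z) * √((specNorm B * specNorm C) ^ 2 * frobSq Z) := by gcongr
    _ = √(frobSq Z) * (specNorm B * specNorm C * √(frobSq Z)) := by
      rw [Real.sqrt_mul (sq_nonneg _),
        Real.sqrt_sq (mul_nonneg (specNorm_nonneg _) (specNorm_nonneg _))]
    _ = specNorm B * specNorm C * (√(frobSq Z) * √(frobSq Z)) := by ring
    _ = _ := by rw [Real.mul_self_sqrt (frobSq_nonneg Z)]

theorem specNorm_le_of_posSemidef {B : Matrix (Fin d) (Fin d) ℝ} (hB : B.PosSemidef) {γ : ℝ}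
    (hγ : 0 ≤ γ) (h : ∀ v : Fin d → ℝ, v ⬝ᵥ B *ᵥ v ≤ γ * ‖WithLp.toLp 2 v‖ ^ 2) :
    specNorm B ≤ γ := by
  have hsymm : (toEuclideanCLM (𝕜 := ℝ) B : EuclideanSpace ℝ (Fin d) →ₗ[ℝ] _).IsSymmetric := by
    rw [coe_toEuclideanCLM_eq_toEuclideanLin]
    exact isSymmetric_toEuclideanLin_iff.2 hB.1
  rw [specNorm, ContinuousLinearMap.norm_eq_iSup_rayleighQuotient _ hsymm]
  refine ciSup_le fun x => ?_
  have hx : inner ℝ (toEuclideanCLM (𝕜 := ℝ) B x) x = x.ofLp ⬝ᵥ B *ᵥ x.ofLp := by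
    rw [real_inner_comm, inner_toEuclideanCLM]
  have h0 : 0 ≤ x.ofLp ⬝ᵥ B *ᵥ x.ofLp := by simpa using hB.dotProduct_mulVec_nonneg x.ofLp
  simp only [ContinuousLinearMap.rayleighQuotient, ContinuousLinearMap.reApplyInnerSelf_apply, hx,
    RCLike.re_to_real]
  rw [abs_of_nonneg (by positivity)]
  exact div_le_of_le_mul₀ (by positivity) hγ (h x.ofLp)

end Norms

section Gam
open scoped Matrix.Norms.L2Operator

variable {d : ℕ}

/-- Covariance `∑_{t < s} Aᵗ W (Aᵗ)ᵀ` of the state after `s` steps from zero. -/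
noncomputable def gamPartial (A W : Matrix (Fin d) (Fin d) ℝ) (s : ℕ) :
    Matrix (Fin d) (Fin d) ℝ :=
  ∑ t ∈ Finset.range s, A ^ t * W * (A ^ t)ᵀ

theorem gamPartial_succ (A W : Matrix (Fin d) (Fin d) ℝ) (s : ℕ) :
    gamPartial A W (s + 1) = A * gamPartial A W s * Aᵀ + W := by
  simp only [gamPartial, Finset.sum_range_succ', pow_zero, transpose_one, one_mul, mul_one,
    Finset.mul_sum, Finset.sum_mul]
  congr 1
  refine Finset.sum_congr rfl fun t _ => ?_
  rw [pow_succ', transpose_mul]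
  simp only [mul_assoc]

theorem posSemidef_gamTerm (A : Matrix (Fin d) (Fin d) ℝ) {W : Matrix (Fin d) (Fin d) ℝ}
    (hW : W.PosDef) (t : ℕ) : (A ^ t * W * (A ^ t)ᵀ).PosSemidef := by
  have := hW.posSemidef.mul_mul_conjTranspose_same (A ^ t)
  rwa [conjTranspose_eq_transpose_of_trivial] at this

theorem posSemidef_gamPartial (A : Matrix (Fin d) (Fin d) ℝ) {W : Matrix (Fin d) (Fin d) ℝ}
    (hW : W.PosDef) (s : ℕ) : (gamPartial A W s).PosSemidef :=
  posSemidef_sum _ fun t _ => posSemidef_gamTerm A hW t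

variable {K : ℕ} {A W : Fin K → Matrix (Fin d) (Fin d) ℝ} {κ ρ Γmax Δ : ℝ}

theorem ModelAssumptions.specNorm_pow_le (H : ModelAssumptions A W κ ρ Γmax Δ) (k : Fin K)
    (t : ℕ) : specNorm (A k ^ t) ≤ κ * ρ ^ t := by
  rcases Nat.eq_zero_or_pos t with rfl | ht
  · simpa using specNorm_one_le.trans H.one_le_kappa
  · exact H.stable k t ht

theorem ModelAssumptions.specNorm_pow_le' (H : ModelAssumptions A W κ ρ Γmax Δ) (k : Fin K)
    (t : ℕ) : specNorm (A k ^ t) ≤ κ :=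
  (H.specNorm_pow_le k t).trans (mul_le_of_le_one_right (zero_le_one.trans H.one_le_kappa)
    (pow_le_one₀ H.rho_nonneg H.rho_lt_one.le))

theorem ModelAssumptions.gammaMax_nonneg (H : ModelAssumptions A W κ ρ Γmax Δ) (k : Fin K) :
    0 ≤ Γmax := (specNorm_nonneg _).trans (H.bounded k)

theorem ModelAssumptions.hasSum_gam (H : ModelAssumptions A W κ ρ Γmax Δ) (k : Fin K) :
    HasSum (fun t : ℕ => A k ^ t * W k * (A k ^ t)ᵀ) (Gam (A k) (W k)) := by
  refine Summable.hasSum ?_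
  have hκ := zero_le_one.trans H.one_le_kappa
  have hρ := H.rho_nonneg
  refine Summable.of_norm_bounded (g := fun t : ℕ => κ ^ 2 * specNorm (W k) * (ρ ^ 2) ^ t)
    ((summable_geometric_of_lt_one (by positivity) (by nlinarith [H.rho_lt_one])).mul_left _) ?_
  intro t
  rw [← specNorm_eq_norm]
  calc specNorm (A k ^ t * W k * (A k ^ t)ᵀ)
      ≤ specNorm (A k ^ t) * specNorm (W k) * specNorm (A k ^ t) := by
        refine (specNorm_mul_le _ _).trans ?_
        rw [specNorm_transpose]
        gcongr
        · exact specNorm_nonneg _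
        · exact specNorm_mul_le _ _
    _ ≤ (κ * ρ ^ t) * specNorm (W k) * (κ * ρ ^ t) := by
        gcongr
        any_goals exact specNorm_nonneg _
        · exact mul_nonneg (by positivity) (specNorm_nonneg _)
        · exact H.specNorm_pow_le k t
        · exact H.specNorm_pow_le k t
    _ = _ := by rw [← pow_mul]; ring

theorem ModelAssumptions.gam_sub_gamPartial (H : ModelAssumptions A W κ ρ Γmax Δ) (k : Fin K)
    (s : ℕ) : Gam (A k) (W k) - gamPartial (A k) (W k) s =
      A k ^ s * Gam (A k) (W k) * (A k ^ s)ᵀ := by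
  have h := H.hasSum_gam k
  have h1 := (hasSum_nat_add_iff' s).2 h
  have h2 := (h.mul_left (A k ^ s)).mul_right ((A k ^ s)ᵀ)
  refine h1.unique (h2.congr_fun ?_)
  intro t
  rw [add_comm, pow_add, transpose_mul]
  simp only [mul_assoc]

theorem ModelAssumptions.hasSum_quadForm (H : ModelAssumptions A W κ ρ Γmax Δ) (k : Fin K)
    (v : Fin d → ℝ) :
    HasSum (fun t : ℕ => v ⬝ᵥ (A k ^ t * W k * (A k ^ t)ᵀ) *ᵥ v) (v ⬝ᵥ Gam (A k) (W k) *ᵥ v) := by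
  let f : Matrix (Fin d) (Fin d) ℝ →+ ℝ :=
    { toFun := fun X => v ⬝ᵥ X *ᵥ v
      map_zero' := by simp
      map_add' := fun X Y => by simp [add_mulVec, dotProduct_add] }
  exact (H.hasSum_gam k).map f (by simp only [f, AddMonoidHom.coe_mk, ZeroHom.coe_mk]; fun_prop)

theorem ModelAssumptions.specNorm_gamPartial_le (H : ModelAssumptions A W κ ρ Γmax Δ) (k : Fin K)
    (s : ℕ) : specNorm (gamPartial (A k) (W k) s) ≤ Γmax := by
  refine specNorm_le_of_posSemidef (posSemidef_gamPartial _ (H.posDef k) s)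
    (H.gammaMax_nonneg k) fun v => ?_
  have h0 : v ⬝ᵥ gamPartial (A k) (W k) s *ᵥ v ≤ v ⬝ᵥ Gam (A k) (W k) *ᵥ v := by
    have := sum_le_hasSum (Finset.range s) (fun t _ => by
      simpa using (posSemidef_gamTerm (A k) (H.posDef k) t).dotProduct_mulVec_nonneg v)
      (H.hasSum_quadForm k v)
    rw [gamPartial, sum_mulVec, dotProduct_sum]
    exact this
  refine h0.trans ?_
  rw [← inner_toEuclideanCLM (Gam (A k) (W k)) (WithLp.toLp 2 v) (WithLp.toLp 2 v)]
  refine (real_inner_le_norm _ _).trans ?_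
  rw [toEuclideanCLM_toLp]
  calc _ ≤ ‖WithLp.toLp 2 v‖ * (specNorm (Gam (A k) (W k)) * ‖WithLp.toLp 2 v‖) := by
        gcongr; exact norm_mulVec_le _ _
    _ ≤ ‖WithLp.toLp 2 v‖ * (Γmax * ‖WithLp.toLp 2 v‖) := by gcongr; exact H.bounded k
    _ = _ := by ring

theorem ModelAssumptions.frobSq_bias_le (H : ModelAssumptions A W κ ρ Γmax Δ) (k : Fin K)
    (a s : ℕ) : frobSq (A k ^ a * gamPartial (A k) (W k) s - A k ^ a * Gam (A k) (W k)) ≤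
      d * (κ ^ 3 * Γmax * ρ ^ s) ^ 2 := by
  have hκ := zero_le_one.trans H.one_le_kappa
  have hρ := H.rho_nonneg
  have hΓ := H.gammaMax_nonneg k
  refine (frobSq_le_mul_specNorm_sq _).trans ?_
  have : A k ^ a * gamPartial (A k) (W k) s - A k ^ a * Gam (A k) (W k) =
      -(A k ^ a * (A k ^ s * Gam (A k) (W k) * (A k ^ s)ᵀ)) := by
    rw [← H.gam_sub_gamPartial, mul_sub, neg_sub]
  rw [this]
  have h2 : specNorm (-(A k ^ a * (A k ^ s * Gam (A k) (W k) * (A k ^ s)ᵀ))) ≤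
      κ ^ 3 * Γmax * ρ ^ s := by
    rw [specNorm_eq_norm, norm_neg, ← specNorm_eq_norm]
    calc _ ≤ specNorm (A k ^ a) * (specNorm (A k ^ s) * specNorm (Gam (A k) (W k)) *
            specNorm (A k ^ s)) := by
          refine (specNorm_mul_le _ _).trans ?_
          gcongr
          · exact specNorm_nonneg _
          refine (specNorm_mul_le _ _).trans ?_
          rw [specNorm_transpose]
          gcongr
          · exact specNorm_nonneg _
          · exact specNorm_mul_le _ _
      _ ≤ κ * ((κ * ρ ^ s) * Γmax * κ) := by
          have e1 := H.specNorm_pow_le k s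
          have e2 := H.specNorm_pow_le' k s
          have e3 := H.specNorm_pow_le' k a
          have e4 := H.bounded k
          have p1 := specNorm_nonneg (A k ^ s)
          have p2 := specNorm_nonneg (A k ^ a)
          have p3 := specNorm_nonneg (Gam (A k) (W k))
          gcongr
      _ = _ := by ring
  have := specNorm_nonneg (-(A k ^ a * (A k ^ s * Gam (A k) (W k) * (A k ^ s)ᵀ)))
  gcongr

end Gam
end MixedLDS

namespace MixedLDS

theorem integral_pow_four_gaussianReal (v : NNReal) :
    ∫ x, x ^ 4 ∂gaussianReal 0 v = 3 * (v : ℝ) ^ 2 := by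
  have hexp : ∀ n : ℕ, iteratedDeriv n (mgf id (gaussianReal 0 v)) 0 =
      ∫ x, x ^ n ∂gaussianReal 0 v := by
    intro n
    have := iteratedDeriv_mgf_zero (X := id) (μ := gaussianReal 0 v)
      (by simp [integrableExpSet_id_gaussianReal]) n
    simpa using this
  rw [← hexp 4, mgf_id_gaussianReal]
  set c : ℝ := (v : ℝ) with hc
  have hE : ∀ t : ℝ, HasDerivAt (fun t : ℝ => Real.exp (0 * t + c * t ^ 2 / 2))
      (c * t * Real.exp (0 * t + c * t ^ 2 / 2)) t := by
    intro t
    have h : HasDerivAt (fun t : ℝ => 0 * t + c * t ^ 2 / 2) (c * t) t := by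
      have := ((hasDerivAt_id' t).const_mul (0 : ℝ)).add
        ((((hasDerivAt_id' t).pow 2).const_mul c).div_const 2)
      refine HasDerivAt.congr_deriv this ?_
      norm_num
      ring
    exact h.exp.congr_deriv (mul_comm _ _)
  have step : ∀ p p' : ℝ → ℝ, (∀ t, HasDerivAt p (p' t) t) →
      deriv (fun t => p t * Real.exp (0 * t + c * t ^ 2 / 2)) =
        fun t => (p' t + c * t * p t) * Real.exp (0 * t + c * t ^ 2 / 2) := by
    intro p p' hp
    funext t
    refine (HasDerivAt.deriv (HasDerivAt.mul (hp t) (hE t))).trans ?_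
    ring
  have h1 : deriv (fun t => Real.exp (0 * t + c * t ^ 2 / 2)) =
      fun t => (c * t) * Real.exp (0 * t + c * t ^ 2 / 2) := by
    funext t
    exact (hE t).deriv
  have hid : ∀ t : ℝ, HasDerivAt (fun t : ℝ => t) 1 t := fun t => hasDerivAt_id t
  have h2 := step (fun t => c * t) (fun _ => c * 1) (fun t => (hid t).const_mul c)
  have h3 := step (fun t => c * 1 + c * t * (c * t)) (fun t => c ^ 2 * 2 * t) (fun t => by
    have := (((hid t).const_mul c).mul ((hid t).const_mul c)).const_add (c * 1)
    exact HasDerivAt.congr_deriv this (by ring))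
  have h4 := step (fun t => c ^ 2 * 2 * t + c * t * (c * 1 + c * t * (c * t)))
    (fun t => 3 * c ^ 2 + 3 * c ^ 3 * t ^ 2) (fun t => by
    have := ((hid t).const_mul (c ^ 2 * 2)).add (((hid t).const_mul c).mul
      ((((hid t).const_mul c).mul ((hid t).const_mul c)).const_add (c * 1)))
    exact HasDerivAt.congr_deriv this (by simp only [Pi.mul_apply]; ring))
  simp only [iteratedDeriv_succ, iteratedDeriv_zero]
  rw [h1, h2, h3, h4]
  simp

section Isserlis

variable {Ω F : Type*} [MeasurableSpace Ω] {μ : Measure Ω} [NormedAddCommGroup F]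
  [NormedSpace ℝ F] [MeasurableSpace F] [BorelSpace F] {X : Ω → F}

theorem integral_pow_four_of_hasGaussianLaw {Y : Ω → ℝ} (hY : HasGaussianLaw Y μ)
    (h0 : ∫ ω, Y ω ∂μ = 0) : ∫ ω, Y ω ^ 4 ∂μ = 3 * (∫ ω, Y ω ^ 2 ∂μ) ^ 2 := by
  have hm := hY.map_eq_gaussianReal
  rw [h0, variance_of_integral_eq_zero hY.aemeasurable h0] at hm
  have h4 : ∫ ω, Y ω ^ 4 ∂μ = ∫ x, x ^ 4 ∂(μ.map Y) := by
    rw [integral_map hY.aemeasurable (by fun_prop)]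
  rw [h4, hm, integral_pow_four_gaussianReal, Real.coe_toNNReal]
  exact integral_nonneg fun ω => sq_nonneg _

theorem memLp_dual (hX : HasGaussianLaw X μ) (ℓ : StrongDual ℝ F) {p : ENNReal} (hp : p ≠ ⊤) :
    MemLp (fun ω => ℓ (X ω)) p μ :=
  (hX.map_fun ℓ).memLp hp

theorem integrable_dual_mul (hX : HasGaussianLaw X μ) (ℓ₁ ℓ₂ : StrongDual ℝ F) :
    Integrable (fun ω => ℓ₁ (X ω) * ℓ₂ (X ω)) μ :=
  (memLp_dual hX ℓ₁ (p := 2) (by simp)).integrable_mul (memLp_dual hX ℓ₂ (p := 2) (by simp))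

theorem memLp_dual_mul (hX : HasGaussianLaw X μ) (ℓ₁ ℓ₂ : StrongDual ℝ F) :
    MemLp (fun ω => ℓ₁ (X ω) * ℓ₂ (X ω)) 2 μ := by
  have : ENNReal.HolderTriple 4 4 2 := ⟨by
    rw [← two_mul, show (4 : ENNReal) = 2 * 2 by norm_num, ENNReal.mul_inv (by simp) (by simp),
      ← mul_assoc, ENNReal.mul_inv_cancel (by simp) (by simp), one_mul]⟩
  exact (memLp_dual hX ℓ₂ (p := 4) (by simp)).mul' (memLp_dual hX ℓ₁ (p := 4) (by simp))

theorem integrable_dual_mul_four (hX : HasGaussianLaw X μ) (a b c e : StrongDual ℝ F) :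
    Integrable (fun ω => a (X ω) * b (X ω) * (c (X ω) * e (X ω))) μ :=
  (memLp_dual_mul hX a b).integrable_mul (memLp_dual_mul hX c e)

/-- Isserlis' formula for four linear functionals of a centered Gaussian vector. -/
theorem integral_dual_mul_four (hX : HasGaussianLaw X μ)
    (h0 : ∀ ℓ : StrongDual ℝ F, ∫ ω, ℓ (X ω) ∂μ = 0) (a b c e : StrongDual ℝ F) :
    ∫ ω, a (X ω) * b (X ω) * (c (X ω) * e (X ω)) ∂μ =
      (∫ ω, a (X ω) * b (X ω) ∂μ) * (∫ ω, c (X ω) * e (X ω) ∂μ) +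
      (∫ ω, a (X ω) * c (X ω) ∂μ) * (∫ ω, b (X ω) * e (X ω) ∂μ) +
      (∫ ω, a (X ω) * e (X ω) ∂μ) * (∫ ω, b (X ω) * c (X ω) ∂μ) := by
  set B : StrongDual ℝ F → StrongDual ℝ F → ℝ := fun ℓ₁ ℓ₂ => ∫ ω, ℓ₁ (X ω) * ℓ₂ (X ω) ∂μ with hB
  have hadd : ∀ x y z, B (x + y) z = B x z + B y z := fun x y z => by
    simp only [hB, _root_.add_apply, add_mul]
    exact integral_add (integrable_dual_mul hX _ _) (integrable_dual_mul hX _ _)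
  have hneg : ∀ x z, B (-x) z = - B x z := fun x z => by
    simp only [hB, _root_.neg_apply, neg_mul]
    exact integral_neg _
  have hcomm : ∀ x z, B x z = B z x := fun x z => by simp only [hB, mul_comm]
  have hadd' : ∀ z x y, B z (x + y) = B z x + B z y := fun z x y => by
    rw [hcomm, hadd, hcomm x, hcomm y]
  have hneg' : ∀ z x, B z (-x) = - B z x := fun z x => by rw [hcomm, hneg, hcomm x]
  have h4 : ∀ ℓ : StrongDual ℝ F, ∫ ω, ℓ (X ω) ^ 4 ∂μ = 3 * B ℓ ℓ ^ 2 := fun ℓ => by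
    rw [integral_pow_four_of_hasGaussianLaw (hX.map_fun ℓ) (h0 ℓ)]
    simp only [hB, sq]
  have i4 : ∀ ℓ : StrongDual ℝ F, Integrable (fun ω => ℓ (X ω) ^ 4) μ := fun ℓ => by
    refine (integrable_dual_mul_four hX ℓ ℓ ℓ ℓ).congr (ae_of_all _ fun ω => ?_)
    ring
  have key : ∀ ω, a (X ω) * b (X ω) * (c (X ω) * e (X ω)) = 192⁻¹ *
      ((a + b + c + e) (X ω) ^ 4 - (a + b + c + -e) (X ω) ^ 4 - (a + b + -c + e) (X ω) ^ 4
        + (a + b + -c + -e) (X ω) ^ 4 - (a + -b + c + e) (X ω) ^ 4 + (a + -b + c + -e) (X ω) ^ 4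
        + (a + -b + -c + e) (X ω) ^ 4 - (a + -b + -c + -e) (X ω) ^ 4) := fun ω => by
    simp only [_root_.add_apply, _root_.neg_apply]
    ring
  simp_rw [key]
  rw [integral_const_mul]
  rw [integral_sub, integral_add, integral_add, integral_sub, integral_add, integral_sub,
    integral_sub]
  any_goals fun_prop
  simp only [h4]
  change _ = B a b * B c e + B a c * B b e + B a e * B b c
  simp only [hadd, hadd', hneg, hneg', hcomm b a, hcomm c a, hcomm e a, hcomm c b, hcomm e b,
    hcomm e c]
  ring

end Isserlis
end MixedLDS

namespace MixedLDS

variable {d : ℕ}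

/-- State after `j` steps of the system `x ↦ A x + e` started at zero. -/
noncomputable def sysState (A : Matrix (Fin d) (Fin d) ℝ) (e : ℕ → EuclideanSpace ℝ (Fin d)) :
    ℕ → EuclideanSpace ℝ (Fin d)
  | 0 => 0
  | j + 1 => WithLp.toLp 2 (A *ᵥ (sysState A e j).ofLp) + e j

/-- The first `R` noise vectors are independent with law `N(0, W)`. -/
structure IsNoise {Ω : Type*} [MeasurableSpace Ω] (μ : Measure Ω) (W : Matrix (Fin d) (Fin d) ℝ)
    (R : ℕ) (e : ℕ → Ω → EuclideanSpace ℝ (Fin d)) : Prop where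
  law : ∀ r < R, HasLaw (e r) (multivariateGaussian 0 W) μ
  indep : iIndepFun (fun r : Fin R => e r) μ

theorem sysState_succ_apply (A : Matrix (Fin d) (Fin d) ℝ) (e : ℕ → EuclideanSpace ℝ (Fin d))
    (j : ℕ) (i : Fin d) :
    sysState A e (j + 1) i = ∑ l, A i l * sysState A e j l + e j i := by
  simp [sysState, mulVec, dotProduct]

theorem measurable_sysState {Ω : Type*} [MeasurableSpace Ω] (A : Matrix (Fin d) (Fin d) ℝ)
    {e : ℕ → Ω → EuclideanSpace ℝ (Fin d)} {R : ℕ} (he : ∀ r < R, Measurable (e r)) {j : ℕ}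
    (hj : j ≤ R) : Measurable fun ω => sysState A (fun r => e r ω) j := by
  induction j with
  | zero => exact measurable_const
  | succ j ih =>
    have h1 := (toEuclideanCLM (𝕜 := ℝ) A).continuous.measurable.comp (ih (by omega))
    exact h1.add (he j (by omega))

theorem exists_dual_sysState {Ω : Type*} (A : Matrix (Fin d) (Fin d) ℝ)
    (e : ℕ → Ω → EuclideanSpace ℝ (Fin d)) {R j : ℕ} (hj : j ≤ R) (i : Fin d) :
    ∃ ℓ : StrongDual ℝ (Fin R → EuclideanSpace ℝ (Fin d)),
      ∀ ω, sysState A (fun r => e r ω) j i = ℓ (fun r => e r ω) := by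
  induction j generalizing i with
  | zero => exact ⟨0, fun ω => by simp [sysState]⟩
  | succ j ih =>
    choose ℓ hℓ using ih (by omega)
    refine ⟨∑ l, A i l • ℓ l + (EuclideanSpace.proj i).comp
      (ContinuousLinearMap.proj (⟨j, hj⟩ : Fin R)), fun ω => ?_⟩
    rw [sysState_succ_apply]
    simp [hℓ]

namespace IsNoise

variable {Ω : Type*} [MeasurableSpace Ω] {μ : Measure Ω} {A W : Matrix (Fin d) (Fin d) ℝ}
  {R : ℕ} {e : ℕ → Ω → EuclideanSpace ℝ (Fin d)}

theorem hasGaussianLaw (h : IsNoise μ W R e) :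
    HasGaussianLaw (fun ω (r : Fin R) => e r ω) μ :=
  iIndepFun.hasGaussianLaw (fun r : Fin R => (h.law r r.2).hasGaussianLaw) h.indep

theorem memLp (h : IsNoise μ W R e) {r : ℕ} (hr : r < R) (i : Fin d) :
    MemLp (fun ω => e r ω i) 2 μ :=
  ((h.law r hr).hasGaussianLaw.map_fun (EuclideanSpace.proj i)).memLp_two

theorem integral_eq_zero (h : IsNoise μ W R e) {r : ℕ} (hr : r < R) (i : Fin d) :
    ∫ ω, e r ω i ∂μ = 0 := by
  have h1 : ∫ ω, e r ω i ∂μ = ∫ x, x i ∂(multivariateGaussian 0 W) :=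
    ((h.law r hr).integral_comp (f := fun x : EuclideanSpace ℝ (Fin d) => x i) (by fun_prop))
  rw [h1]
  have h2 := (EuclideanSpace.proj (𝕜 := ℝ) i).integral_comp_comm
    (IsGaussian.integrable_id (μ := multivariateGaussian (0 : EuclideanSpace ℝ (Fin d)) W))
  simpa using h2

theorem integral_mul (h : IsNoise μ W R e) (hW : W.PosDef) {r s : ℕ} (hr : r < R) (hs : s < R)
    (i j : Fin d) : ∫ ω, e r ω i * e s ω j ∂μ = if r = s then W i j else 0 := by
  have hp := h.hasGaussianLaw.isProbabilityMeasure
  have hc := covariance_eq_sub (h.memLp hr i) (h.memLp hs j)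
  rw [h.integral_eq_zero hr, h.integral_eq_zero hs, mul_zero, sub_zero] at hc
  change cov[_, _; μ] = ∫ ω, e r ω i * e s ω j ∂μ at hc
  rw [← hc]
  split_ifs with hrs
  · subst hrs
    rw [← covariance_eval_multivariateGaussian (μ := 0) hW.posSemidef, ← (h.law r hr).map_eq,
      covariance_map (by fun_prop) (by fun_prop) (h.law r hr).aemeasurable]
    rfl
  · have hi := h.indep.indepFun (i := ⟨r, hr⟩) (j := ⟨s, hs⟩) (by simpa using hrs)
    exact (hi.comp (φ := fun x : EuclideanSpace ℝ (Fin d) => x i)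
      (ψ := fun x : EuclideanSpace ℝ (Fin d) => x j) (by fun_prop) (by fun_prop)).covariance_eq_zero
      (h.memLp hr i) (h.memLp hs j)

theorem integral_dual (h : IsNoise μ W R e)
    (ℓ : StrongDual ℝ (Fin R → EuclideanSpace ℝ (Fin d))) :
    ∫ ω, ℓ (fun r => e r ω) ∂μ = 0 := by
  rw [ℓ.integral_comp_comm h.hasGaussianLaw.integrable]
  have h0 : ∫ ω, (fun r : Fin R => e r ω) ∂μ = 0 := by
    funext r
    rw [eval_integral fun r : Fin R => (h.law r r.2).hasGaussianLaw.integrable]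
    ext i
    have h2 := (EuclideanSpace.proj (𝕜 := ℝ) i).integral_comp_comm
      (h.law r r.2).hasGaussianLaw.integrable
    simp only [EuclideanSpace.coe_proj] at h2
    rw [← h2, h.integral_eq_zero r.2]
    rfl
  rw [h0, map_zero]

theorem memLp_sysState (h : IsNoise μ W R e) {j : ℕ} (hj : j ≤ R) (i : Fin d) {p : ENNReal}
    (hp : p ≠ ⊤) : MemLp (fun ω => sysState A (fun r => e r ω) j i) p μ := by
  obtain ⟨ℓ, hℓ⟩ := exists_dual_sysState A e hj i
  simp only [hℓ]
  exact memLp_dual h.hasGaussianLaw ℓ hp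

theorem integrable_sysState_mul (h : IsNoise μ W R e) {j k : ℕ} (hj : j ≤ R) (hk : k ≤ R)
    (i l : Fin d) :
    Integrable (fun ω => sysState A (fun r => e r ω) j i * sysState A (fun r => e r ω) k l) μ :=
  (h.memLp_sysState hj i (p := 2) (by simp)).integrable_mul
    (h.memLp_sysState hk l (p := 2) (by simp))

theorem integrable_noise_mul_sysState (h : IsNoise μ W R e) {r j : ℕ} (hr : r < R) (hj : j ≤ R)
    (i l : Fin d) : Integrable (fun ω => e r ω i * sysState A (fun r => e r ω) j l) μ :=
  (h.memLp hr i).integrable_mul (h.memLp_sysState hj l (p := 2) (by simp))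

theorem integrable_noise_mul (h : IsNoise μ W R e) {r s : ℕ} (hr : r < R) (hs : s < R)
    (i l : Fin d) : Integrable (fun ω => e r ω i * e s ω l) μ :=
  (h.memLp hr i).integrable_mul (h.memLp hs l)

theorem integral_noise_mul_sysState_succ (h : IsNoise μ W R e) {r j : ℕ} (hr : r < R)
    (hj : j < R) (i l : Fin d) : ∫ ω, e r ω i * sysState A (fun r => e r ω) (j + 1) l ∂μ =
      ∑ m, A l m * ∫ ω, e r ω i * sysState A (fun r => e r ω) j m ∂μ +
        ∫ ω, e r ω i * e j ω l ∂μ := by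
  simp only [sysState_succ_apply, mul_add, Finset.mul_sum]
  simp only [mul_left_comm _ (A l _)]
  have hi : ∀ m, Integrable (fun ω => A l m * (e r ω i * sysState A (fun r => e r ω) j m)) μ :=
    fun m => (h.integrable_noise_mul_sysState (A := A) hr hj.le i m).const_mul (A l m)
  rw [integral_add (integrable_finsetSum _ fun m _ => hi m) (h.integrable_noise_mul hr hj i l),
    integral_finsetSum _ fun m _ => hi m]
  simp only [integral_const_mul]

theorem integral_noise_mul_sysState (h : IsNoise μ W R e) (hW : W.PosDef) {r j : ℕ} (hr : r < R)
    (hj : j ≤ r) (i l : Fin d) : ∫ ω, e r ω i * sysState A (fun r => e r ω) j l ∂μ = 0 := by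
  induction j generalizing l with
  | zero => simp [sysState]
  | succ j ih =>
    rw [h.integral_noise_mul_sysState_succ hr (by omega), h.integral_mul hW hr (by omega),
      if_neg (by omega), add_zero]
    exact Finset.sum_eq_zero fun m _ => by rw [ih (by omega), mul_zero]

/-- The lag-`a` covariance of the state. -/
theorem integral_sysState_mul (h : IsNoise μ W R e) (hW : W.PosDef) {a j : ℕ} (hj : a + j ≤ R)
    (i l : Fin d) :
    ∫ ω, sysState A (fun r => e r ω) (a + j) i * sysState A (fun r => e r ω) j l ∂μ =
      (A ^ a * gamPartial A W j) i l := by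
  have shift : ∀ {t s : ℕ} {C : Matrix (Fin d) (Fin d) ℝ}, s ≤ R → t < R → ∀ (i l : Fin d),
      (∀ m, ∫ ω, sysState A (fun r => e r ω) t m * sysState A (fun r => e r ω) s l ∂μ = C m l) →
      ∫ ω, sysState A (fun r => e r ω) (t + 1) i * sysState A (fun r => e r ω) s l ∂μ =
        (A * C) i l + ∫ ω, e t ω i * sysState A (fun r => e r ω) s l ∂μ := by
    intro t s C hs ht i l hC
    simp only [sysState_succ_apply, add_mul, Finset.sum_mul, mul_assoc]
    have hi : ∀ m, Integrable (fun ω => A i m * (sysState A (fun r => e r ω) t m *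
        sysState A (fun r => e r ω) s l)) μ := fun m =>
      (h.integrable_sysState_mul ht.le hs m l).const_mul _
    rw [integral_add (integrable_finsetSum _ fun m _ => hi m)
      (h.integrable_noise_mul_sysState ht hs i l), integral_finsetSum _ fun m _ => hi m]
    simp only [integral_const_mul, hC, mul_apply]
  have hdiag : ∀ j ≤ R, ∀ i l, ∫ ω, sysState A (fun r => e r ω) j i *
      sysState A (fun r => e r ω) j l ∂μ = gamPartial A W j i l := by
    intro j
    induction j with
    | zero => intro _ i l; simp [sysState, gamPartial]
    | succ j ih =>
      intro hj i l
      have hcross : ∀ m, ∫ ω, sysState A (fun r => e r ω) j m *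
          sysState A (fun r => e r ω) (j + 1) l ∂μ = (A * gamPartial A W j)ᵀ m l := by
        intro m
        rw [transpose_apply]
        simp only [mul_comm (sysState A (fun r => e r _) j m)]
        rw [shift (t := j) (s := j) (by omega) (by omega) l m (fun n => ih (by omega) n m),
          h.integral_noise_mul_sysState hW (by omega) le_rfl, add_zero]
      rw [shift (t := j) (s := j + 1) hj (by omega) i l hcross, gamPartial_succ]
      have : ∫ ω, e j ω i * sysState A (fun r => e r ω) (j + 1) l ∂μ = W i l := by
        rw [h.integral_noise_mul_sysState_succ (by omega) (by omega),
          h.integral_mul hW (by omega) (by omega), if_pos rfl, add_eq_right]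
        exact Finset.sum_eq_zero fun m _ => by
          rw [h.integral_noise_mul_sysState hW (by omega) le_rfl, mul_zero]
      have hsymm : (gamPartial A W j)ᵀ = gamPartial A W j := by
        simpa using (posSemidef_gamPartial A hW j).1.eq
      rw [this, transpose_mul, hsymm, Matrix.add_apply, mul_assoc]
  induction a generalizing i with
  | zero => simpa using hdiag j (by omega) i l
  | succ a ih =>
    rw [show a + 1 + j = (a + j) + 1 by ring, shift (by omega) (by omega) i l
      (fun m => ih (by omega) m), h.integral_noise_mul_sysState hW (by omega) (by omega),
      add_zero, pow_succ', mul_assoc]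

end IsNoise
end MixedLDS

namespace MixedLDS

variable {d : ℕ}

/-- `|S|⁻¹ ∑_{t ∈ S} (x_{t+a})_i x_t`. -/
noncomputable def lagVec (a : ℕ) (x : ℕ → EuclideanSpace ℝ (Fin d)) (S : Finset ℕ) (i : Fin d) :
    Fin d → ℝ :=
  (S.card : ℝ)⁻¹ • ∑ t ∈ S, x (t + a) i • (x t).ofLp

theorem lagVec_apply (a : ℕ) (x : ℕ → EuclideanSpace ℝ (Fin d)) (S : Finset ℕ) (i l : Fin d) :
    lagVec a x S i l = (S.card : ℝ)⁻¹ * ∑ t ∈ S, x (t + a) i * x t l := by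
  simp [lagVec, Finset.sum_apply]

/-- Mean of `lagVec` over the window `S` of the state started at zero. -/
noncomputable def lagMean (a : ℕ) (A W : Matrix (Fin d) (Fin d) ℝ) (S : Finset ℕ) :
    Matrix (Fin d) (Fin d) ℝ :=
  (S.card : ℝ)⁻¹ • ∑ t ∈ S, A ^ a * gamPartial A W t

theorem sum_geometric_le {ρ : ℝ} (h0 : 0 ≤ ρ) (h1 : ρ < 1) {ι : Type*} (S : Finset ι) (f : ι → ℕ)
    (hf : Set.InjOn f S) : ∑ s ∈ S, ρ ^ f s ≤ 1 / (1 - ρ) := by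
  classical
  rw [← Finset.sum_image (f := fun k => ρ ^ k) hf, one_div, ← tsum_geometric_of_lt_one h0 h1]
  exact (summable_geometric_of_lt_one h0 h1).sum_le_tsum _ fun k _ => pow_nonneg h0 k

theorem sum_pow_dist_le {ρ : ℝ} (h0 : 0 ≤ ρ) (h1 : ρ < 1) (S : Finset ℕ) (t : ℕ) :
    ∑ s ∈ S, ρ ^ (2 * ((t - s) + (s - t))) ≤ 2 / (1 - ρ) := by
  have hle : ∀ s, ρ ^ (2 * ((t - s) + (s - t))) ≤ ρ ^ ((t - s) + (s - t)) := fun s =>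
    pow_le_pow_of_le_one h0 h1.le (by omega)
  rw [← Finset.sum_filter_add_sum_filter_not S (fun s => s ≤ t)]
  have e1 : ∑ s ∈ S with s ≤ t, ρ ^ (2 * ((t - s) + (s - t))) ≤ 1 / (1 - ρ) :=
    (Finset.sum_le_sum fun s _ => hle s).trans (sum_geometric_le h0 h1 _ _ (by
      intro x hx y hy hxy
      simp only [Finset.coe_filter, Set.mem_ofPred_eq] at hx hy
      simp only at hxy
      omega))
  have e2 : ∑ s ∈ S with ¬ s ≤ t, ρ ^ (2 * ((t - s) + (s - t))) ≤ 1 / (1 - ρ) :=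
    (Finset.sum_le_sum fun s _ => hle s).trans (sum_geometric_le h0 h1 _ _ (by
      intro x hx y hy hxy
      simp only [Finset.coe_filter, Set.mem_ofPred_eq] at hx hy
      simp only at hxy
      omega))
  calc _ ≤ 1 / (1 - ρ) + 1 / (1 - ρ) := add_le_add e1 e2
    _ = _ := by ring

namespace IsNoise

variable {Ω : Type*} [MeasurableSpace Ω] {μ : Measure Ω}
  {R : ℕ} {e : ℕ → Ω → EuclideanSpace ℝ (Fin d)} {K : ℕ} {A W : Fin K → Matrix (Fin d) (Fin d) ℝ}
  {κ ρ Γmax Δ : ℝ} {k : Fin K}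

/-- The cross-covariance matrix of the states at times `t` and `s`. -/
noncomputable def crossCov (μ : Measure Ω) (A : Matrix (Fin d) (Fin d) ℝ)
    (e : ℕ → Ω → EuclideanSpace ℝ (Fin d)) (t s : ℕ) : Matrix (Fin d) (Fin d) ℝ :=
  Matrix.of fun i l => ∫ ω, sysState A (fun r => e r ω) t i * sysState A (fun r => e r ω) s l ∂μ

theorem crossCov_transpose (A : Matrix (Fin d) (Fin d) ℝ) (t s : ℕ) :
    (crossCov μ A e t s)ᵀ = crossCov μ A e s t := by
  ext i l
  simp only [crossCov, transpose_apply, of_apply, mul_comm]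

theorem specNorm_crossCov_le (H : ModelAssumptions A W κ ρ Γmax Δ) (h : IsNoise μ (W k) R e)
    {t s : ℕ} (ht : t ≤ R) (hs : s ≤ R) :
    specNorm (crossCov μ (A k) e t s) ≤ κ * Γmax * ρ ^ ((t - s) + (s - t)) := by
  have aux : ∀ {t s : ℕ}, t ≤ R → s ≤ t →
      specNorm (crossCov μ (A k) e t s) ≤ κ * Γmax * ρ ^ (t - s) := by
    intro t s ht hs
    obtain ⟨a, rfl⟩ := Nat.exists_eq_add_of_le' hs
    have : crossCov μ (A k) e (a + s) s = A k ^ a * gamPartial (A k) (W k) s := by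
      ext i l
      exact h.integral_sysState_mul (H.posDef k) ht i l
    rw [this, Nat.add_sub_cancel]
    have p1 := specNorm_nonneg (gamPartial (A k) (W k) s)
    have p2 := H.rho_nonneg
    have p3 := H.one_le_kappa
    calc _ ≤ specNorm (A k ^ a) * specNorm (gamPartial (A k) (W k) s) := specNorm_mul_le _ _
      _ ≤ (κ * ρ ^ a) * Γmax := by
        gcongr
        · exact H.specNorm_pow_le k a
        · exact H.specNorm_gamPartial_le k s
      _ = _ := by ring
  rcases le_total s t with hst | hst
  · rw [Nat.sub_eq_zero_of_le hst, add_zero]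
    exact aux ht hst
  · rw [Nat.sub_eq_zero_of_le hst, zero_add, ← crossCov_transpose, specNorm_transpose]
    exact aux hs hst

theorem memLp_sysState_mul (A : Matrix (Fin d) (Fin d) ℝ) {W : Matrix (Fin d) (Fin d) ℝ}
    (h : IsNoise μ W R e) {t s : ℕ} (ht : t ≤ R) (hs : s ≤ R) (i l : Fin d) :
    MemLp (fun ω => sysState A (fun r => e r ω) t i * sysState A (fun r => e r ω) s l) 2 μ := by
  obtain ⟨ℓ₁, h₁⟩ := exists_dual_sysState A e ht i
  obtain ⟨ℓ₂, h₂⟩ := exists_dual_sysState A e hs l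
  simp only [h₁, h₂]
  exact memLp_dual_mul h.hasGaussianLaw ℓ₁ ℓ₂

theorem covariance_sysState_mul (A : Matrix (Fin d) (Fin d) ℝ) {W : Matrix (Fin d) (Fin d) ℝ}
    (h : IsNoise μ W R e) {t t' s s' : ℕ} (ht : t ≤ R) (ht' : t' ≤ R) (hs : s ≤ R) (hs' : s' ≤ R)
    (i l m n : Fin d) :
    cov[fun ω => sysState A (fun r => e r ω) t i * sysState A (fun r => e r ω) t' l,
      fun ω => sysState A (fun r => e r ω) s m * sysState A (fun r => e r ω) s' n; μ] =
      crossCov μ A e t s i m * crossCov μ A e t' s' l n +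
      crossCov μ A e t s' i n * crossCov μ A e t' s l m := by
  have hp := h.hasGaussianLaw.isProbabilityMeasure
  rw [covariance_eq_sub (h.memLp_sysState_mul A ht ht' i l) (h.memLp_sysState_mul A hs hs' m n)]
  obtain ⟨ℓ₁, h₁⟩ := exists_dual_sysState A e ht i
  obtain ⟨ℓ₂, h₂⟩ := exists_dual_sysState A e ht' l
  obtain ⟨ℓ₃, h₃⟩ := exists_dual_sysState A e hs m
  obtain ⟨ℓ₄, h₄⟩ := exists_dual_sysState A e hs' n
  simp only [Pi.mul_apply, crossCov, of_apply, h₁, h₂, h₃, h₄]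
  rw [integral_dual_mul_four h.hasGaussianLaw h.integral_dual]
  ring

theorem abs_covariance_quadForm_le (H : ModelAssumptions A W κ ρ Γmax Δ)
    (h : IsNoise μ (W k) R e) (Z : Matrix (Fin d) (Fin d) ℝ) {a t s : ℕ} (ht : t + a ≤ R)
    (hs : s + a ≤ R) :
    |cov[fun ω => ∑ p : Fin d × Fin d, Z p.1 p.2 * (sysState (A k) (fun r => e r ω) (t + a) p.1 *
        sysState (A k) (fun r => e r ω) t p.2),
      fun ω => ∑ p : Fin d × Fin d, Z p.1 p.2 * (sysState (A k) (fun r => e r ω) (s + a) p.1 *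
        sysState (A k) (fun r => e r ω) s p.2); μ]| ≤
      2 * (κ * Γmax) ^ 2 * ρ ^ (2 * ((t - s) + (s - t))) * frobSq Z := by
  have hp := h.hasGaussianLaw.isProbabilityMeasure
  have hκ := H.one_le_kappa
  have hρ := H.rho_nonneg
  have hΓ := H.gammaMax_nonneg k
  have hm : ∀ {t : ℕ}, t + a ≤ R → ∀ p : Fin d × Fin d, MemLp (fun ω => Z p.1 p.2 *
      (sysState (A k) (fun r => e r ω) (t + a) p.1 * sysState (A k) (fun r => e r ω) t p.2)) 2 μ :=
    fun ht p => (h.memLp_sysState_mul (A k) ht (by omega) p.1 p.2).const_mul (Z p.1 p.2)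
  rw [covariance_fun_sum_fun_sum (hm ht) (hm hs)]
  simp only [covariance_const_mul_left, covariance_const_mul_right]
  have e1 : ∀ p q : Fin d × Fin d, cov[
      fun ω => sysState (A k) (fun r => e r ω) (t + a) p.1 * sysState (A k) (fun r => e r ω) t p.2,
      fun ω => sysState (A k) (fun r => e r ω) (s + a) q.1 * sysState (A k) (fun r => e r ω) s q.2;
      μ] = _ := fun p q =>
    h.covariance_sysState_mul (A k) ht (by omega) hs (by omega) p.1 p.2 q.1 q.2
  simp only [e1]
  set C := crossCov μ (A k) e
  have key : ∑ p : Fin d × Fin d, ∑ q : Fin d × Fin d, Z q.1 q.2 * (Z p.1 p.2 *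
      (C (t + a) (s + a) p.1 q.1 * C t s p.2 q.2 + C (t + a) s p.1 q.2 * C t (s + a) p.2 q.1)) =
      (∑ i, ∑ l, Z i l * (C (t + a) (s + a) * Z * (C t s)ᵀ) i l) +
      ∑ i, ∑ l, Z i l * (C (t + a) s * Zᵀ * (C t (s + a))ᵀ) i l := by
    rw [← Finset.sum_add_distrib, Fintype.sum_prod_type]
    refine Finset.sum_congr rfl fun i _ => ?_
    rw [← Finset.sum_add_distrib]
    refine Finset.sum_congr rfl fun l _ => ?_
    simp only [mul_left_comm _ (Z i l)]
    rw [← mul_add, ← Finset.mul_sum]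
    congr 1
    simp only [mul_apply, transpose_apply, Finset.sum_mul, mul_add, Finset.sum_add_distrib,
      Fintype.sum_prod_type]
    congr 1
    · rw [Finset.sum_comm]
      refine Finset.sum_congr rfl fun m _ => Finset.sum_congr rfl fun n _ => ?_
      ring
    · refine Finset.sum_congr rfl fun m _ => Finset.sum_congr rfl fun n _ => ?_
      ring
  rw [key]
  have b : ∀ {t s : ℕ}, t ≤ R → s ≤ R → specNorm (C t s) ≤ κ * Γmax * ρ ^ ((t - s) + (s - t)) :=
    fun ht hs => specNorm_crossCov_le H h ht hs
  have pw : ∀ {m n : ℕ}, n ≤ m → ρ ^ m ≤ ρ ^ n := fun hmn =>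
    pow_le_pow_of_le_one hρ H.rho_lt_one.le hmn
  have prod_le : ∀ {t₁ s₁ t₂ s₂ : ℕ}, t₁ ≤ R → s₁ ≤ R → t₂ ≤ R → s₂ ≤ R →
      2 * ((t - s) + (s - t)) ≤ ((t₁ - s₁) + (s₁ - t₁)) + ((t₂ - s₂) + (s₂ - t₂)) →
      specNorm (C t₁ s₁) * specNorm (C t₂ s₂)ᵀ * frobSq Z ≤
        (κ * Γmax) ^ 2 * ρ ^ (2 * ((t - s) + (s - t))) * frobSq Z := by
    intro t₁ s₁ t₂ s₂ h₁ h₂ h₃ h₄ hd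
    refine mul_le_mul_of_nonneg_right ?_ (frobSq_nonneg Z)
    rw [specNorm_transpose]
    calc _ ≤ (κ * Γmax * ρ ^ ((t₁ - s₁) + (s₁ - t₁))) * (κ * Γmax * ρ ^ ((t₂ - s₂) + (s₂ - t₂))) :=
          mul_le_mul (b h₁ h₂) (b h₃ h₄) (specNorm_nonneg _) (by positivity)
      _ = (κ * Γmax) ^ 2 * ρ ^ (((t₁ - s₁) + (s₁ - t₁)) + ((t₂ - s₂) + (s₂ - t₂))) := by
          rw [pow_add]; ring
      _ ≤ _ := mul_le_mul_of_nonneg_left (pw hd) (by positivity)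
  calc _ ≤ specNorm (C (t + a) (s + a)) * specNorm (C t s)ᵀ * frobSq Z +
        specNorm (C (t + a) s) * specNorm (C t (s + a))ᵀ * frobSq Z :=
        (abs_add_le _ _).trans (add_le_add (abs_sum_mul_mul_mul_le _ _ _ _ rfl)
          (abs_sum_mul_mul_mul_le _ _ _ _ (frobSq_transpose Z)))
    _ ≤ (κ * Γmax) ^ 2 * ρ ^ (2 * ((t - s) + (s - t))) * frobSq Z +
        (κ * Γmax) ^ 2 * ρ ^ (2 * ((t - s) + (s - t))) * frobSq Z :=
        add_le_add (prod_le (by omega) (by omega) (by omega) (by omega) (by omega))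
          (prod_le (by omega) (by omega) (by omega) (by omega) (by omega))
    _ = _ := by ring

theorem memLp_lagVec (A : Matrix (Fin d) (Fin d) ℝ) {W : Matrix (Fin d) (Fin d) ℝ}
    (h : IsNoise μ W R e) {a : ℕ} {S : Finset ℕ} (hS : ∀ t ∈ S, t + a ≤ R) (i l : Fin d) :
    MemLp (fun ω => lagVec a (sysState A fun r => e r ω) S i l) 2 μ := by
  simp only [lagVec_apply]
  exact (memLp_finsetSum S fun t ht => h.memLp_sysState_mul A (hS t ht)
    (by have := hS t ht; omega) i l).const_mul _

theorem integral_lagVec (A : Matrix (Fin d) (Fin d) ℝ) {W : Matrix (Fin d) (Fin d) ℝ}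
    (h : IsNoise μ W R e) (hW : W.PosDef) {a : ℕ} {S : Finset ℕ} (hS : ∀ t ∈ S, t + a ≤ R)
    (i l : Fin d) :
    ∫ ω, lagVec a (sysState A fun r => e r ω) S i l ∂μ = lagMean a A W S i l := by
  simp only [lagVec_apply, lagMean]
  have hp := h.hasGaussianLaw.isProbabilityMeasure
  rw [integral_const_mul, integral_finsetSum _ fun t ht => (h.memLp_sysState_mul A (hS t ht)
    (by have := hS t ht; omega) i l).integrable (by norm_num), Matrix.smul_apply, Matrix.sum_apply,
    smul_eq_mul]
  congr 1
  refine Finset.sum_congr rfl fun t ht => ?_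
  have := hS t ht
  rw [add_comm t a]
  exact h.integral_sysState_mul hW (by omega) i l

/-- Linear functionals of the empirical lag-`a` covariance concentrate around their mean. -/
theorem variance_lagVec_le (H : ModelAssumptions A W κ ρ Γmax Δ) (h : IsNoise μ (W k) R e)
    (Z : Matrix (Fin d) (Fin d) ℝ) {a : ℕ} {S : Finset ℕ} (hS : ∀ t ∈ S, t + a ≤ R) :
    Var[fun ω => ∑ p : Fin d × Fin d, Z p.1 p.2 *
        lagVec a (sysState (A k) fun r => e r ω) S p.1 p.2; μ] ≤
      4 * (κ * Γmax) ^ 2 / (S.card * (1 - ρ)) * frobSq Z := by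
  have hp := h.hasGaussianLaw.isProbabilityMeasure
  have e0 : (fun ω => ∑ p : Fin d × Fin d, Z p.1 p.2 *
      lagVec a (sysState (A k) fun r => e r ω) S p.1 p.2) =
      fun ω => (S.card : ℝ)⁻¹ * ∑ t ∈ S, ∑ p : Fin d × Fin d, Z p.1 p.2 *
        (sysState (A k) (fun r => e r ω) (t + a) p.1 * sysState (A k) (fun r => e r ω) t p.2) := by
    funext ω
    rw [Finset.sum_comm, Finset.mul_sum]
    refine Finset.sum_congr rfl fun p _ => ?_
    rw [lagVec_apply, ← Finset.mul_sum]
    ring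
  rw [e0, variance_const_mul, variance_fun_sum' (fun t ht => memLp_finsetSum _ fun p _ =>
    (h.memLp_sysState_mul (A k) (hS t ht) (by have := hS t ht; omega) p.1 p.2).const_mul _)]
  have h1 : 0 < 1 - ρ := by linarith [H.rho_lt_one]
  have hsum : ∑ t ∈ S, ∑ s ∈ S, cov[fun ω => ∑ p : Fin d × Fin d, Z p.1 p.2 *
        (sysState (A k) (fun r => e r ω) (t + a) p.1 * sysState (A k) (fun r => e r ω) t p.2),
      fun ω => ∑ p : Fin d × Fin d, Z p.1 p.2 * (sysState (A k) (fun r => e r ω) (s + a) p.1 *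
        sysState (A k) (fun r => e r ω) s p.2); μ] ≤
      S.card * (4 * (κ * Γmax) ^ 2 / (1 - ρ) * frobSq Z) := by
    rw [← nsmul_eq_mul, ← Finset.sum_const]
    refine Finset.sum_le_sum fun t ht => ?_
    calc _ ≤ ∑ s ∈ S, 2 * (κ * Γmax) ^ 2 * ρ ^ (2 * ((t - s) + (s - t))) * frobSq Z :=
          Finset.sum_le_sum fun s hs => (le_abs_self _).trans
            (abs_covariance_quadForm_le H h Z (hS t ht) (hS s hs))
      _ = 2 * (κ * Γmax) ^ 2 * frobSq Z * ∑ s ∈ S, ρ ^ (2 * ((t - s) + (s - t))) := by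
          rw [Finset.mul_sum]
          exact Finset.sum_congr rfl fun s _ => by ring
      _ ≤ 2 * (κ * Γmax) ^ 2 * frobSq Z * (2 / (1 - ρ)) := by
          have := frobSq_nonneg Z
          gcongr
          exact sum_pow_dist_le H.rho_nonneg H.rho_lt_one S t
      _ = _ := by ring
  rcases Finset.eq_empty_or_nonempty S with rfl | hne
  · simp
  have hc : (0 : ℝ) < S.card := by exact_mod_cast hne.card_pos
  calc _ ≤ (S.card : ℝ)⁻¹ ^ 2 * (S.card * (4 * (κ * Γmax) ^ 2 / (1 - ρ) * frobSq Z)) := by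
        gcongr
    _ = _ := by field_simp

end IsNoise
end MixedLDS

namespace MixedLDS

section Bilinear

variable {Ω : Type*} [MeasurableSpace Ω] {μ : Measure Ω}
  {J : Type*} [Fintype J]

theorem integral_sum_mul_sq_le {ξ η : Ω → J → ℝ} (hξ : ∀ j, MemLp (fun ω => ξ ω j) 2 μ)
    (hη : ∀ j, MemLp (fun ω => η ω j) 2 μ) (hind : IndepFun ξ η μ) {s : ℝ} (hs : 0 ≤ s)
    (hξs : ∀ c : J → ℝ, ∫ ω, (∑ j, c j * ξ ω j) ^ 2 ∂μ ≤ s * ∑ j, c j ^ 2)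
    (hηs : ∀ c : J → ℝ, ∫ ω, (∑ j, c j * η ω j) ^ 2 ∂μ ≤ s * ∑ j, c j ^ 2) :
    Integrable (fun ω => (∑ j, ξ ω j * η ω j) ^ 2) μ ∧
      ∫ ω, (∑ j, ξ ω j * η ω j) ^ 2 ∂μ ≤ s ^ 2 * Fintype.card J := by
  classical
  have iξ : ∀ j k, Integrable (fun ω => ξ ω j * ξ ω k) μ := fun j k => (hξ j).integrable_mul (hξ k)
  have iη : ∀ j k, Integrable (fun ω => η ω j * η ω k) μ := fun j k => (hη j).integrable_mul (hη k)
  have hi : ∀ j k, IndepFun (fun ω => ξ ω j * ξ ω k) (fun ω => η ω j * η ω k) μ := fun j k =>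
    hind.comp (φ := fun x : J → ℝ => x j * x k) (ψ := fun x : J → ℝ => x j * x k)
      (by fun_prop) (by fun_prop)
  have iξη : ∀ j k, Integrable (fun ω => (ξ ω j * ξ ω k) * (η ω j * η ω k)) μ := fun j k =>
    (hi j k).integrable_mul (iξ j k) (iη j k)
  have expand : ∀ ω, (∑ j, ξ ω j * η ω j) ^ 2 =
      ∑ j, ∑ k, (ξ ω j * ξ ω k) * (η ω j * η ω k) := fun ω => by
    rw [sq, Finset.sum_mul_sum]
    exact Finset.sum_congr rfl fun j _ => Finset.sum_congr rfl fun k _ => by ring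
  simp only [expand]
  have hint : Integrable (fun ω => ∑ j, ∑ k, (ξ ω j * ξ ω k) * (η ω j * η ω k)) μ :=
    integrable_finsetSum _ fun j _ => integrable_finsetSum _ fun k _ => iξη j k
  refine ⟨hint, ?_⟩
  have e1 : ∫ ω, ∑ j, ∑ k, (ξ ω j * ξ ω k) * (η ω j * η ω k) ∂μ =
      ∫ ω, ∑ j, ∑ k, (ξ ω j * ξ ω k) * ∫ ω', η ω' j * η ω' k ∂μ ∂μ := by
    rw [integral_finsetSum _ fun j _ => integrable_finsetSum _ fun k _ => iξη j k,
      integral_finsetSum _ fun j _ => integrable_finsetSum _ fun k _ => (iξ j k).mul_const _]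
    refine Finset.sum_congr rfl fun j _ => ?_
    rw [integral_finsetSum _ fun k _ => iξη j k,
      integral_finsetSum _ fun k _ => (iξ j k).mul_const _]
    refine Finset.sum_congr rfl fun k _ => ?_
    rw [integral_mul_const]
    exact (hi j k).integral_mul_eq_mul_integral (iξ j k).aestronglyMeasurable
      (iη j k).aestronglyMeasurable
  have e2 : ∀ c : J → ℝ, ∑ j, ∑ k, (c j * c k) * ∫ ω', η ω' j * η ω' k ∂μ =
      ∫ ω, (∑ j, c j * η ω j) ^ 2 ∂μ := by
    intro c
    have : ∀ ω, (∑ j, c j * η ω j) ^ 2 = ∑ j, ∑ k, (c j * c k) * (η ω j * η ω k) := fun ω => by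
      rw [sq, Finset.sum_mul_sum]
      exact Finset.sum_congr rfl fun j _ => Finset.sum_congr rfl fun k _ => by ring
    simp only [this]
    rw [integral_finsetSum _ fun j _ => integrable_finsetSum _ fun k _ => (iη j k).const_mul _]
    refine Finset.sum_congr rfl fun j _ => ?_
    rw [integral_finsetSum _ fun k _ => (iη j k).const_mul _]
    exact Finset.sum_congr rfl fun k _ => (integral_const_mul _ _).symm
  have e3 : ∀ j, ∫ ω, ξ ω j ^ 2 ∂μ ≤ s := fun j => by
    simpa [Pi.single_apply] using hξs (Pi.single j 1)
  have i2 : ∀ j, Integrable (fun ω => ξ ω j ^ 2) μ := fun j => (hξ j).integrable_sq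
  calc _ = ∫ ω, ∑ j, ∑ k, (ξ ω j * ξ ω k) * ∫ ω', η ω' j * η ω' k ∂μ ∂μ := e1
    _ ≤ ∫ ω, s * ∑ j, ξ ω j ^ 2 ∂μ := by
        refine integral_mono (integrable_finsetSum _ fun j _ => integrable_finsetSum _ fun k _ =>
          (iξ j k).mul_const _) ((integrable_finsetSum _ fun j _ => i2 j).const_mul _) fun ω => ?_
        simp only [e2 (ξ ω)]
        exact hηs (ξ ω)
    _ = s * ∑ j, ∫ ω, ξ ω j ^ 2 ∂μ := by
        rw [integral_const_mul, integral_finsetSum _ fun j _ => i2 j]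
    _ ≤ s * ∑ _j : J, s := by gcongr with j; exact e3 j
    _ = _ := by simp; ring

/-- Concentration of the inner product of two independent random vectors with the same mean. -/
theorem measureReal_abs_dot_sub_le [IsProbabilityMeasure μ] {u v : Ω → J → ℝ} (hu : ∀ j, MemLp (fun ω => u ω j) 2 μ)
    (hv : ∀ j, MemLp (fun ω => v ω j) 2 μ) (hind : IndepFun u v μ) {q : J → ℝ}
    (hum : ∀ j, ∫ ω, u ω j ∂μ = q j) (hvm : ∀ j, ∫ ω, v ω j ∂μ = q j) {s : ℝ} (hs : 0 ≤ s)
    (hus : ∀ c : J → ℝ, Var[fun ω => ∑ j, c j * u ω j; μ] ≤ s * ∑ j, c j ^ 2)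
    (hvs : ∀ c : J → ℝ, Var[fun ω => ∑ j, c j * v ω j; μ] ≤ s * ∑ j, c j ^ 2)
    {r : ℝ} (hr : 0 < r) :
    μ.real {ω | r < |∑ j, u ω j * v ω j - ∑ j, q j ^ 2|} ≤
      3 * (2 * s * ∑ j, q j ^ 2 + s ^ 2 * Fintype.card J) / r ^ 2 := by
  have center : ∀ w : Ω → J → ℝ, (∀ j, MemLp (fun ω => w ω j) 2 μ) → (∀ j, ∫ ω, w ω j ∂μ = q j) →
      (∀ c : J → ℝ, Var[fun ω => ∑ j, c j * w ω j; μ] ≤ s * ∑ j, c j ^ 2) →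
      (∀ j, MemLp (fun ω => w ω j - q j) 2 μ) ∧
      ∀ c : J → ℝ, ∫ ω, (∑ j, c j * (w ω j - q j)) ^ 2 ∂μ ≤ s * ∑ j, c j ^ 2 := by
    intro w hw hm hV
    refine ⟨fun j => (hw j).sub (memLp_const _), fun c => ?_⟩
    refine le_of_eq_of_le ?_ (hV c)
    have hmem : MemLp (fun ω => ∑ j, c j * w ω j) 2 μ :=
      memLp_finsetSum _ fun j _ => (hw j).const_mul _
    rw [variance_eq_integral hmem.aestronglyMeasurable.aemeasurable,
      integral_finsetSum _ fun j _ => ((hw j).const_mul _).integrable (by norm_num)]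
    simp only [integral_const_mul, hm, mul_sub, Finset.sum_sub_distrib]
  obtain ⟨mξ, hξ⟩ := center u hu hum hus
  obtain ⟨mη, hη⟩ := center v hv hvm hvs
  have hind' : IndepFun (fun ω j => u ω j - q j) (fun ω j => v ω j - q j) μ :=
    hind.comp (φ := fun (x : J → ℝ) j => x j - q j) (ψ := fun (x : J → ℝ) j => x j - q j)
      (by fun_prop) (by fun_prop)
  obtain ⟨iB, hB⟩ := integral_sum_mul_sq_le mξ mη hind' hs hξ hη
  have i1 : Integrable (fun ω => (∑ j, q j * (u ω j - q j)) ^ 2) μ :=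
    (memLp_finsetSum _ fun j _ => (mξ j).const_mul _).integrable_sq
  have i2 : Integrable (fun ω => (∑ j, q j * (v ω j - q j)) ^ 2) μ :=
    (memLp_finsetSum _ fun j _ => (mη j).const_mul _).integrable_sq
  set g : Ω → ℝ := fun ω => 3 * ((∑ j, q j * (u ω j - q j)) ^ 2 + (∑ j, q j * (v ω j - q j)) ^ 2 +
    (∑ j, (u ω j - q j) * (v ω j - q j)) ^ 2) with hg
  have ig : Integrable g μ := ((i1.add i2).add iB).const_mul 3
  have hsub : {ω | r < |∑ j, u ω j * v ω j - ∑ j, q j ^ 2|} ⊆ {ω | r ^ 2 ≤ g ω} := by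
    intro ω hω
    have hω' : r < |∑ j, u ω j * v ω j - ∑ j, q j ^ 2| := hω
    have e : ∑ j, u ω j * v ω j - ∑ j, q j ^ 2 = ∑ j, q j * (u ω j - q j) +
        ∑ j, q j * (v ω j - q j) + ∑ j, (u ω j - q j) * (v ω j - q j) := by
      rw [← Finset.sum_add_distrib, ← Finset.sum_add_distrib, ← Finset.sum_sub_distrib]
      exact Finset.sum_congr rfl fun j _ => by ring
    change r ^ 2 ≤ g ω
    have h2 : r ^ 2 ≤ (∑ j, u ω j * v ω j - ∑ j, q j ^ 2) ^ 2 := by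
      rw [← sq_abs (_ - _)]
      exact pow_le_pow_left₀ hr.le hω'.le 2
    rw [e] at h2
    simp only [hg]
    set x := ∑ j, q j * (u ω j - q j)
    set y := ∑ j, q j * (v ω j - q j)
    set z := ∑ j, (u ω j - q j) * (v ω j - q j)
    nlinarith [sq_nonneg (x - y), sq_nonneg (x - z), sq_nonneg (y - z)]
  have hint : ∫ ω, g ω ∂μ ≤ 3 * (2 * s * ∑ j, q j ^ 2 + s ^ 2 * Fintype.card J) := by
    simp only [hg]
    rw [integral_const_mul, integral_add ?_ iB, integral_add i1 i2]
    · have := hξ q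
      have := hη q
      linarith
    · exact i1.add i2
  have hM := mul_meas_ge_le_integral_of_nonneg (ae_of_all μ fun ω => by
    simp only [hg, Pi.zero_apply]; positivity) ig (r ^ 2)
  rw [le_div_iff₀ (by positivity), mul_comm]
  calc _ ≤ r ^ 2 * μ.real {ω | r ^ 2 ≤ g ω} :=
        mul_le_mul_of_nonneg_left (measureReal_mono hsub) (sq_nonneg r)
    _ ≤ _ := hM.trans hint

end Bilinear

section Majority

variable {Ω : Type*} {mΩ : MeasurableSpace Ω} {μ : Measure Ω}

/-- Grouping an independent family of σ-algebras along disjoint index sets. -/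
theorem iIndep_iSup_of_disjoint [IsProbabilityMeasure μ] {ι κ : Type*} {m : ι → MeasurableSpace Ω}
    (hle : ∀ i, m i ≤ mΩ) (h : iIndep m μ) {S : κ → Set ι}
    (hS : ∀ p q, p ≠ q → Disjoint (S p) (S q)) : iIndep (fun p => ⨆ i ∈ S p, m i) μ := by
  classical
  rw [iIndep_iff]
  intro s
  induction s using Finset.induction_on with
  | empty => simp
  | insert a s ha ih =>
    intro f hf
    rw [Finset.set_biInter_insert, Finset.prod_insert ha,
      ← ih fun i hi => hf i (Finset.mem_insert_of_mem hi)]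
    have hd : Disjoint (S a) (⋃ p ∈ s, S p) := by
      rw [Set.disjoint_iUnion₂_right]
      intro p hp
      exact hS a p (by rintro rfl; exact ha hp)
    have hI := indep_iSup_of_disjoint hle h hd
    rw [Indep_iff] at hI
    refine hI _ _ (hf a (Finset.mem_insert_self _ _)) ?_
    refine Finset.measurableSet_biInter s fun p hp => ?_
    have hmono : (⨆ i ∈ S p, m i) ≤ ⨆ i ∈ ⋃ p ∈ s, S p, m i :=
      biSup_mono fun i hi => Set.mem_iUnion₂.2 ⟨p, hp, hi⟩
    exact hmono _ (hf p (Finset.mem_insert_of_mem hp))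

theorem measureReal_majority_le [IsProbabilityMeasure μ] {G : ℕ} {m : Fin G → MeasurableSpace Ω}
    (h : iIndep m μ) {B : Fin G → Set Ω} (hB : ∀ g, MeasurableSet[m g] (B g))
    (hp : ∀ g, μ.real (B g) ≤ 1 / 64) :
    μ.real {ω | ∃ S : Finset (Fin G), G ≤ 2 * S.card ∧ ∀ g ∈ S, ω ∈ B g} ≤ (1 / 4) ^ G := by
  classical
  rw [iIndep_iff] at h
  have hset : {ω | ∃ S : Finset (Fin G), G ≤ 2 * S.card ∧ ∀ g ∈ S, ω ∈ B g} =
      ⋃ S ∈ (Finset.univ.filter fun S : Finset (Fin G) => G ≤ 2 * S.card), ⋂ g ∈ S, B g := by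
    ext ω
    simp
  have hone : ∀ S : Finset (Fin G), G ≤ 2 * S.card → μ.real (⋂ g ∈ S, B g) ≤ (1 / 8) ^ G := by
    intro S hS
    rw [measureReal_def, h S fun g _ => hB g, ENNReal.toReal_prod]
    calc ∏ g ∈ S, (μ (B g)).toReal ≤ ∏ _g ∈ S, (1 / 64 : ℝ) :=
          Finset.prod_le_prod (fun _ _ => ENNReal.toReal_nonneg) fun g _ => hp g
      _ = (1 / 8) ^ (2 * S.card) := by rw [Finset.prod_const, pow_mul]; norm_num
      _ ≤ (1 / 8) ^ G := pow_le_pow_of_le_one (by norm_num) (by norm_num) hS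
  rw [hset]
  calc _ ≤ ∑ S ∈ (Finset.univ.filter fun S : Finset (Fin G) => G ≤ 2 * S.card),
        μ.real (⋂ g ∈ S, B g) := measureReal_biUnion_finset_le _ _
    _ ≤ ∑ S ∈ (Finset.univ.filter fun S : Finset (Fin G) => G ≤ 2 * S.card), (1 / 8 : ℝ) ^ G :=
        Finset.sum_le_sum fun S hS => hone S (Finset.mem_filter.1 hS).2
    _ ≤ ∑ S : Finset (Fin G), (1 / 8 : ℝ) ^ G :=
        Finset.sum_le_sum_of_subset_of_nonneg (Finset.filter_subset _ _) fun _ _ _ => by positivity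
    _ = (1 / 4) ^ G := by
        rw [Finset.sum_const, Finset.card_univ, Fintype.card_finset, Fintype.card_fin,
          nsmul_eq_mul, Nat.cast_pow, ← mul_pow]
        norm_num

theorem median_mem_Icc {n : ℕ} (hn : 0 < n) {a : Fin n → ℝ} {lo hi : ℝ}
    (h : ∀ S : Finset (Fin n), n ≤ 2 * S.card → ∃ g ∈ S, lo ≤ a g ∧ a g ≤ hi) :
    lo ≤ median a ∧ median a ≤ hi := by
  have key : ∀ i : Fin n, 2 * (i : ℕ) ≤ n → n ≤ 2 * (i + 1) →
      lo ≤ a (Tuple.sort a i) ∧ a (Tuple.sort a i) ≤ hi := by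
    intro i h1 h2
    constructor
    · obtain ⟨g, hg, hlo, -⟩ := h ((Finset.Iic i).map (Tuple.sort a).toEmbedding) (by
        rw [Finset.card_map, Fin.card_Iic]; exact h2)
      obtain ⟨j, hj, rfl⟩ := Finset.mem_map.1 hg
      exact hlo.trans (Tuple.monotone_sort a (Finset.mem_Iic.1 hj))
    · obtain ⟨g, hg, -, hhi⟩ := h ((Finset.Ici i).map (Tuple.sort a).toEmbedding) (by
        rw [Finset.card_map, Fin.card_Ici]; omega)
      obtain ⟨j, hj, rfl⟩ := Finset.mem_map.1 hg
      exact (Tuple.monotone_sort a (Finset.mem_Ici.1 hj)).trans hhi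
  rw [median, dif_pos hn]
  have k1 := key ⟨(n - 1) / 2, by omega⟩ (by simp only; omega) (by simp only; omega)
  have k2 := key ⟨n / 2, by omega⟩ (by simp only; omega) (by simp only; omega)
  constructor <;> linarith [k1.1, k1.2, k2.1, k2.2]

theorem median_zero (n : ℕ) : median (fun _ : Fin n => (0 : ℝ)) = 0 := by
  simp [median]

end Majority
end MixedLDS

namespace MixedLDS

variable {d K : ℕ}

/-- The rows of `f` as a single Euclidean vector. -/
noncomputable def flat (f : Matrix (Fin d) (Fin d) ℝ) : EuclideanSpace ℝ (Fin d × Fin d) :=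
  WithLp.toLp 2 fun p => f p.1 p.2

/-- The coordinates `V_iᵀ f_i` of the projected rows of `f`. -/
noncomputable def projRows (V : Fin d → Matrix (Fin d) (Fin K) ℝ) (f : Matrix (Fin d) (Fin d) ℝ) :
    EuclideanSpace ℝ (Fin d × Fin K) :=
  WithLp.toLp 2 fun p => ((V p.1)ᵀ *ᵥ f p.1) p.2

theorem flat_sub (f g : Matrix (Fin d) (Fin d) ℝ) : flat (f - g) = flat f - flat g := rfl

theorem projRows_sub (V : Fin d → Matrix (Fin d) (Fin K) ℝ) (f g : Matrix (Fin d) (Fin d) ℝ) :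
    projRows V (f - g) = projRows V f - projRows V g := by
  ext p
  change ((V p.1)ᵀ *ᵥ (f p.1 - g p.1)) p.2 = _
  rw [mulVec_sub]
  rfl

theorem norm_flat_sq (f : Matrix (Fin d) (Fin d) ℝ) : ‖flat f‖ ^ 2 = frobSq f := by
  simp [EuclideanSpace.real_norm_sq_eq, flat, frobSq, Fintype.sum_prod_type]

theorem norm_flat_sq_eq_sum (f : Matrix (Fin d) (Fin d) ℝ) :
    ‖flat f‖ ^ 2 = ∑ i, ‖WithLp.toLp 2 (f i)‖ ^ 2 := by
  simp [EuclideanSpace.real_norm_sq_eq, flat, Fintype.sum_prod_type]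

theorem norm_flat (f : Matrix (Fin d) (Fin d) ℝ) : ‖flat f‖ = √(frobSq f) := by
  rw [← norm_flat_sq, Real.sqrt_sq (norm_nonneg _)]

theorem norm_toLp_transpose_mulVec_sq {V : Matrix (Fin d) (Fin K) ℝ} (hV : Vᵀ * V = 1)
    (v : Fin d → ℝ) : ‖WithLp.toLp 2 (Vᵀ *ᵥ v)‖ ^ 2 =
      ‖WithLp.toLp 2 v‖ ^ 2 - ‖WithLp.toLp 2 (v - (V * Vᵀ) *ᵥ v)‖ ^ 2 := by
  have hn : ∀ {n : ℕ} (x : Fin n → ℝ), ‖WithLp.toLp 2 x‖ ^ 2 = x ⬝ᵥ x := fun x => by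
    rw [EuclideanSpace.real_norm_sq_eq]
    simp [dotProduct, sq]
  have h1 : v ⬝ᵥ (V * Vᵀ) *ᵥ v = (Vᵀ *ᵥ v) ⬝ᵥ (Vᵀ *ᵥ v) := by
    rw [← mulVec_mulVec, dotProduct_mulVec, ← mulVec_transpose]
  have h2 : ((V * Vᵀ) *ᵥ v) ⬝ᵥ ((V * Vᵀ) *ᵥ v) = (Vᵀ *ᵥ v) ⬝ᵥ (Vᵀ *ᵥ v) := by
    rw [← mulVec_mulVec, dotProduct_mulVec, ← mulVec_transpose, mulVec_mulVec, hV, one_mulVec]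
  rw [hn, hn, hn, sub_dotProduct, dotProduct_sub, dotProduct_sub, h1, (dotProduct_comm _ v).trans h1, h2]
  ring

theorem norm_projRows_sq {V : Fin d → Matrix (Fin d) (Fin K) ℝ} (hV : ∀ i, (V i)ᵀ * V i = 1)
    (f : Matrix (Fin d) (Fin d) ℝ) : ‖projRows V f‖ ^ 2 =
      ‖flat f‖ ^ 2 - ∑ i, ‖WithLp.toLp 2 (f i - (V i * (V i)ᵀ) *ᵥ f i)‖ ^ 2 := by
  rw [norm_flat_sq_eq_sum, ← Finset.sum_sub_distrib]
  have : ‖projRows V f‖ ^ 2 = ∑ i, ‖WithLp.toLp 2 ((V i)ᵀ *ᵥ f i)‖ ^ 2 := by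
    simp [EuclideanSpace.real_norm_sq_eq, projRows, Fintype.sum_prod_type]
  rw [this]
  exact Finset.sum_congr rfl fun i _ => norm_toLp_transpose_mulVec_sq (hV i) (f i)

theorem norm_projRows_le {V : Fin d → Matrix (Fin d) (Fin K) ℝ} (hV : ∀ i, (V i)ᵀ * V i = 1)
    (f : Matrix (Fin d) (Fin d) ℝ) : ‖projRows V f‖ ≤ ‖flat f‖ := by
  refine (sq_le_sq₀ (norm_nonneg _) (norm_nonneg _)).1 ?_
  rw [norm_projRows_sq hV]
  have : 0 ≤ ∑ i, ‖WithLp.toLp 2 (f i - (V i * (V i)ᵀ) *ᵥ f i)‖ ^ 2 :=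
    Finset.sum_nonneg fun _ _ => sq_nonneg _
  linarith

theorem ApproxRows.abs_norm_projRows_sub_le {V : Fin d → Matrix (Fin d) (Fin K) ℝ}
    {X : Fin K → Matrix (Fin d) (Fin d) ℝ} {c : ℝ} (hc : 0 ≤ c)
    (h : ApproxRows V X (c / √d)) (k l : Fin K) :
    |‖projRows V (X k - X l)‖ - √(frobSq (X k - X l))| ≤ 2 * c := by
  have hflat : ‖flat (X k - X l)‖ = √(frobSq (X k - X l)) := norm_flat _
  rw [← hflat]
  have hres : ∑ i, ‖WithLp.toLp 2 ((X k - X l) i - (V i * (V i)ᵀ) *ᵥ (X k - X l) i)‖ ^ 2 ≤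
      (2 * c) ^ 2 := by
    have hone : ∀ i, ‖WithLp.toLp 2 ((X k - X l) i - (V i * (V i)ᵀ) *ᵥ (X k - X l) i)‖ ^ 2 ≤
        (2 * (c / √d)) ^ 2 := by
      intro i
      refine pow_le_pow_left₀ (norm_nonneg _) ?_ 2
      have e : WithLp.toLp 2 ((X k - X l) i - (V i * (V i)ᵀ) *ᵥ (X k - X l) i) =
          WithLp.toLp 2 (X k i - (V i * (V i)ᵀ) *ᵥ X k i) -
            WithLp.toLp 2 (X l i - (V i * (V i)ᵀ) *ᵥ X l i) := by
        rw [← WithLp.toLp_sub]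
        congr 1
        change (X k i - X l i) - (V i * (V i)ᵀ) *ᵥ (X k i - X l i) = _
        rw [mulVec_sub]
        abel
      rw [e]
      refine (norm_sub_le _ _).trans ?_
      linarith [(h i).2 k, (h i).2 l]
    calc _ ≤ ∑ _i : Fin d, (2 * (c / √d)) ^ 2 := Finset.sum_le_sum fun i _ => hone i
      _ = d * (2 * (c / √d)) ^ 2 := by simp
      _ ≤ (2 * c) ^ 2 := by
        rcases Nat.eq_zero_or_pos d with rfl | hd
        · simp; positivity
        · have : (0 : ℝ) < d := by exact_mod_cast hd
          rw [mul_pow, div_pow, Real.sq_sqrt this.le]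
          field_simp
          exact le_rfl
  have hV : ∀ i, (V i)ᵀ * V i = 1 := fun i => (h i).1
  have hle := norm_projRows_le hV (X k - X l)
  have hsq := norm_projRows_sq hV (X k - X l)
  have p1 := norm_nonneg (projRows V (X k - X l))
  have p2 := norm_nonneg (flat (X k - X l))
  rw [abs_le]
  refine ⟨?_, by linarith⟩
  by_contra! hlt
  nlinarith

theorem abs_norm_projRows_sub_le {V : Fin d → Matrix (Fin d) (Fin K) ℝ}
    {X : Fin K → Matrix (Fin d) (Fin d) ℝ} {c β : ℝ} (hc : 0 ≤ c)
    (h : ApproxRows V X (c / √d)) (k l : Fin K) {M M' : Matrix (Fin d) (Fin d) ℝ}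
    (hM : frobSq (M - X k) ≤ β ^ 2) (hM' : frobSq (M' - X l) ≤ β ^ 2) (hβ : 0 ≤ β) :
    |‖projRows V (M - M')‖ - √(frobSq (X k - X l))| ≤ 2 * c + 2 * β := by
  have h1 := h.abs_norm_projRows_sub_le hc k l
  have hV : ∀ i, (V i)ᵀ * V i = 1 := fun i => (h i).1
  have n1 : ‖flat (M - X k)‖ ≤ β := (norm_flat _).trans_le (Real.sqrt_le_iff.2 ⟨hβ, hM⟩)
  have n2 : ‖flat (M' - X l)‖ ≤ β := (norm_flat _).trans_le (Real.sqrt_le_iff.2 ⟨hβ, hM'⟩)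
  have h2 : |‖projRows V (M - M')‖ - ‖projRows V (X k - X l)‖| ≤ 2 * β := by
    refine (abs_norm_sub_norm_le _ _).trans ?_
    have e : projRows V (M - M') - projRows V (X k - X l) =
        projRows V (M - X k) - projRows V (M' - X l) := by
      simp only [projRows_sub]
      abel
    rw [e]
    refine (norm_sub_le _ _).trans ?_
    linarith [norm_projRows_le hV (M - X k), norm_projRows_le hV (M' - X l)]
  calc _ = |(‖projRows V (M - M')‖ - ‖projRows V (X k - X l)‖) +
        (‖projRows V (X k - X l)‖ - √(frobSq (X k - X l)))| := by congr 1; ring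
    _ ≤ _ := (abs_add_le _ _).trans (by linarith)

theorem frobSq_lagMean_sub_le {A W : Fin K → Matrix (Fin d) (Fin d) ℝ} {κ ρ Γmax Δ : ℝ}
    (H : ModelAssumptions A W κ ρ Γmax Δ) (k : Fin K) (a : ℕ) {S : Finset ℕ} (hne : S.Nonempty)
    {n : ℕ} (hS : ∀ t ∈ S, n ≤ t) :
    frobSq (lagMean a (A k) (W k) S - A k ^ a * Gam (A k) (W k)) ≤
      (√d * (κ ^ 3 * Γmax * ρ ^ n)) ^ 2 := by
  have hκ := zero_le_one.trans H.one_le_kappa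
  have hρ := H.rho_nonneg
  have hΓ := H.gammaMax_nonneg k
  have hc : (0 : ℝ) < S.card := by exact_mod_cast hne.card_pos
  have e : lagMean a (A k) (W k) S - A k ^ a * Gam (A k) (W k) =
      (S.card : ℝ)⁻¹ • ∑ t ∈ S, (A k ^ a * gamPartial (A k) (W k) t - A k ^ a * Gam (A k) (W k)) := by
    rw [lagMean, Finset.sum_sub_distrib, smul_sub, Finset.sum_const, ← Nat.cast_smul_eq_nsmul ℝ,
      smul_smul, inv_mul_cancel₀ hc.ne', one_smul]
  have hn : ∀ X : Matrix (Fin d) (Fin d) ℝ, frobSq X = ‖flat X‖ ^ 2 := fun X => (norm_flat_sq X).symm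
  rw [e, hn]
  refine pow_le_pow_left₀ (norm_nonneg _) ?_ 2
  have e2 : flat ((S.card : ℝ)⁻¹ • ∑ t ∈ S,
      (A k ^ a * gamPartial (A k) (W k) t - A k ^ a * Gam (A k) (W k))) = (S.card : ℝ)⁻¹ •
      ∑ t ∈ S, flat (A k ^ a * gamPartial (A k) (W k) t - A k ^ a * Gam (A k) (W k)) := by
    ext p
    simp only [flat, Matrix.smul_apply, Matrix.sum_apply, PiLp.smul_apply, WithLp.ofLp_sum,
      Finset.sum_apply]
  rw [e2, norm_smul, norm_inv, Real.norm_natCast]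
  have hone : ∀ t ∈ S, ‖flat (A k ^ a * gamPartial (A k) (W k) t - A k ^ a * Gam (A k) (W k))‖ ≤
      √d * (κ ^ 3 * Γmax * ρ ^ n) := by
    intro t ht
    refine (sq_le_sq₀ (norm_nonneg _) (by positivity)).1 ?_
    rw [← hn, mul_pow, Real.sq_sqrt (Nat.cast_nonneg d)]
    refine (H.frobSq_bias_le k a t).trans ?_
    have hp : ρ ^ t ≤ ρ ^ n := pow_le_pow_of_le_one hρ H.rho_lt_one.le (hS t ht)
    have : κ ^ 3 * Γmax * ρ ^ t ≤ κ ^ 3 * Γmax * ρ ^ n :=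
      mul_le_mul_of_nonneg_left hp (by positivity)
    gcongr
  calc _ ≤ (S.card : ℝ)⁻¹ * ∑ _t ∈ S, √d * (κ ^ 3 * Γmax * ρ ^ n) := by
        gcongr
        exact (norm_sum_le _ _).trans (Finset.sum_le_sum hone)
    _ = _ := by rw [Finset.sum_const, nsmul_eq_mul, inv_mul_cancel_left₀ hc.ne']

section Concentration

variable {Ω : Type*} [MeasurableSpace Ω] {μ : Measure Ω} {R : ℕ}
  {A W : Fin K → Matrix (Fin d) (Fin d) ℝ} {κ ρ Γmax Δ : ℝ}

/-- Difference of the empirical lag-`a` covariances of two systems started at zero. -/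
noncomputable def lagDiff (a : ℕ) (S : Finset ℕ) (A₁ A₂ : Matrix (Fin d) (Fin d) ℝ)
    (e₁ e₂ : ℕ → EuclideanSpace ℝ (Fin d)) : Matrix (Fin d) (Fin d) ℝ :=
  Matrix.of fun i => lagVec a (sysState A₁ e₁) S i - lagVec a (sysState A₂ e₂) S i

theorem variance_sub_le [IsProbabilityMeasure μ] {X Y : Ω → ℝ} (hX : MemLp X 2 μ)
    (hY : MemLp Y 2 μ) :
    Var[fun ω => X ω - Y ω; μ] ≤ 2 * (Var[X; μ] + Var[Y; μ]) := by
  have h1 := variance_fun_sub hX hY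
  have h2 := variance_fun_add hX hY
  have h3 := variance_nonneg (fun ω => X ω + Y ω) μ
  linarith

theorem projRows_lagDiff_moments [IsProbabilityMeasure μ] (H : ModelAssumptions A W κ ρ Γmax Δ)
    {k l : Fin K} {e₁ e₂ : ℕ → Ω → EuclideanSpace ℝ (Fin d)} (h₁ : IsNoise μ (W k) R e₁)
    (h₂ : IsNoise μ (W l) R e₂) {a : ℕ} {S : Finset ℕ} (hS : ∀ t ∈ S, t + a ≤ R)
    {V : Fin d → Matrix (Fin d) (Fin K) ℝ} (hV : ∀ i, (V i)ᵀ * V i = 1) :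
    let u : Ω → Fin d × Fin K → ℝ := fun ω =>
      (projRows V (lagDiff a S (A k) (A l) (fun r => e₁ r ω) fun r => e₂ r ω)).ofLp
    (∀ j, MemLp (fun ω => u ω j) 2 μ) ∧
    (∀ j, ∫ ω, u ω j ∂μ =
      projRows V (lagMean a (A k) (W k) S - lagMean a (A l) (W l) S) j) ∧
    ∀ c : Fin d × Fin K → ℝ, Var[fun ω => ∑ j, c j * u ω j; μ] ≤
      16 * (κ * Γmax) ^ 2 / (S.card * (1 - ρ)) * ∑ j, c j ^ 2 := by
  intro u
  have hu : ∀ ω j, u ω j = ∑ m, V j.1 m j.2 *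
      (lagVec a (sysState (A k) fun r => e₁ r ω) S j.1 m -
        lagVec a (sysState (A l) fun r => e₂ r ω) S j.1 m) := fun ω j => by
    simp [u, projRows, lagDiff, mulVec, dotProduct]
  have m₁ := fun i m => h₁.memLp_lagVec (A k) hS i m
  have m₂ := fun i m => h₂.memLp_lagVec (A l) hS i m
  refine ⟨fun j => ?_, fun j => ?_, fun c => ?_⟩
  · simp only [hu]
    exact memLp_finsetSum _ fun m _ => ((m₁ _ _).sub (m₂ _ _)).const_mul _
  · simp only [hu]
    have hi : ∀ m, Integrable (fun ω => V j.1 m j.2 *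
        (lagVec a (sysState (A k) fun r => e₁ r ω) S j.1 m -
          lagVec a (sysState (A l) fun r => e₂ r ω) S j.1 m)) μ := fun m =>
      (((m₁ _ _).sub (m₂ _ _)).const_mul _).integrable (by norm_num)
    rw [integral_finsetSum _ fun m _ => hi m]
    simp only [projRows, mulVec, dotProduct, transpose_apply]
    refine Finset.sum_congr rfl fun m _ => ?_
    rw [integral_const_mul, integral_sub ((m₁ _ _).integrable (by norm_num))
      ((m₂ _ _).integrable (by norm_num)), h₁.integral_lagVec (A k) (H.posDef k) hS,
      h₂.integral_lagVec (A l) (H.posDef l) hS]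
    rfl
  · set Z : Matrix (Fin d) (Fin d) ℝ := Matrix.of fun i m => ∑ b, V i m b * c (i, b) with hZ
    have hfrob : frobSq Z = ∑ j, c j ^ 2 := by
      rw [frobSq, Fintype.sum_prod_type]
      refine Finset.sum_congr rfl fun i _ => ?_
      have e1 : ∑ m, Z i m ^ 2 = (V i *ᵥ fun b => c (i, b)) ⬝ᵥ (V i *ᵥ fun b => c (i, b)) := by
        simp [hZ, mulVec, dotProduct, sq]
      rw [e1, dotProduct_mulVec, ← mulVec_transpose, mulVec_mulVec, hV, one_mulVec]
      simp [dotProduct, sq]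
    have e : ∀ ω, ∑ j, c j * u ω j =
        (∑ p : Fin d × Fin d, Z p.1 p.2 * lagVec a (sysState (A k) fun r => e₁ r ω) S p.1 p.2) -
        ∑ p : Fin d × Fin d, Z p.1 p.2 * lagVec a (sysState (A l) fun r => e₂ r ω) S p.1 p.2 := by
      intro ω
      rw [← Finset.sum_sub_distrib, Fintype.sum_prod_type, Fintype.sum_prod_type]
      refine Finset.sum_congr rfl fun i _ => ?_
      simp only [hu, hZ, of_apply, Finset.mul_sum, Finset.sum_mul]
      rw [Finset.sum_comm]
      refine Finset.sum_congr rfl fun m _ => ?_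
      rw [← Finset.sum_sub_distrib]
      exact Finset.sum_congr rfl fun b _ => by ring
    simp only [e]
    have v₁ := h₁.variance_lagVec_le H Z hS
    have v₂ := h₂.variance_lagVec_le H Z hS
    refine (variance_sub_le (memLp_finsetSum _ fun p _ => (m₁ _ _).const_mul _)
      (memLp_finsetSum _ fun p _ => (m₂ _ _).const_mul _)).trans ?_
    rw [← hfrob]
    calc _ ≤ 2 * (4 * (κ * Γmax) ^ 2 / (S.card * (1 - ρ)) * frobSq Z +
          4 * (κ * Γmax) ^ 2 / (S.card * (1 - ρ)) * frobSq Z) := by gcongr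
      _ = _ := by ring

end Concentration
end MixedLDS

namespace MixedLDS

variable {d K : ℕ}

theorem measurable_projRows_lagDiff {Ω : Type*} [MeasurableSpace Ω] {R : ℕ}
    {e₁ e₂ : ℕ → Ω → EuclideanSpace ℝ (Fin d)} (h₁ : ∀ r < R, Measurable (e₁ r))
    (h₂ : ∀ r < R, Measurable (e₂ r)) {a : ℕ} {S : Finset ℕ} (hS : ∀ t ∈ S, t + a ≤ R)
    (A₁ A₂ : Matrix (Fin d) (Fin d) ℝ) {V : Ω → Fin d → Matrix (Fin d) (Fin K) ℝ}
    (hV : ∀ i j l, Measurable fun ω => V ω i j l) :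
    Measurable fun ω => (projRows (V ω) (lagDiff a S A₁ A₂ (fun r => e₁ r ω) fun r => e₂ r ω)).ofLp := by
  have hl : ∀ {e : ℕ → Ω → EuclideanSpace ℝ (Fin d)}, (∀ r < R, Measurable (e r)) →
      ∀ (A : Matrix (Fin d) (Fin d) ℝ) i m,
      Measurable fun ω => lagVec a (sysState A fun r => e r ω) S i m := by
    intro e he A i m
    simp only [lagVec_apply]
    refine (Finset.measurable_sum _ fun t ht => ?_).const_mul _
    have c1 : ∀ i, Measurable fun x : EuclideanSpace ℝ (Fin d) => x i := fun i => by fun_prop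
    exact ((c1 i).comp (measurable_sysState A he (hS t ht))).mul
      ((c1 m).comp (measurable_sysState A he (by have := hS t ht; omega)))
  refine measurable_pi_lambda _ fun j => ?_
  simp only [projRows, lagDiff, mulVec, dotProduct, of_apply, Pi.sub_apply]
  exact Finset.measurable_sum _ fun m _ =>
    (hV j.1 m j.2).mul ((hl h₁ A₁ j.1 m).sub (hl h₂ A₂ j.1 m))

theorem measurableSet_lt_abs_dot_sub {Ω J : Type*} [MeasurableSpace Ω] [Fintype J]
    {u v : Ω → J → ℝ} (hu : Measurable u) (hv : Measurable v) (r c : ℝ) :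
    MeasurableSet {ω | r < |∑ j, u ω j * v ω j - c|} :=
  measurableSet_lt measurable_const (by fun_prop)

section NoiseAlgebra

variable {Ω : Type*} {M : ℕ} {T : Fin M → ℕ} {w : Fin M → ℕ → Ω → EuclideanSpace ℝ (Fin d)}

/-- The σ-algebra generated by the noise of trajectories `m, n` at the times `lo < t ≤ hi`. -/
@[reducible]
def noiseAlgebra (T : Fin M → ℕ) (w : Fin M → ℕ → Ω → EuclideanSpace ℝ (Fin d)) (m n : Fin M)
    (lo hi : ℕ) : MeasurableSpace Ω :=
  ⨆ j ∈ {j : (m : Fin M) × Fin (T m + 1) | (j.1 = m ∨ j.1 = n) ∧ lo < (j.2 : ℕ) ∧ (j.2 : ℕ) ≤ hi},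
    MeasurableSpace.comap (w j.1 j.2) inferInstance

theorem measurable_noiseAlgebra {m n m' : Fin M} (hm : m' = m ∨ m' = n) {lo hi t : ℕ}
    (h1 : lo < t) (h2 : t ≤ hi) (h3 : t ≤ T m') :
    Measurable[noiseAlgebra T w m n lo hi] (w m' t) := by
  have hle : MeasurableSpace.comap (w m' t) inferInstance ≤ noiseAlgebra T w m n lo hi := by
    refine le_trans (le_of_eq ?_) (le_biSup (fun j : (m : Fin M) × Fin (T m + 1) =>
      MeasurableSpace.comap (w j.1 j.2) inferInstance)
      (show (⟨m', ⟨t, by omega⟩⟩ : (m : Fin M) × Fin (T m + 1)) ∈ _ from ⟨hm, h1, h2⟩))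
    rfl
  exact (comap_measurable (w m' t)).mono hle le_rfl

/-- Projected difference of the lag-`a` covariances of trajectories `m, m'` over the second half
of the block of length `2 N` after time `s`, both restarted from zero. -/
noncomputable def blockVec (A : Fin K → Matrix (Fin d) (Fin d) ℝ) (lab : Fin M → Fin K)
    (w : Fin M → ℕ → Ω → EuclideanSpace ℝ (Fin d)) (V : Fin d → Matrix (Fin d) (Fin K) ℝ)
    (a N : ℕ) (m n : Fin M) (s : ℕ) (ω : Ω) : Fin d × Fin K → ℝ :=
  (projRows V (lagDiff a (Finset.Ico N (2 * N)) (A (lab m)) (A (lab n))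
    (fun r => w m (s + 1 + r) ω) fun r => w n (s + 1 + r) ω)).ofLp

theorem measurable_blockVec {A : Fin K → Matrix (Fin d) (Fin d) ℝ} {lab : Fin M → Fin K}
    {V : Fin d → Matrix (Fin d) (Fin K) ℝ} {a N s lo hi : ℕ} {m n : Fin M}
    (ha : a ≤ 1) (hm : s + 2 * N ≤ T m) (hn : s + 2 * N ≤ T n) (hlo : lo ≤ s)
    (hhi : s + 2 * N ≤ hi) :
    Measurable[noiseAlgebra T w m n lo hi] (blockVec A lab w V a N m n s) := by
  refine @measurable_projRows_lagDiff d K Ω (noiseAlgebra T w m n lo hi) (2 * N)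
    (fun r => w m (s + 1 + r)) (fun r => w n (s + 1 + r)) (fun r hr => ?_) (fun r hr => ?_) a _
    (fun t ht => ?_) _ _ (fun _ => V) fun _ _ _ => measurable_const
  · exact measurable_noiseAlgebra (Or.inl rfl) (by omega) (by omega) (by omega)
  · exact measurable_noiseAlgebra (Or.inr rfl) (by omega) (by omega) (by omega)
  · have := Finset.mem_Ico.1 ht
    omega

end NoiseAlgebra

section Blocks

variable {Ω : Type*} [mΩ : MeasurableSpace Ω] {μ : Measure Ω} {M : ℕ}
  {A W : Fin K → Matrix (Fin d) (Fin d) ℝ} {κ ρ Γmax Δ : ℝ} {lab : Fin M → Fin K} {T : Fin M → ℕ}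
  {w x : Fin M → ℕ → Ω → EuclideanSpace ℝ (Fin d)}

theorem IsMixedLDS.isNoise (h : IsMixedLDS μ A W lab T w x) {m : Fin M} {s R : ℕ}
    (hs : s + R ≤ T m + 1) : IsNoise μ (W (lab m)) R fun r => w m (s + r) where
  law r hr := h.law_noise m _ (by omega)
  indep := h.indep_noise.precomp
    (g := fun r : Fin R => (⟨m, ⟨s + r, by omega⟩⟩ : (m : Fin M) × Fin (T m + 1))) (by
      intro r r' hrr
      simp only [Sigma.mk.injEq, heq_eq_eq, Fin.mk.injEq, true_and] at hrr
      exact Fin.ext (by omega))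

theorem IsMixedLDS.iIndep_noiseAlgebra [IsProbabilityMeasure μ] (h : IsMixedLDS μ A W lab T w x)
    (m n : Fin M) {ι : Type*} {lo hi : ι → ℕ} (hd : ∀ p q, p ≠ q → hi p ≤ lo q ∨ hi q ≤ lo p) :
    iIndep (fun p => noiseAlgebra T w m n (lo p) (hi p)) μ := by
  refine iIndep_iSup_of_disjoint (fun j => ?_) h.indep_noise.iIndep fun p q hpq => ?_
  · exact (h.measurable_noise j.1 j.2 (by omega)).comap_le
  · rw [Set.disjoint_left]
    rintro j ⟨-, h1, h2⟩ ⟨-, h3, h4⟩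
    rcases hd p q hpq with h5 | h5 <;> omega

theorem chebyshev_numeric {s q D Δ k : ℝ} (hs0 : 0 ≤ s) (hk : 1 ≤ k)
    (hΔ : 0 < Δ) (hD : 0 ≤ D) (hs : s * √k ≤ Δ ^ 2 / 2000000) (hq0 : 0 ≤ q)
    (hq : |q - D| ≤ Δ / 100) :
    3 * (2 * s * q ^ 2 + s ^ 2 * k) / ((Δ ^ 2 + Δ * D) / 40) ^ 2 ≤ 1 / 64 := by
  have h1 : 1 ≤ √k := Real.one_le_sqrt.2 hk
  have h2 : s ≤ Δ ^ 2 / 2000000 := (le_mul_of_one_le_right hs0 h1).trans hs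
  have h3 : s ^ 2 * k ≤ (Δ ^ 2 / 2000000) ^ 2 := by
    have : s ^ 2 * k = (s * √k) ^ 2 := by rw [mul_pow, Real.sq_sqrt (by linarith)]
    rw [this]
    exact pow_le_pow_left₀ (by positivity) hs 2
  have h4 : q ^ 2 ≤ 2 * D ^ 2 + Δ ^ 2 := by
    have := (abs_le.1 hq).2
    have : q ^ 2 ≤ (D + Δ / 100) ^ 2 := pow_le_pow_left₀ hq0 (by linarith) 2
    nlinarith [sq_nonneg (D - Δ / 100)]
  have h5 : s * q ^ 2 ≤ Δ ^ 2 / 2000000 * (2 * D ^ 2 + Δ ^ 2) := by gcongr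
  rw [div_le_iff₀ (by positivity)]
  have h6 : 0 ≤ Δ ^ 3 * D := by positivity
  have h7 : 0 ≤ Δ ^ 2 * D ^ 2 := by positivity
  have h8 : 0 ≤ Δ ^ 4 := by positivity
  nlinarith

theorem IsMixedLDS.measureReal_majority_le [IsProbabilityMeasure μ]
    (H : ModelAssumptions A W κ ρ Γmax Δ) (h : IsMixedLDS μ A W lab T w x) {m n : Fin M}
    {a N G : ℕ} (ha : a ≤ 1) (hN : 0 < N) (hd : 0 < d) (hm : 4 * (G * N) ≤ T m)
    (hn : 4 * (G * N) ≤ T n) {V : Fin d → Matrix (Fin d) (Fin K) ℝ}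
    (hV : ApproxRows V (fun k => A k ^ a * Gam (A k) (W k)) (1 / 400 * Δ / √d))
    (hβ : √d * (κ ^ 3 * Γmax * ρ ^ N) ≤ Δ / 400)
    (hσ : 16 * (κ * Γmax) ^ 2 / (N * (1 - ρ)) * √((d : ℝ) * K) ≤ Δ ^ 2 / 2000000) {D : ℝ}
    (hD : D = √(frobSq (A (lab m) ^ a * Gam (A (lab m)) (W (lab m)) -
      A (lab n) ^ a * Gam (A (lab n)) (W (lab n))))) :
    μ.real {ω | ∃ S : Finset (Fin G), G ≤ 2 * S.card ∧ ∀ g ∈ S, (Δ ^ 2 + Δ * D) / 20 <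
      |∑ j, blockVec A lab w V a N m n (4 * (g * N)) ω j *
        blockVec A lab w V a N m n (4 * (g * N) + 2 * N) ω j - D ^ 2|} ≤ (1 / 4) ^ G := by
  have hlt : ∀ g : Fin G, g * N + N ≤ G * N := fun g => by
    rw [← Nat.succ_mul]
    exact Nat.mul_le_mul_right N g.2
  have hΔ := H.sep_pos
  have hD0 : 0 ≤ D := hD ▸ Real.sqrt_nonneg _
  have hκ := zero_le_one.trans H.one_le_kappa
  have hρ := H.rho_nonneg
  have hΓ := H.gammaMax_nonneg (lab m)
  have hρ1 : 0 < 1 - ρ := by linarith [H.rho_lt_one]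
  have hind := h.iIndep_noiseAlgebra m n (ι := Fin G) (lo := fun g => 4 * (g * N))
    (hi := fun g => 4 * (g * N) + 4 * N) (by
      intro p q hpq
      rcases lt_or_gt_of_ne hpq with hlt | hlt
      · left
        have := Nat.mul_le_mul_right N (Nat.succ_le_of_lt (Fin.lt_def.1 hlt))
        rw [Nat.succ_mul] at this
        omega
      · right
        have := Nat.mul_le_mul_right N (Nat.succ_le_of_lt (Fin.lt_def.1 hlt))
        rw [Nat.succ_mul] at this
        omega)
  refine MixedLDS.measureReal_majority_le hind (B := fun g => {ω | (Δ ^ 2 + Δ * D) / 20 <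
      |∑ j, blockVec A lab w V a N m n (4 * (g * N)) ω j *
        blockVec A lab w V a N m n (4 * (g * N) + 2 * N) ω j - D ^ 2|}) (fun g => ?_) fun g => ?_
  · have := hlt g
    exact @measurableSet_lt_abs_dot_sub Ω _ (noiseAlgebra T w m n _ _) _ _ _
      (measurable_blockVec ha (by omega) (by omega) le_rfl (by omega))
      (measurable_blockVec ha (by omega) (by omega) (by omega) (by omega)) _ _
  · have hg := hlt g
    set b := (g : ℕ) * N with hb
    set u := blockVec A lab w V a N m n (4 * b) with hu
    set v := blockVec A lab w V a N m n (4 * b + 2 * N) with hv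
    have hS : ∀ t ∈ Finset.Ico N (2 * N), t + a ≤ 2 * N := fun t ht => by
      have := Finset.mem_Ico.1 ht
      omega
    have hcard : (Finset.Ico N (2 * N)).card = N := by simp; omega
    have hVo : ∀ i, (V i)ᵀ * V i = 1 := fun i => (hV i).1
    obtain ⟨u1, u2, u3⟩ := projRows_lagDiff_moments H
      (h.isNoise (m := m) (s := 4 * b + 1) (R := 2 * N) (by omega))
      (h.isNoise (m := n) (s := 4 * b + 1) (R := 2 * N) (by omega)) hS hVo
    obtain ⟨v1, v2, v3⟩ := projRows_lagDiff_moments H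
      (h.isNoise (m := m) (s := 4 * b + 2 * N + 1) (R := 2 * N) (by omega))
      (h.isNoise (m := n) (s := 4 * b + 2 * N + 1) (R := 2 * N) (by omega)) hS hVo
    rw [hcard] at u3 v3
    have huv : IndepFun u v μ := by
      have hi := h.iIndep_noiseAlgebra m n (ι := Bool)
        (lo := fun p => if p then 4 * b else 4 * b + 2 * N)
        (hi := fun p => if p then 4 * b + 2 * N else 4 * b + 4 * N) (by
          intro p q hpq
          cases p <;> cases q <;> simp at hpq ⊢)
      have hi' := hi.indep (i := true) (j := false) (by simp)
      simp only [if_true, Bool.false_eq_true, if_false] at hi'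
      rw [IndepFun_iff_Indep]
      refine indep_of_indep_of_le_left (indep_of_indep_of_le_right hi' ?_) ?_
      · exact (measurable_blockVec ha (by omega) (by omega) le_rfl (by omega)).comap_le
      · exact (measurable_blockVec ha (by omega) (by omega) le_rfl le_rfl).comap_le
    set σ := 16 * (κ * Γmax) ^ 2 / (N * (1 - ρ)) with hσd
    have hσ0 : 0 ≤ σ := by positivity
    set q := projRows V (lagMean a (A (lab m)) (W (lab m)) (Finset.Ico N (2 * N)) -
      lagMean a (A (lab n)) (W (lab n)) (Finset.Ico N (2 * N))) with hq
    have hqn : ∑ j, q j ^ 2 = ‖q‖ ^ 2 := (EuclideanSpace.real_norm_sq_eq q).symm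
    have hne : (Finset.Ico N (2 * N)).Nonempty := Finset.card_pos.1 (by omega)
    have hbias : ∀ k, frobSq (lagMean a (A k) (W k) (Finset.Ico N (2 * N)) -
        A k ^ a * Gam (A k) (W k)) ≤ (Δ / 400) ^ 2 := fun k =>
      (frobSq_lagMean_sub_le H k a hne fun t ht => (Finset.mem_Ico.1 ht).1).trans
        (pow_le_pow_left₀ (by positivity) hβ 2)
    have hqD : |‖q‖ - D| ≤ Δ / 100 := by
      rw [hD]
      refine (abs_norm_projRows_sub_le (c := 1 / 400 * Δ) (by positivity) hV (lab m) (lab n)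
        (hbias _) (hbias _) (by positivity)).trans (le_of_eq ?_)
      ring
    have hr : 0 < (Δ ^ 2 + Δ * D) / 40 := by positivity
    have hcheb := measureReal_abs_dot_sub_le u1 v1 huv u2 v2 hσ0 u3 v3 hr
    have hQ0 := norm_nonneg q
    rw [hqn] at hcheb
    have hK : 0 < K := (Nat.zero_le _).trans_lt (lab m).2
    have hdK : (1 : ℝ) ≤ (d : ℝ) * K := by
      have : 1 ≤ d * K := Nat.mul_pos hd hK
      exact_mod_cast this
    have hnum := chebyshev_numeric hσ0 hdK hΔ hD0 hσ hQ0 hqD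
    refine (measureReal_mono ?_).trans (hcheb.trans (le_trans (le_of_eq ?_) hnum))
    · intro ω hω
      have hω' : (Δ ^ 2 + Δ * D) / 20 < |∑ j, u ω j * v ω j - D ^ 2| := hω
      change (Δ ^ 2 + Δ * D) / 40 < |∑ j, u ω j * v ω j - ‖q‖ ^ 2|
      have hdiff : |‖q‖ ^ 2 - D ^ 2| ≤ (Δ ^ 2 + Δ * D) / 40 := by
        rw [abs_le] at hqD ⊢
        constructor <;> nlinarith
      have := abs_sub_le (∑ j, u ω j * v ω j) (‖q‖ ^ 2) (D ^ 2)
      linarith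
    · simp

end Blocks
end MixedLDS

namespace MixedLDS

variable {d K : ℕ}

/-- Principle of induction over trajectories for properties of initial states. -/
theorem start_induction {Ω : Type*} {M : ℕ} {T : Fin M → ℕ}
    {x : Fin M → ℕ → Ω → EuclideanSpace ℝ (Fin d)}
    {P : Fin M → (Ω → EuclideanSpace ℝ (Fin d)) → Prop}
    (hx : ZeroStart x ∨ ConsecutiveSegments T x) (hP0 : ∀ m, P m fun _ => 0)
    (hstep : ConsecutiveSegments T x → ∀ m m', m'.val = m.val + 1 → P m (x m 0) →
      P m' (x m (T m))) (m : Fin M) : P m (x m 0) := by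
  rcases hx with hx | hx
  · rw [show x m 0 = fun _ => 0 from funext fun ω => hx m ω]
    exact hP0 m
  · obtain ⟨i, hi⟩ := m
    induction i with
    | zero =>
      rw [show x ⟨0, hi⟩ 0 = fun _ => 0 from funext fun ω => hx.1 _ rfl ω]
      exact hP0 _
    | succ i ih =>
      have hi' : i < M := by omega
      rw [show x ⟨i + 1, hi⟩ 0 = x ⟨i, hi'⟩ (T ⟨i, hi'⟩) from
        funext fun ω => hx.2 ⟨i, hi'⟩ _ rfl ω]
      exact hstep hx _ _ rfl (ih hi')

section Moments

variable {Ω : Type*} [mΩ : MeasurableSpace Ω] {μ : Measure Ω} {M : ℕ}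
  {A W : Fin K → Matrix (Fin d) (Fin d) ℝ} {κ ρ Γmax Δ : ℝ} {lab : Fin M → Fin K} {T : Fin M → ℕ}
  {w x : Fin M → ℕ → Ω → EuclideanSpace ℝ (Fin d)}

theorem IsMixedLDS.measurable_of_start (h : IsMixedLDS μ A W lab T w x) {m : Fin M}
    (h0 : Measurable (x m 0)) {t : ℕ} (ht : t ≤ T m + 1) : Measurable (x m t) := by
  induction t with
  | zero => exact h0
  | succ t ih =>
    have e : x m (t + 1) = fun ω => toEuclideanCLM (𝕜 := ℝ) (A (lab m)) (x m t ω) + w m t ω :=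
      funext fun ω => h.step m t (by omega) ω
    rw [e]
    exact ((toEuclideanCLM (𝕜 := ℝ) (A (lab m))).continuous.measurable.comp (ih (by omega))).add
      (h.measurable_noise m t (by omega))

theorem IsMixedLDS.measurable (h : IsMixedLDS μ A W lab T w x)
    (hx : ZeroStart x ∨ ConsecutiveSegments T x) (m : Fin M) {t : ℕ} (ht : t ≤ T m + 1) :
    Measurable (x m t) :=
  h.measurable_of_start (start_induction (P := fun _ f => Measurable f) hx
    (fun _ => measurable_const) (fun _ m _ _ hm => h.measurable_of_start hm (by omega)) m) ht

/-- The trajectory decomposes into the evolved state at time `s` and the state restarted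
from zero at time `s`. -/
theorem IsMixedLDS.eq_add_sysState (h : IsMixedLDS μ A W lab T w x) (m : Fin M) {s j : ℕ}
    (hj : s + j ≤ T m + 1) (ω : Ω) :
    x m (s + j) ω = WithLp.toLp 2 (A (lab m) ^ j *ᵥ (x m s ω).ofLp) +
      sysState (A (lab m)) (fun r => w m (s + r) ω) j := by
  induction j with
  | zero => simp [sysState]
  | succ j ih =>
    rw [← add_assoc, h.step m (s + j) (by omega) ω, ih (by omega), sysState, ← add_assoc]
    congr 1
    rw [WithLp.ofLp_add, mulVec_add, WithLp.toLp_add, mulVec_mulVec, pow_succ']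

theorem IsNoise.integral_norm_sysState_sq_le {R : ℕ} {e : ℕ → Ω → EuclideanSpace ℝ (Fin d)}
    (H : ModelAssumptions A W κ ρ Γmax Δ) {k : Fin K} (h : IsNoise μ (W k) R e) {j : ℕ}
    (hj : j ≤ R) : Integrable (fun ω => ‖sysState (A k) (fun r => e r ω) j‖ ^ 2) μ ∧
      ∫ ω, ‖sysState (A k) (fun r => e r ω) j‖ ^ 2 ∂μ ≤ d * Γmax := by
  simp only [EuclideanSpace.real_norm_sq_eq]
  simp only [sq]
  have hi : ∀ i, Integrable (fun ω => sysState (A k) (fun r => e r ω) j i *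
      sysState (A k) (fun r => e r ω) j i) μ := fun i => h.integrable_sysState_mul hj hj i i
  refine ⟨integrable_finsetSum _ fun i _ => hi i, ?_⟩
  rw [integral_finsetSum _ fun i _ => hi i]
  have hone : ∀ i, ∫ ω, sysState (A k) (fun r => e r ω) j i *
      sysState (A k) (fun r => e r ω) j i ∂μ ≤ Γmax := by
    intro i
    have := h.integral_sysState_mul (A := A k) (H.posDef k) (a := 0) (j := j) (by omega) i i
    rw [zero_add, pow_zero, one_mul] at this
    rw [this]
    have e1 : gamPartial (A k) (W k) j i i =
        (WithLp.toLp 2 (gamPartial (A k) (W k) j *ᵥ Pi.single i 1) : EuclideanSpace ℝ (Fin d)) i := by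
      simp
    rw [e1]
    refine (le_abs_self _).trans ((PiLp.norm_apply_le (p := 2) (WithLp.toLp 2
      (gamPartial (A k) (W k) j *ᵥ Pi.single i 1) : EuclideanSpace ℝ (Fin d)) i).trans ?_)
    refine (norm_mulVec_le _ _).trans ?_
    simpa using H.specNorm_gamPartial_le k j
  calc _ ≤ ∑ _i : Fin d, Γmax := Finset.sum_le_sum fun i _ => hone i
    _ = _ := by simp

theorem IsMixedLDS.moment_of_start (H : ModelAssumptions A W κ ρ Γmax Δ)
    (h : IsMixedLDS μ A W lab T w x) {m : Fin M} {B : ℝ} (h0 : Measurable (x m 0))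
    (hi : Integrable (fun ω => ‖x m 0 ω‖ ^ 2) μ) (hB : ∫ ω, ‖x m 0 ω‖ ^ 2 ∂μ ≤ B) {t : ℕ}
    (ht : t ≤ T m + 1) : Integrable (fun ω => ‖x m t ω‖ ^ 2) μ ∧
      ∫ ω, ‖x m t ω‖ ^ 2 ∂μ ≤ 3 / 2 * (κ * ρ ^ t) ^ 2 * B + 3 * (d * Γmax) := by
  obtain ⟨iy, hy⟩ := (h.isNoise (m := m) (s := 0) (R := T m + 1)
    (by omega)).integral_norm_sysState_sq_le H ht
  set y : Ω → EuclideanSpace ℝ (Fin d) :=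
    fun ω => sysState (A (lab m)) (fun r => w m (0 + r) ω) t with hyd
  have hle : ∀ ω, ‖x m t ω‖ ^ 2 ≤ 3 / 2 * (κ * ρ ^ t) ^ 2 * ‖x m 0 ω‖ ^ 2 + 3 * ‖y ω‖ ^ 2 := by
    intro ω
    have e := h.eq_add_sysState m (s := 0) (j := t) (by omega) ω
    rw [zero_add] at e
    have h1 : ‖WithLp.toLp 2 (A (lab m) ^ t *ᵥ (x m 0 ω).ofLp)‖ ≤ κ * ρ ^ t * ‖x m 0 ω‖ :=
      (norm_mulVec_le _ _).trans (mul_le_mul_of_nonneg_right (H.specNorm_pow_le _ _)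
        (norm_nonneg _))
    have h2 : ‖x m t ω‖ ≤ κ * ρ ^ t * ‖x m 0 ω‖ + ‖y ω‖ := by
      rw [e]
      exact (norm_add_le _ _).trans (by gcongr)
    have h3 := pow_le_pow_left₀ (norm_nonneg _) h2 2
    nlinarith [sq_nonneg (κ * ρ ^ t * ‖x m 0 ω‖ - 2 * ‖y ω‖)]
  have ig : Integrable (fun ω => 3 / 2 * (κ * ρ ^ t) ^ 2 * ‖x m 0 ω‖ ^ 2 + 3 * ‖y ω‖ ^ 2) μ :=
    (hi.const_mul _).add (iy.const_mul _)
  have hint : Integrable (fun ω => ‖x m t ω‖ ^ 2) μ := by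
    refine ig.mono' ?_ (ae_of_all _ fun ω => ?_)
    · exact ((h.measurable_of_start h0 ht).norm.pow_const 2).aestronglyMeasurable
    · rw [Real.norm_of_nonneg (sq_nonneg _)]
      exact hle ω
  refine ⟨hint, (integral_mono hint ig hle).trans ?_⟩
  rw [integral_add (hi.const_mul _) (iy.const_mul _), integral_const_mul, integral_const_mul]
  gcongr

theorem pow_le_of_log_le {ρ : ℝ} (h0 : 0 ≤ ρ) (h1 : ρ < 1) {n : ℕ} {y : ℝ}
    (hy : 0 < y) (hn : 1 / (1 - ρ) * Real.log y ≤ n) : ρ ^ n ≤ 1 / y := by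
  have h3 : ρ ≤ Real.exp (-(1 - ρ)) := by
    have := Real.add_one_le_exp (-(1 - ρ))
    linarith
  have h4 : Real.log y ≤ n * (1 - ρ) := by
    have : 0 < 1 - ρ := by linarith
    rwa [one_div, inv_mul_le_iff₀ this, mul_comm] at hn
  calc ρ ^ n ≤ Real.exp (-(1 - ρ)) ^ n := pow_le_pow_left₀ h0 h3 n
    _ = Real.exp (-(n * (1 - ρ))) := by rw [← Real.exp_nat_mul]; ring_nf
    _ ≤ Real.exp (-Real.log y) := by gcongr
    _ = 1 / y := by rw [Real.exp_neg, Real.exp_log hy, one_div]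

theorem IsMixedLDS.moment_le (H : ModelAssumptions A W κ ρ Γmax Δ)
    (h : IsMixedLDS μ A W lab T w x) (hx : ZeroStart x ∨ (ConsecutiveSegments T x ∧
      ∀ m, 1 / (1 - ρ) * Real.log (√2 * κ) ≤ T m)) (m : Fin M) {t : ℕ} (ht : t ≤ T m + 1) :
    Integrable (fun ω => ‖x m t ω‖ ^ 2) μ ∧
      ∫ ω, ‖x m t ω‖ ^ 2 ∂μ ≤ 21 * (κ ^ 2 * (d * Γmax)) := by
  have hκ := H.one_le_kappa
  have hρ := H.rho_nonneg
  have hB : ∀ m : Fin M, 0 ≤ d * Γmax := fun m =>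
    mul_nonneg (Nat.cast_nonneg _) (H.gammaMax_nonneg (lab m))
  have hx' : ZeroStart x ∨ ConsecutiveSegments T x := hx.imp id And.left
  have hstart := start_induction (P := fun _ f => Integrable (fun ω => ‖f ω‖ ^ 2) μ ∧
    ∫ ω, ‖f ω‖ ^ 2 ∂μ ≤ 12 * (d * Γmax)) hx' (fun m => by simpa using hB m)
    (fun _ m m' _ hm => by
      by_cases hz : ZeroStart x
      · obtain ⟨i1, i2⟩ := h.moment_of_start H (B := 0) (h.measurable hx' m (by omega)) hm.1
          (by simp [hz m]) (t := T m) (by omega)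
        exact ⟨i1, i2.trans (by linarith [hB m])⟩
      have hx2 := (hx.resolve_left hz).2 m
      obtain ⟨i1, i2⟩ := h.moment_of_start H (h.measurable hx' m (by omega)) hm.1 hm.2 (t := T m)
        (by omega)
      refine ⟨i1, i2.trans ?_⟩
      have hp : 0 < √2 * κ := by positivity
      have h1 := pow_le_of_log_le hρ H.rho_lt_one hp hx2
      have h2 : (κ * ρ ^ T m) ^ 2 ≤ 1 / 2 := by
        calc (κ * ρ ^ T m) ^ 2 ≤ (κ * (1 / (√2 * κ))) ^ 2 := by gcongr
          _ = 1 / 2 := by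
            field_simp
            rw [Real.sq_sqrt (by norm_num)]
      nlinarith [hB m]) m
  obtain ⟨i1, i2⟩ := h.moment_of_start H (h.measurable hx' m (by omega)) hstart.1 hstart.2 ht
  refine ⟨i1, i2.trans ?_⟩
  have h2 : (κ * ρ ^ t) ^ 2 ≤ κ ^ 2 := by
    refine pow_le_pow_left₀ (by positivity) ?_ 2
    exact mul_le_of_le_one_right (by linarith) (pow_le_one₀ hρ H.rho_lt_one.le)
  have h3 : 1 ≤ κ ^ 2 := one_le_pow₀ hκ
  nlinarith [hB m]

theorem IsMixedLDS.measureReal_exists_norm_gt_le [IsProbabilityMeasure μ]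
    (H : ModelAssumptions A W κ ρ Γmax Δ)
    (h : IsMixedLDS μ A W lab T w x) (hx : ZeroStart x ∨ (ConsecutiveSegments T x ∧
      ∀ m, 1 / (1 - ρ) * Real.log (√2 * κ) ≤ T m)) (Mc : Finset (Fin M)) {Tc : ℕ}
    (hT : ∀ m ∈ Mc, T m = Tc) {R : ℝ} (hR : 0 < R) :
    μ.real {ω | ∃ m ∈ Mc, ∃ t ∈ Finset.range (Tc + 2), R < ‖x m t ω‖} ≤
      Mc.card * (Tc + 2) * (21 * (κ ^ 2 * (d * Γmax)) / R ^ 2) := by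
  have hset : {ω | ∃ m ∈ Mc, ∃ t ∈ Finset.range (Tc + 2), R < ‖x m t ω‖} =
      ⋃ p ∈ Mc ×ˢ Finset.range (Tc + 2), {ω | R < ‖x p.1 p.2 ω‖} := by
    ext ω
    simp [and_assoc]
  have hone : ∀ p ∈ Mc ×ˢ Finset.range (Tc + 2), μ.real {ω | R < ‖x p.1 p.2 ω‖} ≤
      21 * (κ ^ 2 * (d * Γmax)) / R ^ 2 := by
    intro p hp
    obtain ⟨h1, h2⟩ := Finset.mem_product.1 hp
    have h3 := Finset.mem_range.1 h2
    obtain ⟨i1, i2⟩ := h.moment_le H hx p.1 (t := p.2) (by rw [hT _ h1]; omega)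
    have hM := mul_meas_ge_le_integral_of_nonneg (ae_of_all μ fun ω => sq_nonneg ‖x p.1 p.2 ω‖)
      i1 (R ^ 2)
    rw [le_div_iff₀ (by positivity), mul_comm]
    refine le_trans (mul_le_mul_of_nonneg_left (measureReal_mono fun ω hω => ?_)
      (sq_nonneg R)) (hM.trans i2)
    have hω' : R < ‖x p.1 p.2 ω‖ := hω
    exact pow_le_pow_left₀ hR.le hω'.le 2
  rw [hset]
  calc _ ≤ ∑ p ∈ Mc ×ˢ Finset.range (Tc + 2), μ.real {ω | R < ‖x p.1 p.2 ω‖} :=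
        measureReal_biUnion_finset_le _ _
    _ ≤ ∑ _p ∈ Mc ×ˢ Finset.range (Tc + 2), 21 * (κ ^ 2 * (d * Γmax)) / R ^ 2 :=
        Finset.sum_le_sum hone
    _ = _ := by
        rw [Finset.sum_const, Finset.card_product, Finset.card_range, nsmul_eq_mul]
        push_cast
        ring

end Moments
end MixedLDS

namespace MixedLDS

variable {d K : ℕ}

section Perturbation

/-- The outer product `u vᵀ` as a Euclidean vector. -/
noncomputable def outer (u v : EuclideanSpace ℝ (Fin d)) : EuclideanSpace ℝ (Fin d × Fin d) :=
  WithLp.toLp 2 fun p => u p.1 * v p.2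

theorem norm_outer (u v : EuclideanSpace ℝ (Fin d)) : ‖outer u v‖ = ‖u‖ * ‖v‖ := by
  refine (sq_eq_sq₀ (norm_nonneg _) (by positivity)).1 ?_
  rw [mul_pow, EuclideanSpace.real_norm_sq_eq, EuclideanSpace.real_norm_sq_eq,
    EuclideanSpace.real_norm_sq_eq, Fintype.sum_prod_type, Finset.sum_mul_sum]
  simp [outer, mul_pow]

theorem outer_sub_outer (u v u' v' : EuclideanSpace ℝ (Fin d)) :
    outer u v - outer u' v' = outer (u - u') v + outer u' (v - v') := by
  ext p
  simp [outer]
  ring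

theorem norm_inv_card_smul_sum_le {E ι : Type*} [NormedAddCommGroup E] [NormedSpace ℝ E]
    (S : Finset ι) (f : ι → E) {B : ℝ} (hB : 0 ≤ B) (h : ∀ t ∈ S, ‖f t‖ ≤ B) :
    ‖(S.card : ℝ)⁻¹ • ∑ t ∈ S, f t‖ ≤ B := by
  rcases Finset.eq_empty_or_nonempty S with rfl | hne
  · simpa using hB
  have hc : (0 : ℝ) < S.card := by exact_mod_cast hne.card_pos
  rw [norm_smul, norm_inv, Real.norm_natCast]
  calc _ ≤ (S.card : ℝ)⁻¹ * ∑ _t ∈ S, B := by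
        gcongr
        exact (norm_sum_le _ _).trans (Finset.sum_le_sum h)
    _ = B := by rw [Finset.sum_const, nsmul_eq_mul, inv_mul_cancel_left₀ hc.ne']

/-- The empirical lag-`a` covariance as a matrix. -/
noncomputable def lagMat (a : ℕ) (x : ℕ → EuclideanSpace ℝ (Fin d)) (S : Finset ℕ) :
    Matrix (Fin d) (Fin d) ℝ :=
  Matrix.of fun i => lagVec a x S i

theorem flat_lagMat (a : ℕ) (x : ℕ → EuclideanSpace ℝ (Fin d)) (S : Finset ℕ) :
    flat (lagMat a x S) = (S.card : ℝ)⁻¹ • ∑ t ∈ S, outer (x (t + a)) (x t) := by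
  ext p
  simp [flat, lagMat, lagVec_apply, outer]

theorem norm_flat_lagMat_le {a : ℕ} {x : ℕ → EuclideanSpace ℝ (Fin d)} {S : Finset ℕ} {R : ℝ}
    (hR : 0 ≤ R) (h : ∀ t ∈ S, ‖x (t + a)‖ ≤ R ∧ ‖x t‖ ≤ R) : ‖flat (lagMat a x S)‖ ≤ R ^ 2 := by
  rw [flat_lagMat]
  refine norm_inv_card_smul_sum_le S _ (by positivity) fun t ht => ?_
  rw [norm_outer, sq]
  exact mul_le_mul (h t ht).1 (h t ht).2 (norm_nonneg _) hR

theorem norm_flat_lagMat_sub_le {a : ℕ} {x x' : ℕ → EuclideanSpace ℝ (Fin d)} {S : Finset ℕ}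
    {R R' E : ℝ} (hE : 0 ≤ E) (hR : 0 ≤ R) (hR' : 0 ≤ R') (h : ∀ t ∈ S, ‖x t‖ ≤ R)
    (h' : ∀ t ∈ S, ‖x' (t + a)‖ ≤ R')
    (hsub : ∀ t ∈ S, ‖x (t + a) - x' (t + a)‖ ≤ E ∧ ‖x t - x' t‖ ≤ E) :
    ‖flat (lagMat a x S) - flat (lagMat a x' S)‖ ≤ E * (R + R') := by
  rw [flat_lagMat, flat_lagMat, ← smul_sub, ← Finset.sum_sub_distrib]
  refine norm_inv_card_smul_sum_le S _ (by positivity) fun t ht => ?_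
  rw [outer_sub_outer]
  refine (norm_add_le _ _).trans ?_
  rw [norm_outer, norm_outer]
  calc _ ≤ E * R + R' * E := add_le_add
        (mul_le_mul (hsub t ht).1 (h t ht) (norm_nonneg _) hE)
        (mul_le_mul (h' t ht) (hsub t ht).2 (norm_nonneg _) hR')
    _ = _ := by ring

theorem lagMat_map_add (a s : ℕ) (x : ℕ → EuclideanSpace ℝ (Fin d)) (S : Finset ℕ) :
    lagMat a x (S.map (addLeftEmbedding s)) = lagMat a (fun j => x (s + j)) S := by
  ext i l
  simp [lagMat, lagVec_apply, add_assoc]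

theorem window₁_eq_map (N g : ℕ) :
    window₁ N g = (Finset.Ico N (2 * N)).map (addLeftEmbedding (4 * (g * N) + 1)) := by
  rw [Finset.map_add_left_Ico, window₁]
  ext t
  rw [show (4 * g + 1) * N = 4 * (g * N) + N by ring]
  simp only [Finset.mem_Icc, Finset.mem_Ico]
  omega

theorem window₂_eq_map (N g : ℕ) :
    window₂ N g = (Finset.Ico N (2 * N)).map (addLeftEmbedding (4 * (g * N) + 2 * N + 1)) := by
  rw [Finset.map_add_left_Ico, window₂]
  ext t
  rw [show (4 * g + 3) * N = 4 * (g * N) + 2 * N + N by ring]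
  simp only [Finset.mem_Icc, Finset.mem_Ico]
  omega

/-- Common form of `statGam` (`a = 0`) and `statY` (`a = 1`). -/
noncomputable def statLag (a : ℕ) (V : Fin d → Matrix (Fin d) (Fin K) ℝ) (N g : ℕ)
    (x z : ℕ → EuclideanSpace ℝ (Fin d)) : ℝ :=
  ∑ j, projRows V (lagMat a x (window₁ N g) - lagMat a z (window₁ N g)) j *
    projRows V (lagMat a x (window₂ N g) - lagMat a z (window₂ N g)) j

theorem statGam_eq (V : Fin d → Matrix (Fin d) (Fin K) ℝ) (N g : ℕ)
    (x z : ℕ → EuclideanSpace ℝ (Fin d)) : statGam V N g x z = statLag 0 V N g x z := by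
  rw [statLag, Fintype.sum_prod_type]
  rfl

theorem statY_eq (V : Fin d → Matrix (Fin d) (Fin K) ℝ) (N g : ℕ)
    (x z : ℕ → EuclideanSpace ℝ (Fin d)) : statY V N g x z = statLag 1 V N g x z := by
  rw [statLag, Fintype.sum_prod_type]
  rfl

theorem statLag_self (a : ℕ) (V : Fin d → Matrix (Fin d) (Fin K) ℝ) (N g : ℕ)
    (x : ℕ → EuclideanSpace ℝ (Fin d)) : statLag a V N g x x = 0 := by
  rw [statLag, sub_self, ← sub_self (0 : Matrix (Fin d) (Fin d) ℝ), projRows_sub]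
  simp

theorem inner_eq_sum_mul {J : Type*} [Fintype J] (u v : EuclideanSpace ℝ J) :
    inner ℝ u v = ∑ j, u j * v j := by
  simp [PiLp.inner_apply, mul_comm]

theorem abs_inner_sub_inner_le {E : Type*} [NormedAddCommGroup E] [InnerProductSpace ℝ E]
    (u v u' v' : E) :
    |inner ℝ u v - inner ℝ u' v'| ≤ ‖u - u'‖ * ‖v‖ + ‖u'‖ * ‖v - v'‖ := by
  have : inner ℝ u v - inner ℝ u' v' = inner ℝ (u - u') v + inner ℝ u' (v - v') := by
    rw [inner_sub_left, inner_sub_right]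
    ring
  rw [this]
  exact (abs_add_le _ _).trans (add_le_add (abs_real_inner_le_norm _ _)
    (abs_real_inner_le_norm _ _))

variable {Ω : Type*} [MeasurableSpace Ω] {μ : Measure Ω} {M : ℕ}
  {A W : Fin K → Matrix (Fin d) (Fin d) ℝ} {κ ρ Γmax Δ : ℝ} {lab : Fin M → Fin K} {T : Fin M → ℕ}
  {w x : Fin M → ℕ → Ω → EuclideanSpace ℝ (Fin d)}

theorem IsMixedLDS.sysState_bounds (H : ModelAssumptions A W κ ρ Γmax Δ)
    (h : IsMixedLDS μ A W lab T w x) {m : Fin M} {ω : Ω} {R : ℝ}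
    (hR : ∀ t ≤ T m + 1, ‖x m t ω‖ ≤ R) {s j N : ℕ} (hj : s + j ≤ T m + 1) (hN : N ≤ j) :
    ‖sysState (A (lab m)) (fun r => w m (s + r) ω) j‖ ≤ 2 * κ * R ∧
      ‖x m (s + j) ω - sysState (A (lab m)) (fun r => w m (s + r) ω) j‖ ≤ κ * ρ ^ N * R := by
  have hκ := H.one_le_kappa
  have hρ := H.rho_nonneg
  have e := h.eq_add_sysState m hj ω
  have hR0 : 0 ≤ R := (norm_nonneg _).trans (hR 0 (by omega))
  have hs := hR s (by omega)
  have h1 : ∀ {c : ℝ}, specNorm (A (lab m) ^ j) ≤ c →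
      ‖WithLp.toLp 2 (A (lab m) ^ j *ᵥ (x m s ω).ofLp)‖ ≤ c * R := fun hc =>
    (norm_mulVec_le _ _).trans (mul_le_mul hc hs (norm_nonneg _) ((specNorm_nonneg _).trans hc))
  constructor
  · have e2 : sysState (A (lab m)) (fun r => w m (s + r) ω) j =
        x m (s + j) ω - WithLp.toLp 2 (A (lab m) ^ j *ᵥ (x m s ω).ofLp) := by
      rw [e]; abel
    rw [e2]
    refine (norm_sub_le _ _).trans ?_
    have := h1 (H.specNorm_pow_le' (lab m) j)
    have := hR (s + j) hj
    nlinarith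
  · rw [e, add_sub_cancel_right]
    refine h1 ((H.specNorm_pow_le (lab m) j).trans ?_)
    exact mul_le_mul_of_nonneg_left (pow_le_pow_of_le_one hρ H.rho_lt_one.le hN) (by linarith)

/-- Restarting both trajectories from zero before each window barely changes the statistic. -/
theorem IsMixedLDS.abs_statLag_sub_le (H : ModelAssumptions A W κ ρ Γmax Δ)
    (h : IsMixedLDS μ A W lab T w x) {m n : Fin M} {ω : Ω} {R : ℝ}
    (hRm : ∀ t ≤ T m + 1, ‖x m t ω‖ ≤ R) (hRn : ∀ t ≤ T n + 1, ‖x n t ω‖ ≤ R) {a N g : ℕ}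
    (ha : a ≤ 1) (hm : 4 * (g * N) + 4 * N ≤ T m) (hn : 4 * (g * N) + 4 * N ≤ T n)
    {V : Fin d → Matrix (Fin d) (Fin K) ℝ} (hV : ∀ i, (V i)ᵀ * V i = 1) :
    |statLag a V N g (fun t => x m t ω) (fun t => x n t ω) -
      ∑ j, blockVec A lab w V a N m n (4 * (g * N)) ω j *
        blockVec A lab w V a N m n (4 * (g * N) + 2 * N) ω j| ≤
      60 * (κ ^ 4 * R ^ 4 * ρ ^ N) := by
  have hκ := H.one_le_kappa
  have hρ := H.rho_nonneg
  have hR0 : 0 ≤ R := (norm_nonneg _).trans (hRm 0 (by omega))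
  set S := Finset.Ico N (2 * N) with hS
  have hSt : ∀ t ∈ S, N ≤ t ∧ t < 2 * N := fun t ht => Finset.mem_Ico.1 ht
  set E := κ * ρ ^ N * R with hE
  have hE0 : 0 ≤ E := by positivity
  have one : ∀ {m : Fin M}, (∀ t ≤ T m + 1, ‖x m t ω‖ ≤ R) → ∀ {s : ℕ}, s + 2 * N ≤ T m →
      ‖flat (lagMat a (fun j => x m (s + 1 + j) ω) S)‖ ≤ R ^ 2 ∧
      ‖flat (lagMat a (sysState (A (lab m)) fun r => w m (s + 1 + r) ω) S)‖ ≤ (2 * κ * R) ^ 2 ∧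
      ‖flat (lagMat a (fun j => x m (s + 1 + j) ω) S) -
        flat (lagMat a (sysState (A (lab m)) fun r => w m (s + 1 + r) ω) S)‖ ≤
        E * (R + 2 * κ * R) := by
    intro m hR s hs
    have b : ∀ t ∈ S, ∀ c ≤ 1, _ := fun t ht c hc =>
      h.sysState_bounds H hR (s := s + 1) (j := t + c) (N := N)
        (by have := hSt t ht; omega) (by have := hSt t ht; omega)
    have hx : ∀ t ∈ S, ∀ c ≤ 1, ‖x m (s + 1 + (t + c)) ω‖ ≤ R := fun t ht c hc =>
      hR _ (by have := hSt t ht; omega)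
    refine ⟨norm_flat_lagMat_le hR0 fun t ht => ⟨hx t ht a ha, hx t ht 0 zero_le_one⟩,
      norm_flat_lagMat_le (by positivity) fun t ht => ⟨(b t ht a ha).1, (b t ht 0 zero_le_one).1⟩,
      norm_flat_lagMat_sub_le hE0 hR0 (by positivity) (fun t ht => hx t ht 0 zero_le_one)
      (fun t ht => (b t ht a ha).1) fun t ht => ⟨(b t ht a ha).2, (b t ht 0 zero_le_one).2⟩⟩
  have two : ∀ {s : ℕ}, s + 2 * N ≤ T m → s + 2 * N ≤ T n →
      ‖projRows V (lagMat a (fun j => x m (s + 1 + j) ω) S -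
        lagMat a (fun j => x n (s + 1 + j) ω) S)‖ ≤ 2 * R ^ 2 ∧
      ‖(WithLp.toLp 2 (blockVec A lab w V a N m n s ω) : EuclideanSpace ℝ (Fin d × Fin K))‖ ≤
        2 * (2 * κ * R) ^ 2 ∧
      ‖projRows V (lagMat a (fun j => x m (s + 1 + j) ω) S -
        lagMat a (fun j => x n (s + 1 + j) ω) S) -
        WithLp.toLp 2 (blockVec A lab w V a N m n s ω)‖ ≤ 2 * (E * (R + 2 * κ * R)) := by
    intro s hm hn
    obtain ⟨m1, m2, m3⟩ := one hRm hm
    obtain ⟨n1, n2, n3⟩ := one hRn hn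
    have eb : (WithLp.toLp 2 (blockVec A lab w V a N m n s ω) :
        EuclideanSpace ℝ (Fin d × Fin K)) =
        projRows V (lagMat a (sysState (A (lab m)) fun r => w m (s + 1 + r) ω) S -
          lagMat a (sysState (A (lab n)) fun r => w n (s + 1 + r) ω) S) := rfl
    refine ⟨?_, ?_, ?_⟩
    · refine (norm_projRows_le hV _).trans ?_
      rw [flat_sub]
      exact (norm_sub_le _ _).trans (by linarith)
    · rw [eb]
      refine (norm_projRows_le hV _).trans ?_
      rw [flat_sub]
      exact (norm_sub_le _ _).trans (by linarith)
    · rw [eb, ← projRows_sub]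
      refine (norm_projRows_le hV _).trans ?_
      rw [flat_sub, flat_sub, flat_sub, sub_sub_sub_comm]
      exact (norm_sub_le _ _).trans (by linarith)
  obtain ⟨a1, a2, a3⟩ := two (s := 4 * (g * N)) (by omega) (by omega)
  obtain ⟨b1, b2, b3⟩ := two (s := 4 * (g * N) + 2 * N) (by omega) (by omega)
  have e1 : statLag a V N g (fun t => x m t ω) (fun t => x n t ω) = inner ℝ
      (projRows V (lagMat a (fun j => x m (4 * (g * N) + 1 + j) ω) S -
        lagMat a (fun j => x n (4 * (g * N) + 1 + j) ω) S))
      (projRows V (lagMat a (fun j => x m (4 * (g * N) + 2 * N + 1 + j) ω) S -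
        lagMat a (fun j => x n (4 * (g * N) + 2 * N + 1 + j) ω) S)) := by
    rw [statLag, window₁_eq_map, window₂_eq_map]
    rw [lagMat_map_add, lagMat_map_add, lagMat_map_add, lagMat_map_add, inner_eq_sum_mul]
  have e2 : ∑ j, blockVec A lab w V a N m n (4 * (g * N)) ω j *
        blockVec A lab w V a N m n (4 * (g * N) + 2 * N) ω j = inner ℝ
      (WithLp.toLp 2 (blockVec A lab w V a N m n (4 * (g * N)) ω) :
        EuclideanSpace ℝ (Fin d × Fin K))
      (WithLp.toLp 2 (blockVec A lab w V a N m n (4 * (g * N) + 2 * N) ω)) :=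
    (inner_eq_sum_mul _ _).symm
  rw [e1, e2]
  refine (abs_inner_sub_inner_le _ _ _ _).trans ?_
  have hRR : R + 2 * κ * R ≤ 3 * κ * R := by nlinarith
  calc _ ≤ 2 * (E * (R + 2 * κ * R)) * (2 * R ^ 2) +
        2 * (2 * κ * R) ^ 2 * (2 * (E * (R + 2 * κ * R))) := by gcongr
    _ = 2 * E * (R + 2 * κ * R) * (2 * R ^ 2 + 8 * κ ^ 2 * R ^ 2) := by ring
    _ ≤ 2 * E * (3 * κ * R) * (2 * κ ^ 2 * R ^ 2 + 8 * κ ^ 2 * R ^ 2) := by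
        have : 2 * R ^ 2 ≤ 2 * κ ^ 2 * R ^ 2 := by
          have : 1 ≤ κ ^ 2 := one_le_pow₀ hκ
          nlinarith [sq_nonneg R]
        gcongr
    _ = _ := by rw [hE]; ring

end Perturbation
end MixedLDS

namespace MixedLDS

variable {d K : ℕ}

section RandomSubspaces

/-- A bound on an event for every fixed value of the first of two independent variables. -/
theorem measure_indepFun_le {Ω α β : Type*} [MeasurableSpace Ω] [MeasurableSpace α]
    [MeasurableSpace β] {μ : Measure Ω} [IsProbabilityMeasure μ] {f : Ω → α} {g : Ω → β}
    (hf : Measurable f) (hg : Measurable g) (hi : IndepFun f g μ) {B : Set (α × β)}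
    (hB : MeasurableSet B) {c : ENNReal} (h : ∀ᵐ ω ∂μ, μ {ω' | (f ω, g ω') ∈ B} ≤ c) :
    μ {ω | (f ω, g ω) ∈ B} ≤ c := by
  have := Measure.isProbabilityMeasure_map (μ := μ) hf.aemeasurable
  have := Measure.isProbabilityMeasure_map (μ := μ) hg.aemeasurable
  have e := (indepFun_iff_map_prod_eq_prod_map_map hf.aemeasurable hg.aemeasurable).1 hi
  calc μ {ω | (f ω, g ω) ∈ B} = μ.map (fun ω => (f ω, g ω)) B :=
        (Measure.map_apply (hf.prodMk hg) hB).symm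
    _ = ∫⁻ p, μ.map g (Prod.mk p ⁻¹' B) ∂μ.map f := by rw [e, Measure.prod_apply hB]
    _ = ∫⁻ ω, μ.map g (Prod.mk (f ω) ⁻¹' B) ∂μ :=
        lintegral_map (measurable_measure_prodMk_left hB) hf
    _ ≤ ∫⁻ _, c ∂μ := by
        refine lintegral_mono_ae (h.mono fun ω hω => ?_)
        rw [Measure.map_apply hg (measurable_prodMk_left hB)]
        exact hω
    _ = c := by simp

/-- The noise recovered from a path of length `L + 2`, zero at later times. -/
noncomputable def pathNoise (B : Matrix (Fin d) (Fin d) ℝ) (L : ℕ)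
    (q : Fin (L + 2) → EuclideanSpace ℝ (Fin d)) (t : ℕ) : EuclideanSpace ℝ (Fin d) :=
  if h : t ≤ L then q ⟨t + 1, by omega⟩ - toEuclideanCLM (𝕜 := ℝ) B (q ⟨t, by omega⟩) else 0

theorem measurable_pathNoise (B : Matrix (Fin d) (Fin d) ℝ) (L t : ℕ) :
    Measurable fun q => pathNoise B L q t := by
  unfold pathNoise
  split_ifs
  · exact (measurable_pi_apply _).sub
      ((toEuclideanCLM (𝕜 := ℝ) B).continuous.measurable.comp (measurable_pi_apply _))
  · exact measurable_const

variable {Ω : Type*} [MeasurableSpace Ω] {μ : Measure Ω} {M : ℕ}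
  {A W : Fin K → Matrix (Fin d) (Fin d) ℝ} {κ ρ Γmax Δ : ℝ} {lab : Fin M → Fin K} {T : Fin M → ℕ}
  {w x : Fin M → ℕ → Ω → EuclideanSpace ℝ (Fin d)}

/-- The noise may be taken to vanish after the end of the trajectories. -/
theorem IsMixedLDS.truncate (h : IsMixedLDS μ A W lab T w x) :
    IsMixedLDS μ A W lab T (fun m t => if t ≤ T m then w m t else 0) x where
  measurable_noise m t ht := by simpa [ht] using h.measurable_noise m t ht
  law_noise m t ht := by simpa [ht] using h.law_noise m t ht
  indep_noise := by
    have e : ∀ p : (m : Fin M) × Fin (T m + 1), (p.2 : ℕ) ≤ T p.1 := fun p => by omega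
    simpa [e] using h.indep_noise
  step m t ht ω := by simpa [ht] using h.step m t ht ω

theorem IsMixedLDS.pathNoise_eq (h : IsMixedLDS μ A W lab T w x)
    (hw : ∀ m t, T m < t → w m t = 0) (m : Fin M) (t : ℕ) (ω : Ω) :
    pathNoise (A (lab m)) (T m) (fun t => x m t ω) t = w m t ω := by
  unfold pathNoise
  split_ifs with ht
  · rw [sub_eq_iff_eq_add]
    exact (h.step m t ht ω).trans (add_comm _ _)
  · rw [hw m t (by omega)]
    rfl

/-- Deviation of a majority of the block products from `D²`. -/
def majorityDeviation (A : Fin K → Matrix (Fin d) (Fin d) ℝ) (lab : Fin M → Fin K)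
    (w : Fin M → ℕ → Ω → EuclideanSpace ℝ (Fin d)) (V : Fin d → Matrix (Fin d) (Fin K) ℝ)
    (a N G : ℕ) (m n : Fin M) (r D : ℝ) (ω : Ω) : Prop :=
  ∃ S : Finset (Fin G), G ≤ 2 * S.card ∧ ∀ g ∈ S, r <
    |∑ j, blockVec A lab w V a N m n (4 * (g * N)) ω j *
      blockVec A lab w V a N m n (4 * (g * N) + 2 * N) ω j - D ^ 2|

theorem IsMixedLDS.measure_majorityDeviation_le [IsProbabilityMeasure μ]
    (h : IsMixedLDS μ A W lab T w x) (hx : ZeroStart x ∨ ConsecutiveSegments T x)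
    (hw : ∀ m t, T m < t → w m t = 0) {m n : Fin M} {V : Ω → Fin d → Matrix (Fin d) (Fin K) ℝ}
    (hV : ∀ i j l, Measurable fun ω => V ω i j l)
    (hi : IndepFun (fun ω i j l => V ω i j l)
      (fun ω => ((fun t : Fin (T m + 2) => x m t ω), fun t : Fin (T n + 2) => x n t ω)) μ)
    {a N G : ℕ} (ha : a ≤ 1) {r D : ℝ} {c : ENNReal}
    (hc : ∀ᵐ ω ∂μ, μ {ω' | majorityDeviation A lab w (V ω) a N G m n r D ω'} ≤ c) :
    μ {ω | majorityDeviation A lab w (V ω) a N G m n r D ω} ≤ c := by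
  let P := (Fin d → Fin d → Fin K → ℝ) × ((Fin (T m + 2) → EuclideanSpace ℝ (Fin d)) ×
      (Fin (T n + 2) → EuclideanSpace ℝ (Fin d)))
  let pt : Ω → Ω → P := fun ω ω' => (fun i j l => V ω i j l, (fun t => x m t ω'), fun t => x n t ω')
  let bv : ℕ → P → Fin d × Fin K → ℝ := fun s p =>
    (projRows (fun i => Matrix.of (p.1 i)) (lagDiff a (Finset.Ico N (2 * N)) (A (lab m)) (A (lab n))
      (fun r => pathNoise (A (lab m)) (T m) p.2.1 (s + 1 + r))
      fun r => pathNoise (A (lab n)) (T n) p.2.2 (s + 1 + r))).ofLp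
  have hbv : ∀ s, Measurable (bv s) := by
    intro s
    refine measurable_projRows_lagDiff (R := 2 * N)
      (e₁ := fun r (p : P) => pathNoise (A (lab m)) (T m) p.2.1 (s + 1 + r))
      (e₂ := fun r (p : P) => pathNoise (A (lab n)) (T n) p.2.2 (s + 1 + r))
      (fun r _ => ?_) (fun r _ => ?_) (fun t ht => ?_) _ _
      (V := fun (p : P) i => Matrix.of (p.1 i)) fun i j l => ?_
    · exact (measurable_pathNoise _ _ _).comp (measurable_fst.comp measurable_snd)
    · exact (measurable_pathNoise _ _ _).comp (measurable_snd.comp measurable_snd)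
    · have := Finset.mem_Ico.1 ht
      omega
    · exact (measurable_pi_apply l).comp ((measurable_pi_apply j).comp
        ((measurable_pi_apply i).comp measurable_fst))
  have hxm : ∀ m, Measurable fun ω => (fun t : Fin (T m + 2) => x m t ω) := fun m =>
    measurable_pi_lambda _ fun t => h.measurable hx m (by omega)
  have hVm : Measurable fun ω i j l => V ω i j l := measurable_pi_lambda _ fun i =>
    measurable_pi_lambda _ fun j => measurable_pi_lambda _ fun l => hV i j l
  have key : ∀ ω ω' s, bv s (pt ω ω') =
      blockVec A lab w (V ω) a N m n s ω' := by
    intro ω ω' s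
    simp only [bv, pt, blockVec, h.pathNoise_eq hw]
    rfl
  let B : Set P := ⋃ S : Finset (Fin G), ⋃ _ : G ≤ 2 * S.card, ⋂ g ∈ S,
    {p | r < |∑ j, bv (4 * (g * N)) p j * bv (4 * (g * N) + 2 * N) p j - D ^ 2|}
  have hB : MeasurableSet B := MeasurableSet.iUnion fun S => MeasurableSet.iUnion fun _ =>
    Finset.measurableSet_biInter S fun g _ => measurableSet_lt_abs_dot_sub (hbv _) (hbv _) _ _
  have hmem : ∀ ω ω', pt ω ω' ∈ B ↔
      majorityDeviation A lab w (V ω) a N G m n r D ω' := by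
    intro ω ω'
    simp only [B, Set.mem_iUnion, Set.mem_iInter, exists_prop, majorityDeviation, ← key]
    rfl
  simp only [← hmem] at hc ⊢
  exact measure_indepFun_le hVm ((hxm m).prodMk (hxm n)) hi hB hc

/-- If no majority of the block products deviates, the median statistic is close to `D²`. -/
theorem IsMixedLDS.abs_median_statLag_sub_le (H : ModelAssumptions A W κ ρ Γmax Δ)
    (h : IsMixedLDS μ A W lab T w x) {m n : Fin M} {ω : Ω} {R : ℝ}
    (hRm : ∀ t ≤ T m + 1, ‖x m t ω‖ ≤ R) (hRn : ∀ t ≤ T n + 1, ‖x n t ω‖ ≤ R) {a N G : ℕ}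
    (ha : a ≤ 1) (hG : 0 < G) (hm : 4 * (G * N) ≤ T m) (hn : 4 * (G * N) ≤ T n)
    {V : Fin d → Matrix (Fin d) (Fin K) ℝ} (hV : ∀ i, (V i)ᵀ * V i = 1) {r D : ℝ}
    (hdev : ¬ majorityDeviation A lab w V a N G m n r D ω) :
    |median (fun g : Fin G => statLag a V N g (fun t => x m t ω) (fun t => x n t ω)) - D ^ 2| ≤
      r + 60 * (κ ^ 4 * R ^ 4 * ρ ^ N) := by
  have := median_mem_Icc (lo := D ^ 2 - (r + 60 * (κ ^ 4 * R ^ 4 * ρ ^ N)))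
    (hi := D ^ 2 + (r + 60 * (κ ^ 4 * R ^ 4 * ρ ^ N)))
    (a := fun g : Fin G => statLag a V N g (fun t => x m t ω) (fun t => x n t ω)) hG ?_
  · rw [abs_le]
    constructor <;> linarith [this.1, this.2]
  · intro S hS
    simp only [majorityDeviation, not_exists, not_and, not_forall, not_lt] at hdev
    obtain ⟨g, hg, hle⟩ := hdev S hS
    have hgN : (g : ℕ) * N + N ≤ G * N := by
      rw [← Nat.succ_mul]
      exact Nat.mul_le_mul_right N g.2
    have hp := h.abs_statLag_sub_le H hRm hRn ha (N := N) (g := g) (by omega) (by omega) hV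
    refine ⟨g, hg, ?_⟩
    rw [abs_le] at hp hle
    constructor <;> linarith [hp.1, hp.2, hle.1, hle.2]

end RandomSubspaces
end MixedLDS

namespace MixedLDS

section Numerics

variable {κ ρ Γmax Δ δ N k : ℝ} {d G L n₀ t : ℕ}

theorem le_block_length (hN : 8 ≤ N) (hL : (L : ℝ) = N * G) (hG : 0 < G) :
    N / 8 ≤ (L / (4 * G) : ℕ) := by
  have h1 := Nat.div_add_mod L (4 * G)
  have h2 := Nat.mod_lt L (show 4 * G > 0 by omega)
  have h3 : L < 4 * G * (L / (4 * G)) + 4 * G := by omega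
  have h4 : (L : ℝ) < 4 * G * (L / (4 * G) : ℕ) + 4 * G := by exact_mod_cast h3
  have hG' : (0 : ℝ) < G := by exact_mod_cast hG
  rw [hL] at h4
  have h5 : N < 4 * (L / (4 * G) : ℕ) + 4 := by
    refine lt_of_mul_lt_mul_right (a := (G : ℝ)) ?_ hG'.le
    linarith
  linarith

theorem eight_le_of_length (hκ : 1 ≤ κ) (hρ : 0 ≤ ρ) (hρ1 : ρ < 1) (hΓ : 0 ≤ Γmax) (hΔ : 0 < Δ)
    (hd : 0 < d) (ht : 0 < t) (hδ : 0 < δ) (hδ1 : δ < 1) (hk : 0 ≤ k)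
    (hN : 10 ^ 9 * (Γmax ^ 2 * κ ^ 2 * k / Δ ^ 2 + 1) * (1 / (1 - ρ)) *
      Real.log ((Γmax / Δ + 2) * (d * κ * t / δ)) ≤ N) : 8 ≤ N := by
  have hd1 : (1 : ℝ) ≤ d := by exact_mod_cast hd
  have ht1 : (1 : ℝ) ≤ t := by exact_mod_cast ht
  have hY1 : 1 ≤ d * κ * t / δ := by
    rw [le_div_iff₀ hδ, one_mul]
    exact hδ1.le.trans (one_le_mul_of_one_le_of_one_le
      (one_le_mul_of_one_le_of_one_le hd1 hκ) ht1)
  have hl2 : 2 ≤ (Γmax / Δ + 2) * (d * κ * t / δ) := by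
    have : 0 ≤ Γmax / Δ := by positivity
    nlinarith
  have hlog : 1 / 2 ≤ Real.log ((Γmax / Δ + 2) * (d * κ * t / δ)) :=
    le_trans (by linarith [Real.log_two_gt_d9]) (Real.log_le_log (by norm_num) hl2)
  have h1ρ : 1 ≤ 1 / (1 - ρ) := one_le_one_div (by linarith) (by linarith)
  have hQ0 : 0 ≤ Γmax ^ 2 * κ ^ 2 * k / Δ ^ 2 := by positivity
  calc (8 : ℝ) ≤ 10 ^ 9 * (0 + 1) * 1 * (1 / 2) := by norm_num
    _ ≤ _ := by gcongr
    _ ≤ N := hN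

theorem perturbation_numeric {b l p : ℝ} (hκ : 0 ≤ κ) (hκl : κ ≤ l) (hb : 0 ≤ b)
    (hbl : b ≤ Δ * l ^ 2) (hl : 2 ≤ l) (hp : 0 ≤ p) (hpl : p ≤ 1 / l ^ 40) :
    60 * (κ ^ 4 * (156 * b) ^ 2 * p) ≤ Δ ^ 2 / 100 := by
  have hl0 : 0 < l := by linarith
  have h1 : κ ^ 4 ≤ l ^ 4 := pow_le_pow_left₀ hκ hκl 4
  have h2 : (156 * b) ^ 2 ≤ (156 * (Δ * l ^ 2)) ^ 2 :=
    pow_le_pow_left₀ (by positivity) (by linarith) 2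
  have h3 : (2 : ℝ) ^ 32 ≤ l ^ 32 := pow_le_pow_left₀ (by norm_num) hl 32
  calc _ ≤ 60 * (l ^ 4 * (156 * (Δ * l ^ 2)) ^ 2 * (1 / l ^ 40)) :=
        mul_le_mul_of_nonneg_left (mul_le_mul (mul_le_mul h1 h2 (by positivity) (by positivity))
          hpl hp (by positivity)) (by norm_num)
    _ = 1460160 * Δ ^ 2 / l ^ 32 := by field_simp; ring
    _ ≤ 1460160 * Δ ^ 2 / 2 ^ 32 := div_le_div_of_nonneg_left (by positivity) (by norm_num) h3
    _ ≤ _ := by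
        have : 0 ≤ Δ ^ 2 := sq_nonneg _
        linarith

/-- Consequences of the lower bound on the trajectory length. -/
theorem length_numeric (hκ : 1 ≤ κ) (hρ : 0 ≤ ρ) (hρ1 : ρ < 1) (hΓ : 0 ≤ Γmax) (hΔ : 0 < Δ)
    (hd : 0 < d) (ht : 0 < t) (hδ : 0 < δ) (hδ1 : δ < 1) (hk : 0 ≤ k)
    (hn : N / 8 ≤ n₀)
    (hN : 10 ^ 9 * (Γmax ^ 2 * κ ^ 2 * k / Δ ^ 2 + 1) * (1 / (1 - ρ)) *
      Real.log ((Γmax / Δ + 2) * (d * κ * t / δ)) ≤ N) :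
    √d * (κ ^ 3 * Γmax * ρ ^ n₀) ≤ Δ / 400 ∧
    16 * (κ * Γmax) ^ 2 / (n₀ * (1 - ρ)) * k ≤ Δ ^ 2 / 2000000 ∧
    60 * (κ ^ 4 * (156 * (κ ^ 2 * d * (Γmax + Δ) * t / δ)) ^ 2 * ρ ^ n₀) ≤ Δ ^ 2 / 100 := by
  have hd1 : (1 : ℝ) ≤ d := by exact_mod_cast hd
  have ht1 : (1 : ℝ) ≤ t := by exact_mod_cast ht
  set Y := d * κ * t / δ with hY
  set X := Γmax / Δ + 2 with hX
  have hX2 : 2 ≤ X := by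
    have : 0 ≤ Γmax / Δ := by positivity
    linarith
  have hdκ : 1 ≤ d * κ := one_le_mul_of_one_le_of_one_le hd1 hκ
  have hYd : d * κ ≤ Y := by
    rw [hY, le_div_iff₀ hδ]
    calc d * κ * δ ≤ d * κ * 1 := by gcongr
      _ ≤ d * κ * t := by gcongr
  have hκd : κ ≤ d * κ := le_mul_of_one_le_left (by linarith) hd1
  have hY1 : 1 ≤ Y := hdκ.trans hYd
  set l := X * Y with hl
  have hXl : X ≤ l := le_mul_of_one_le_right (by linarith) hY1
  have hYl : Y ≤ l := le_mul_of_one_le_left (by linarith) (by linarith)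
  have hl2 : 2 ≤ l := hX2.trans hXl
  have hlog : 1 / 2 ≤ Real.log l :=
    le_trans (by linarith [Real.log_two_gt_d9]) (Real.log_le_log (by norm_num) hl2)
  have h1ρ : 0 < 1 - ρ := by linarith
  set Q := Γmax ^ 2 * κ ^ 2 * k / Δ ^ 2 with hQ
  have hQ0 : 0 ≤ Q := by positivity
  have hρn : ρ ^ n₀ ≤ 1 / l ^ 40 := by
    refine pow_le_of_log_le hρ hρ1 (by positivity) ?_
    rw [Real.log_pow]
    refine le_trans ?_ hn
    have : 320 * (1 / (1 - ρ) * Real.log l) ≤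
        10 ^ 9 * (Q + 1) * (1 / (1 - ρ)) * Real.log l := by
      rw [mul_assoc (10 ^ 9 * (Q + 1))]
      have h0 : 0 ≤ 1 / (1 - ρ) * Real.log l := by positivity
      refine mul_le_mul_of_nonneg_right ?_ h0
      nlinarith
    push_cast
    linarith
  have hκ0 : 0 ≤ κ := by linarith
  have hl0 : 0 < l := by linarith
  have hΓX : Γmax ≤ Δ * X := by
    rw [hX, mul_add, mul_div_cancel₀ _ hΔ.ne']
    linarith
  refine ⟨?_, ?_, ?_⟩
  · have hs : √(d : ℝ) ≤ d := Real.sqrt_le_iff.2 ⟨by linarith, by nlinarith⟩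
    calc √d * (κ ^ 3 * Γmax * ρ ^ n₀) ≤ d * (κ ^ 3 * (Δ * X) * (1 / l ^ 40)) := by gcongr
      _ = (d * κ) * κ ^ 2 * X * Δ / l ^ 40 := by ring
      _ ≤ l * l ^ 2 * l * Δ / l ^ 40 := by
          have h1 : d * κ ≤ l := hYd.trans hYl
          have h2 : κ ≤ l := hκd.trans h1
          gcongr
      _ = Δ / l ^ 36 := by field_simp
      _ ≤ Δ / 400 := by
          have : (400 : ℝ) ≤ l ^ 36 :=
            le_trans (by norm_num) (pow_le_pow_left₀ (by norm_num) hl2 36)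
          gcongr
  · have h3 : 10 ^ 9 * (Q + 1) * Real.log l ≤ N * (1 - ρ) := by
      have := mul_le_mul_of_nonneg_right hN h1ρ.le
      calc _ = 10 ^ 9 * (Q + 1) * (1 / (1 - ρ)) * Real.log l * (1 - ρ) := by field_simp
        _ ≤ _ := this
    have h4 : 10 ^ 9 * (Q + 1) * (1 / 2) ≤ N * (1 - ρ) := le_trans (by gcongr) h3
    have h5 : N / 8 * (1 - ρ) ≤ n₀ * (1 - ρ) := by gcongr
    have h6 : 32000000 * (Q + 1) ≤ n₀ * (1 - ρ) := by nlinarith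
    have h7 : 0 < n₀ * (1 - ρ) := by nlinarith
    have h8 : 16 * (κ * Γmax) ^ 2 * k = 16 * Q * Δ ^ 2 := by
      rw [hQ]
      field_simp
    rw [div_mul_eq_mul_div, div_le_iff₀ h7, h8]
    have : 0 ≤ Δ ^ 2 := sq_nonneg _
    nlinarith
  · have h1 : κ ≤ l := hκd.trans (hYd.trans hYl)
    have h2 : κ ^ 2 * d * (Γmax + Δ) * t / δ ≤ Δ * l ^ 2 := by
      have e : κ ^ 2 * d * (Γmax + Δ) * t / δ = κ * Y * (Γmax + Δ) := by
        rw [hY]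
        ring
      have h3 : Γmax + Δ ≤ Δ * X := by
        rw [hX, mul_add, mul_div_cancel₀ _ hΔ.ne']
        linarith
      rw [e]
      calc κ * Y * (Γmax + Δ) ≤ l * Y * (Δ * X) := by gcongr
        _ = Δ * l ^ 2 := by rw [hl]; ring
    exact perturbation_numeric hκ0 h1 (by positivity) h2 hl2 (by positivity) hρn

theorem copies_numeric {c : ℕ} (hc : 2 ≤ c) (hδ : 0 < δ) (hδ1 : δ < 1)
    (hG : 4 * Real.log (c / δ) ≤ G) : (c * c * (2 * (1 / 4 : ℝ) ^ G)) ≤ δ / 2 := by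
  have hc' : (2 : ℝ) ≤ c := by exact_mod_cast hc
  have hcδ : 0 < c / δ := by positivity
  have h4 : 1 ≤ Real.log 4 := by
    rw [show (4 : ℝ) = 2 ^ 2 by norm_num, Real.log_pow]
    push_cast
    linarith [Real.log_two_gt_d9]
  have h1 : (c / δ) ^ 4 ≤ (4 : ℝ) ^ G := by
    rw [← Real.log_le_log_iff (by positivity) (by positivity), Real.log_pow, Real.log_pow]
    push_cast
    refine hG.trans (le_mul_of_one_le_right (by positivity) h4)
  have h2 : (1 / 4 : ℝ) ^ G ≤ (δ / c) ^ 4 := by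
    rw [one_div, inv_pow, ← inv_div (c : ℝ) δ, inv_pow]
    exact inv_anti₀ (by positivity) h1
  calc _ ≤ c * c * (2 * (δ / c) ^ 4) := by gcongr
    _ = 2 * δ ^ 4 / c ^ 2 := by field_simp
    _ ≤ 2 * δ ^ 4 / 2 ^ 2 := by gcongr
    _ ≤ 2 * δ ^ 1 / 2 ^ 2 := by
        have := pow_le_pow_of_le_one hδ.le hδ1.le (show 1 ≤ 4 by norm_num)
        gcongr
    _ = δ / 2 := by ring

theorem radius_numeric {c : ℕ} (hκ : 1 ≤ κ) (hΓ : 0 ≤ Γmax) (hΔ : 0 < Δ) (hd : 0 < d) (hL : 0 < L)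
    (hct : c * L ≤ t) (ht : 0 < t) (hδ : 0 < δ) :
    c * (L + 2) * (21 * (κ ^ 2 * (d * Γmax)) / (156 * (κ ^ 2 * d * (Γmax + Δ) * t / δ))) ≤
      δ / 2 := by
  have hd1 : (0 : ℝ) < d := by exact_mod_cast hd
  have ht1 : (0 : ℝ) < t := by exact_mod_cast ht
  have hL1 : (1 : ℝ) ≤ L := by exact_mod_cast hL
  have hct' : (c : ℝ) * L ≤ t := by exact_mod_cast hct
  have h1 : (c : ℝ) * (L + 2) ≤ 3 * t := by
    calc (c : ℝ) * (L + 2) ≤ c * (L + 2 * L) := by gcongr; linarith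
      _ = 3 * (c * L) := by ring
      _ ≤ _ := by linarith
  have hκ0 : 0 < κ := by linarith
  calc _ ≤ 3 * t * (21 * (κ ^ 2 * (d * (Γmax + Δ))) /
        (156 * (κ ^ 2 * d * (Γmax + Δ) * t / δ))) := by gcongr; linarith
    _ = 63 / 156 * δ := by
        have : Γmax + Δ ≠ 0 := by positivity
        field_simp
        ring
    _ ≤ _ := by linarith

theorem threshold_numeric {τ D₀ D₁ s₀ s₁ : ℝ} (hΔ : 0 < Δ) (hτ : 1 / 8 < τ / Δ ^ 2)
    (hτ' : τ / Δ ^ 2 < 3 / 8)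
    (h₀ : |s₀ - D₀ ^ 2| ≤ (Δ ^ 2 + Δ * D₀) / 20 + Δ ^ 2 / 100)
    (h₁ : |s₁ - D₁ ^ 2| ≤ (Δ ^ 2 + Δ * D₁) / 20 + Δ ^ 2 / 100) {p : Prop}
    (hp : p → D₀ = 0 ∧ D₁ = 0) (hn : ¬ p → Δ ^ 2 ≤ D₀ ^ 2 + D₁ ^ 2) : s₀ + s₁ ≤ τ ↔ p := by
  have hΔ2 : 0 < Δ ^ 2 := by positivity
  rw [lt_div_iff₀ hΔ2] at hτ
  rw [div_lt_iff₀ hΔ2] at hτ'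
  rw [abs_le] at h₀ h₁
  by_cases h : p
  · obtain ⟨rfl, rfl⟩ := hp h
    simp only [h, iff_true]
    linarith [h₀.2, h₁.2]
  · simp only [h, iff_false, not_le]
    have := hn h
    nlinarith [sq_nonneg (Δ - D₀), sq_nonneg (Δ - D₁), h₀.1, h₁.1]

end Numerics
end MixedLDS

namespace MixedLDS

theorem similarity_eq_one_iff {d K : ℕ} {V U : Fin d → Matrix (Fin d) (Fin K) ℝ} {T G : ℕ} {τ : ℝ}
    {x z : ℕ → EuclideanSpace ℝ (Fin d)} : similarity V U T G τ x z = 1 ↔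
      median (fun g : Fin G => statLag 0 V (T / (4 * G)) g x z) +
        median (fun g : Fin G => statLag 1 U (T / (4 * G)) g x z) ≤ τ := by
  simp only [similarity, statGam_eq, statY_eq, ite_eq_left_iff, zero_ne_one, imp_false, not_not]

theorem similarity_self {d K : ℕ} {V U : Fin d → Matrix (Fin d) (Fin K) ℝ} {T G : ℕ} {τ : ℝ}
    (hτ : 0 ≤ τ) (x : ℕ → EuclideanSpace ℝ (Fin d)) : similarity V U T G τ x x = 1 := by
  rw [similarity_eq_one_iff]
  simpa [statLag_self, median_zero] using hτ

theorem ofReal_one_sub_le_of_compl {Ω : Type*} [MeasurableSpace Ω] {μ : Measure Ω}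
    [IsProbabilityMeasure μ] {δ : ℝ} (hδ : 0 ≤ δ) {s t : Set Ω} (ht : μ t ≤ ENNReal.ofReal δ)
    (hst : ∀ᵐ ω ∂μ, ω ∉ t → ω ∈ s) : ENNReal.ofReal (1 - δ) ≤ μ s := by
  have h1 : μ Set.univ ≤ μ (s ∪ t) := measure_mono_ae (hst.mono fun ω hω _ => by
    by_cases h : ω ∈ t
    · exact Or.inr h
    · exact Or.inl (hω h))
  rw [measure_univ] at h1
  rw [ENNReal.ofReal_sub _ hδ, ENNReal.ofReal_one, tsub_le_iff_right]
  exact h1.trans ((measure_union_le _ _).trans (by gcongr))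

section Clustering

variable {d K : ℕ} {Ω : Type*} [MeasurableSpace Ω] {μ : Measure Ω} {M : ℕ}
  {A W : Fin K → Matrix (Fin d) (Fin d) ℝ} {κ ρ Γmax Δ : ℝ} {lab : Fin M → Fin K} {T : Fin M → ℕ}
  {w x : Fin M → ℕ → Ω → EuclideanSpace ℝ (Fin d)}

/-- Frobenius distance of the lag-`a` stationary autocovariances of models `k` and `l`. -/
noncomputable def lagDist (A W : Fin K → Matrix (Fin d) (Fin d) ℝ) (a : ℕ) (k l : Fin K) : ℝ :=
  √(frobSq (A k ^ a * Gam (A k) (W k) - A l ^ a * Gam (A l) (W l)))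

theorem lagDist_self (A W : Fin K → Matrix (Fin d) (Fin d) ℝ) (a : ℕ) (k : Fin K) :
    lagDist A W a k k = 0 := by
  simp [lagDist, frobSq]

theorem ModelAssumptions.le_lagDist (H : ModelAssumptions A W κ ρ Γmax Δ) {k l : Fin K}
    (hkl : k ≠ l) : Δ ^ 2 ≤ lagDist A W 0 k l ^ 2 + lagDist A W 1 k l ^ 2 := by
  rw [lagDist, lagDist, Real.sq_sqrt (frobSq_nonneg _), Real.sq_sqrt (frobSq_nonneg _)]
  simpa [Yam] using H.separated k l hkl

/-- Exactness of the clustering off the events of large states and of majority deviations. -/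
theorem IsMixedLDS.similarity_iff (H : ModelAssumptions A W κ ρ Γmax Δ)
    (h : IsMixedLDS μ A W lab T w x) {m n : Fin M} {ω : Ω} {R : ℝ}
    (hRm : ∀ t ≤ T m + 1, ‖x m t ω‖ ≤ R) (hRn : ∀ t ≤ T n + 1, ‖x n t ω‖ ≤ R) {L G : ℕ}
    (hG : 0 < G) (hm : L ≤ T m) (hn : L ≤ T n)
    {V U : Fin d → Matrix (Fin d) (Fin K) ℝ} (hV : ∀ i, (V i)ᵀ * V i = 1)
    (hU : ∀ i, (U i)ᵀ * U i = 1) {τ : ℝ} (hτ : 1 / 8 < τ / Δ ^ 2) (hτ' : τ / Δ ^ 2 < 3 / 8)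
    (hdV : ¬ majorityDeviation A lab w V 0 (L / (4 * G)) G m n
      ((Δ ^ 2 + Δ * lagDist A W 0 (lab m) (lab n)) / 20) (lagDist A W 0 (lab m) (lab n)) ω)
    (hdU : ¬ majorityDeviation A lab w U 1 (L / (4 * G)) G m n
      ((Δ ^ 2 + Δ * lagDist A W 1 (lab m) (lab n)) / 20) (lagDist A W 1 (lab m) (lab n)) ω)
    (hpert : 60 * (κ ^ 4 * R ^ 4 * ρ ^ (L / (4 * G))) ≤ Δ ^ 2 / 100) :
    similarity V U L G τ (fun t => x m t ω) (fun t => x n t ω) = 1 ↔ lab m = lab n := by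
  have hL : 4 * (G * (L / (4 * G))) ≤ L := by
    rw [← mul_assoc]
    exact Nat.mul_div_le L (4 * G)
  have h0 := h.abs_median_statLag_sub_le H hRm hRn zero_le_one hG (hL.trans hm) (hL.trans hn) hV hdV
  have h1 := h.abs_median_statLag_sub_le H hRm hRn le_rfl hG (hL.trans hm) (hL.trans hn) hU hdU
  rw [similarity_eq_one_iff]
  refine threshold_numeric H.sep_pos hτ hτ' (h0.trans (by gcongr)) (h1.trans (by gcongr))
    (fun e => ?_) H.le_lagDist
  rw [e]
  exact ⟨lagDist_self _ _ _ _, lagDist_self _ _ _ _⟩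

end Clustering
end MixedLDS

open MixedLDS in
theorem theorem4 :
    ∃ C₁ C₂ c₃ : ℝ, 0 < C₁ ∧ 0 < C₂ ∧ 0 < c₃ ∧
      ∀ (Ω : Type*) [MeasurableSpace Ω] (μ : Measure Ω) [IsProbabilityMeasure μ]
        (d K M : ℕ)
        -- the models and their parameters
        (A W : Fin K → Matrix (Fin d) (Fin d) ℝ) (κ ρ Γmax Δ : ℝ)
        (_ : ModelAssumptions A W κ ρ Γmax Δ)
        -- the trajectories; those in `Mc` have common length `Tc` and are to be clustered
        (lab : Fin M → Fin K) (T : Fin M → ℕ) (Mc : Finset (Fin M)) (Tc : ℕ)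
        (_ : ∀ m ∈ Mc, T m = Tc)
        (w x : Fin M → ℕ → Ω → EuclideanSpace ℝ (Fin d))
        (_ : IsMixedLDS μ A W lab T w x)
        (_ : ZeroStart x ∨
          (ConsecutiveSegments T x ∧ ∀ m, 1 / (1 - ρ) * Real.log (√2 * κ) ≤ T m))
        -- confidence level, threshold, number of copies, length
        (δ τ N : ℝ) (G : ℕ) (_ : 0 < δ) (_ : δ < 1)
        (_ : 1 / 8 < τ / Δ ^ 2) (_ : τ / Δ ^ 2 < 3 / 8)
        (_ : 0 < N) (_ : (Tc : ℝ) = N * G)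
        (_ : C₁ * Real.log ((Mc.card : ℝ) / δ) ≤ G)
        (_ : C₂ * (Γmax ^ 2 * κ ^ 2 * √((d : ℝ) * K) / Δ ^ 2 + 1) * (1 / (1 - ρ)) *
          Real.log ((Γmax / Δ + 2) * (d * κ * (∑ m, T m : ℕ) / δ)) ≤ N)
        -- subspaces, independent of the trajectories to be clustered
        (V U : Ω → Fin d → Matrix (Fin d) (Fin K) ℝ)
        (_ : ∀ i a b, Measurable fun ω => V ω i a b)
        (_ : ∀ i a b, Measurable fun ω => U ω i a b)
        (_ : IndepFun (fun ω (i : Fin d) (a : Fin d) (b : Fin K) => (V ω i a b, U ω i a b))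
          (fun ω (m : Mc) (t : Fin (Tc + 2)) => x m t ω) μ)
        (_ : ∀ᵐ ω ∂μ, ApproxRows (V ω) (fun k => Gam (A k) (W k)) (c₃ * (Δ / √d)) ∧
          ApproxRows (U ω) (fun k => Yam (A k) (W k)) (c₃ * (Δ / √d))),
        ENNReal.ofReal (1 - δ) ≤
          μ {ω | ∀ m ∈ Mc, ∀ n ∈ Mc,
            similarity (V ω) (U ω) Tc G τ (fun t => x m t ω) (fun t => x n t ω) = 1 ↔
              lab m = lab n} := by
  refine ⟨4, 10 ^ 9, 1 / 400, by norm_num, by norm_num, by norm_num, ?_⟩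
  intro Ω _ μ _ d K M A W κ ρ Γmax Δ H lab T Mc Tc hT w₀ x h₀ hx δ τ N G hδ hδ1 hτ hτ' hN hTc hG
    hNL V U hVm hUm hind happ
  obtain ⟨w, h, hw⟩ : ∃ w, IsMixedLDS μ A W lab T w x ∧ ∀ m t, T m < t → w m t = 0 :=
    ⟨_, h₀.truncate, fun m t ht => if_neg (by omega)⟩
  have hΔ := H.sep_pos
  have hτ0 : 0 ≤ τ := by
    rw [lt_div_iff₀ (by positivity)] at hτ
    exact le_trans (by positivity) hτ.le
  have hx' : ZeroStart x ∨ ConsecutiveSegments T x := hx.imp_right And.left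
  have hsure : (∀ ω, ∀ m ∈ Mc, ∀ n ∈ Mc,
      similarity (V ω) (U ω) Tc G τ (fun t => x m t ω) (fun t => x n t ω) = 1 ↔ lab m = lab n) →
      ENNReal.ofReal (1 - δ) ≤ μ {ω | ∀ m ∈ Mc, ∀ n ∈ Mc,
        similarity (V ω) (U ω) Tc G τ (fun t => x m t ω) (fun t => x n t ω) = 1 ↔
          lab m = lab n} := fun hs =>
    ofReal_one_sub_le_of_compl (t := ∅) hδ.le (by simp) (ae_of_all _ fun ω _ => hs ω)
  rcases Nat.lt_or_ge Mc.card 2 with hc | hc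
  · refine hsure fun ω m hm n hn => ?_
    obtain rfl := Finset.card_le_one.1 (Nat.le_of_lt_succ hc) m hm n hn
    exact iff_of_true (similarity_self hτ0 _) rfl
  rcases Nat.eq_zero_or_pos d with rfl | hd
  · refine hsure fun ω m hm n hn => iff_of_true ?_ ?_
    · rw [similarity_eq_one_iff]
      simpa [statLag, median_zero] using hτ0
    · by_contra hne
      have := H.separated _ _ hne
      simp only [frobSq, Finset.univ_eq_empty, Finset.sum_empty, add_zero] at this
      exact absurd this (not_le.2 (by positivity))
  have hc2 : (2 : ℝ) ≤ Mc.card := by exact_mod_cast hc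
  have hG0 : 0 < G := by
    have h1 : 1 < (Mc.card : ℝ) / δ := by
      rw [lt_div_iff₀ hδ]
      linarith
    have h2 := Real.log_pos h1
    exact_mod_cast (show (0 : ℝ) < 4 * Real.log (Mc.card / δ) by positivity).trans_le hG
  have hTc0 : 0 < Tc := by
    have : (0 : ℝ) < Tc := by
      rw [hTc]
      positivity
    exact_mod_cast this
  have hcT : Mc.card * Tc ≤ ∑ m, T m := by
    rw [← smul_eq_mul, ← Finset.sum_const]
    refine (Finset.sum_le_sum fun m hm => (hT m hm).ge).trans ?_
    exact Finset.sum_le_sum_of_subset (Finset.subset_univ _)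
  have ht0 : 0 < ∑ m, T m := (Nat.mul_pos (by omega) hTc0).trans_le hcT
  obtain ⟨m₀, -⟩ : Mc.Nonempty := Finset.card_pos.1 (by omega)
  have hΓ := H.gammaMax_nonneg (lab m₀)
  have hκ := H.one_le_kappa
  have hN8 : 8 ≤ N := eight_le_of_length hκ H.rho_nonneg H.rho_lt_one hΓ hΔ hd ht0 hδ hδ1
    (Real.sqrt_nonneg _) hNL
  have hn₀ := le_block_length hN8 hTc hG0
  obtain ⟨hβ, hσ, hp⟩ := length_numeric hκ H.rho_nonneg H.rho_lt_one hΓ hΔ hd ht0 hδ hδ1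
    (Real.sqrt_nonneg _) hn₀ hNL
  have hn₀' : 0 < Tc / (4 * G) := by
    have : (0 : ℝ) < (Tc / (4 * G) : ℕ) := by linarith
    exact_mod_cast this
  have hL : 4 * (G * (Tc / (4 * G))) ≤ Tc := by
    rw [← mul_assoc]
    exact Nat.mul_div_le Tc (4 * G)
  set B := 156 * (κ ^ 2 * d * (Γmax + Δ) * (∑ m, T m : ℕ) / δ) with hB
  have hB0 : 0 < B := by positivity
  have hR2 : √B ^ 2 = B := Real.sq_sqrt hB0.le
  have hR4 : √B ^ 4 = B ^ 2 := by
    rw [show 4 = 2 * 2 from rfl, pow_mul, hR2]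
  rw [← hR4] at hp
  have hrad : μ {ω | ∃ m ∈ Mc, ∃ t ∈ Finset.range (Tc + 2), √B < ‖x m t ω‖} ≤
      ENNReal.ofReal (δ / 2) := by
    rw [← ofReal_measureReal]
    refine ENNReal.ofReal_le_ofReal ((h.measureReal_exists_norm_gt_le H hx Mc hT
      (Real.sqrt_pos.2 hB0)).trans ?_)
    rw [hR2]
    exact radius_numeric hκ hΓ hΔ hd hTc0 hcT ht0 hδ
  have hdev : ∀ {a : ℕ}, a ≤ 1 → ∀ {F : Ω → Fin d → Matrix (Fin d) (Fin K) ℝ},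
      (∀ i j l, Measurable fun ω => F ω i j l) →
      (IndepFun (fun ω i j l => F ω i j l) (fun ω (m : Mc) (t : Fin (Tc + 2)) => x m t ω) μ) →
      (∀ᵐ ω ∂μ, ApproxRows (F ω) (fun k => A k ^ a * Gam (A k) (W k)) (1 / 400 * Δ / √d)) →
      ∀ m ∈ Mc, ∀ n ∈ Mc, μ {ω | majorityDeviation A lab w (F ω) a (Tc / (4 * G)) G m n
        ((Δ ^ 2 + Δ * lagDist A W a (lab m) (lab n)) / 20) (lagDist A W a (lab m) (lab n)) ω} ≤
        ENNReal.ofReal ((1 / 4) ^ G) := by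
    intro a ha F hF hFi hFa m hm n hn
    have hTm := hT m hm
    have hTn := hT n hn
    refine h.measure_majorityDeviation_le hx' hw hF ?_ ha (hFa.mono fun ω hω => ?_)
    · have hψ : Measurable fun q : Mc → Fin (Tc + 2) → EuclideanSpace ℝ (Fin d) =>
          ((fun t : Fin (T m + 2) => q ⟨m, hm⟩ (Fin.cast (by rw [hTm]) t)),
            fun t : Fin (T n + 2) => q ⟨n, hn⟩ (Fin.cast (by rw [hTn]) t)) := by fun_prop
      exact hFi.comp measurable_id hψ
    · rw [← ofReal_measureReal]
      exact ENNReal.ofReal_le_ofReal (h.measureReal_majority_le H ha hn₀' hd (hL.trans hTm.ge)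
        (hL.trans hTn.ge) hω hβ hσ rfl)
  have hfst : Measurable fun (q : Fin d → Fin d → Fin K → ℝ × ℝ) i j l => (q i j l).1 := by fun_prop
  have hsnd : Measurable fun (q : Fin d → Fin d → Fin K → ℝ × ℝ) i j l => (q i j l).2 := by fun_prop
  have hdV := hdev zero_le_one hVm (hind.comp hfst measurable_id)
    (happ.mono fun ω hω => by simpa [mul_div_assoc] using hω.1)
  have hdU := hdev le_rfl hUm (hind.comp hsnd measurable_id)
    (happ.mono fun ω hω => by simpa [mul_div_assoc, Yam] using hω.2)
  refine ofReal_one_sub_le_of_compl hδ.le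
    (t := {ω | ∃ m ∈ Mc, ∃ t ∈ Finset.range (Tc + 2), √B < ‖x m t ω‖} ∪ ⋃ m ∈ Mc, ⋃ n ∈ Mc,
      ({ω | majorityDeviation A lab w (V ω) 0 (Tc / (4 * G)) G m n
          ((Δ ^ 2 + Δ * lagDist A W 0 (lab m) (lab n)) / 20) (lagDist A W 0 (lab m) (lab n)) ω} ∪
        {ω | majorityDeviation A lab w (U ω) 1 (Tc / (4 * G)) G m n
          ((Δ ^ 2 + Δ * lagDist A W 1 (lab m) (lab n)) / 20) (lagDist A W 1 (lab m) (lab n)) ω}))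
    ?_ ?_
  · have hpair : (∑ _m ∈ Mc, ∑ _n ∈ Mc,
        (ENNReal.ofReal ((1 / 4) ^ G) + ENNReal.ofReal ((1 / 4) ^ G))) ≤
        ENNReal.ofReal (δ / 2) := by
      rw [Finset.sum_const, Finset.sum_const, ← ENNReal.ofReal_add (by positivity) (by positivity),
        ← ENNReal.ofReal_nsmul, ← ENNReal.ofReal_nsmul]
      refine ENNReal.ofReal_le_ofReal (le_trans (le_of_eq ?_) (copies_numeric hc hδ hδ1 hG))
      simp only [nsmul_eq_mul]
      ring
    rw [← add_halves δ, ENNReal.ofReal_add (by positivity) (by positivity)]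
    refine (measure_union_le _ _).trans (add_le_add hrad (le_trans ?_ hpair))
    refine (measure_biUnion_finset_le _ _).trans (Finset.sum_le_sum fun m hm => ?_)
    refine (measure_biUnion_finset_le _ _).trans (Finset.sum_le_sum fun n hn => ?_)
    exact (measure_union_le _ _).trans (add_le_add (hdV m hm n hn) (hdU m hm n hn))
  · filter_upwards [happ] with ω hω hgood
    simp only [Set.mem_union, Set.mem_iUnion, Set.mem_ofPred_eq, not_or, not_exists, not_and,
      exists_prop, not_lt] at hgood
    intro m hm n hn
    have hb : ∀ m ∈ Mc, ∀ t ≤ T m + 1, ‖x m t ω‖ ≤ √B := fun m hm t ht =>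
      hgood.1 m hm t (Finset.mem_range.2 (by rw [hT m hm] at ht; omega))
    exact h.similarity_iff H (hb m hm) (hb n hn) hG0 (hT m hm).ge (hT n hn).ge
      (fun i => (hω.1 i).1) (fun i => (hω.2 i).1) hτ hτ' (hgood.2 m hm n hn).1
      (hgood.2 m hm n hn).2 hp
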